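/- **Setting.** Let $\mathcal H$ be a finite class of measurable classifiers $h:\mathcal X\to\{\pm1\}$ and $\mathcal D$ a distribution on $\mathcal X\times\{\pm1\}$ with marginal $\mathcal D_X$. Write $\mathrm{err}(h)=\Pr_{\mathcal D}(h(X)\ne Y)$, let $h^*\in\mathcal H$ minimize $\mathrm{err}$ over $\mathcal H$, and for $A\subseteq\mathcal H$ put $\mathrm{DIS}(A)=\{x:\exists h,h'\in A,\ h(x)\neq h'(x)\}$. For a multiset $S$ of weighted labeled examples let $\mathrm{err}(h,S)=\frac1{|S|}\sum_{(x,y,w)\in S}w\,\mathbf 1(h(x)\ne y)$. The disagreement coefficient is $$\theta=\sup_{r>0}\frac{\mathcal D_X\{x:\exists h\in\mathcal H,\ h^*(x)\ne h(x),\ \mathcal D_X\{x':h(x')\ne h^*(x')\}\le r\}}{r}.$$ **Algorithm (Active Cover).** Let $M\ge1$, let the epoch schedule satisfy $0=\tau_0<3=\tau_1<\tau_2<\dots<\tau_M=n$ with $\tau_{m+1}\le2\tau_m$ for $1\le m<M$, let $0<\delta<1/e$ with $|\mathcal H|/\delta>\sqrt{192}$, and put $\epsilon_m=32\,(\log(|\mathcal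 H|/\delta)+\log\tau_m)/\tau_m$. The constants satisfy $$\alpha\ge1,\quad \eta\ge864,\quad \xi\le\frac1{8n\epsilon_M\log n},\quad \beta^2\le\frac{\eta}{864\,\gamma n\epsilon_M\log n},\quad \gamma\ge\frac\eta4,\quad c_1\ge2\alpha\sqrt6,\quad c_2\ge\frac{\eta c_1^2}4,\quad c_3\ge1.$$ The examples $(X_1,Y_1),\dots,(X_n,Y_n)$ are i.i.d. from $\mathcal D$. In epoch $1$ the three labels are queried and the examples are stored with weight $1$; $A_1=\mathcal H$. Let $\tilde Z_m$ be the multiset of examples stored in epochs $1,\dots,m$, let $h_{m+1}$ be a minimizer of $\mathrm{err}(\cdot,\tilde Z_m)$ over $\mathcal H$, and put $$\Delta_m=c_1\sqrt{\epsilon_m\,\mathrm{err}(h_{m+1},\tilde Z_m)}+c_2\epsilon_m\log\tau_m,\qquad A_{m+1}=\{h\in\mathcal H:\mathrm{err}(h,\tilde Z_m)-\mathrm{err}(h_{m+1},\tilde Z_m)\le\gamma\Delta_m\},\qquad D_m=\mathrm{DIS}(A_m).$$ For $2\le m\le M$ the query probability function $P_m:\mathcal X\to[0,1]$ minimizes $\mathbb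 E_X[1/(1-P(X))]$ subject to $P\ge P_{\min,m}$ on $D_m$ and, for all $h\in\mathcal H$, $$\mathbb E_X\Big[\tfrac{\mathbf 1(h(X)\ne h_m(X),\,X\in D_m)}{P(X)}\Big]\le 2\alpha^2\Pr(h(X)\ne h_m(X),X\in D_m)+2\beta^2\gamma\big(\mathrm{err}(h,\tilde Z_{m-1})-\mathrm{err}(h_m,\tilde Z_{m-1})\big)\tau_{m-1}\Delta_{m-1}+\xi\tau_{m-1}\Delta_{m-1}^2,$$ where $P_{\min,m}=\min\Big(c_3\Big/\Big(\sqrt{\tau_{m-1}\mathrm{err}(h_m,\tilde Z_{m-1})/(n\epsilon_M)}+\log\tau_{m-1}\Big),\tfrac12\Big)$. The choices of $h_m$ and $P_m$ depend only on what was seen before epoch $m$. For an example $i$ of epoch $m\ge2$: if $X_i\in D_m$, the label is queried with probability $P_m(X_i)$, independently of all else given the past and $X_i$, and $(X_i,Y_i,1/P_m(X_i))$ is stored if it is queried, an example of weight $0$ otherwise; if $X_i\notin D_m$, the label is not queried and $(X_i,h_m(X_i),1)$ is stored. **Theorem.** Put $$\overline{\mathrm{err}}_M(h^*)=\frac1n\sum_{j=1}^M(\tau_j-\tau_{j-1})\,\Pr_{(X,Y)\sim\mathcal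 D}\big(h^*(X)\ne Y,\ X\in D_j\big).$$ There are an absolute integer $k$ and a constant $C$ depending only on $c_1,c_2,\gamma$ such that, for every run as above, with probability at least $1-\delta$ the number of labels queried among the $n$ examples is at most $$4\theta\,\overline{\mathrm{err}}_M(h^*)\,n+\theta\cdot C(\log n)^k\Big(\sqrt{n\,\overline{\mathrm{err}}_M(h^*)\log(|\mathcal H|/\delta)}+\log(|\mathcal H|/\delta)\Big)+4\log\frac{8\log n}{\delta}.$$ -/

import Mathlib

open MeasureTheory ProbabilityTheory

namespace ActiveCover

/-! Labels `±1` are encoded by `Bool`; a classifier is a map `𝒳 → Bool`, and the class of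
classifiers is a finite set `H : Finset (𝒳 → Bool)`. `ν` is the distribution of `(X, Y)`. -/

noncomputable section

universe u v

variable {𝒳 : Type u}

/-! ### Population quantities -/

/-- Disagreement region of a set of classifiers. -/
def DIS (A : Set (𝒳 → Bool)) : Set 𝒳 := {x | ∃ h ∈ A, ∃ h' ∈ A, h x ≠ h' x}

/-- Expected error `Pr (h(X) ≠ Y)`. -/
def popErr [MeasurableSpace 𝒳] (ν : Measure (𝒳 × Bool)) (h : 𝒳 → Bool) : ℝ :=
  ν.real {z | h z.1 ≠ z.2}

/-- Expected error inside a region, `Pr (h(X) ≠ Y ∧ X ∈ D)`. -/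
def popErrOn [MeasurableSpace 𝒳] (ν : Measure (𝒳 × Bool)) (D : Set 𝒳) (h : 𝒳 → Bool) : ℝ :=
  ν.real {z | h z.1 ≠ z.2 ∧ z.1 ∈ D}

/-- `h` is an error minimizer in `H`. -/
def IsBest [MeasurableSpace 𝒳] (ν : Measure (𝒳 × Bool)) (H : Finset (𝒳 → Bool))
    (h : 𝒳 → Bool) : Prop :=
  h ∈ H ∧ ∀ g ∈ H, popErr ν h ≤ popErr ν g

/-- `{x | ∃ h ∈ H, h*(x) ≠ h(x), Pr (h ≠ h*) ≤ r}` for a marginal `ρ` on `𝒳`. -/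
def ballDisagreement [MeasurableSpace 𝒳] (ρ : Measure 𝒳) (H : Finset (𝒳 → Bool))
    (hstar : 𝒳 → Bool) (r : ℝ) : Set 𝒳 :=
  {x | ∃ h ∈ H, hstar x ≠ h x ∧ ρ.real {x' | h x' ≠ hstar x'} ≤ r}

/-- Disagreement coefficient `θ(h*)`, a supremum over `r > 0`. The set is bounded, see
`disagreementCoeff_bddAbove`. -/
def disagreementCoeff [MeasurableSpace 𝒳] (ρ : Measure 𝒳) (H : Finset (𝒳 → Bool))
    (hstar : 𝒳 → Bool) : ℝ :=
  sSup {t | ∃ r : ℝ, 0 < r ∧ t = ρ.real (ballDisagreement ρ H hstar r) / r}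

theorem disagreementCoeff_bddAbove [MeasurableSpace 𝒳] (ρ : Measure 𝒳) [IsFiniteMeasure ρ]
    (H : Finset (𝒳 → Bool)) (hstar : 𝒳 → Bool) :
    BddAbove {t | ∃ r : ℝ, 0 < r ∧ t = ρ.real (ballDisagreement ρ H hstar r) / r} := by
  classical
  refine ⟨H.card, ?_⟩
  rintro t ⟨r, hr, rfl⟩
  rw [div_le_iff₀ hr]
  set F := H.filter (fun h => ρ.real {x' | h x' ≠ hstar x'} ≤ r) with hF
  have hsub : ballDisagreement ρ H hstar r ⊆ ⋃ h ∈ F, {x' | h x' ≠ hstar x'} := by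
    rintro x ⟨h, hh, hx, hd⟩
    simp only [Set.mem_iUnion]
    exact ⟨h, by simp [hF, hh]; simpa using hd, fun e => hx e.symm⟩
  calc ρ.real (ballDisagreement ρ H hstar r)
      ≤ ρ.real (⋃ h ∈ F, {x' | h x' ≠ hstar x'}) := measureReal_mono hsub (measure_ne_top _ _)
    _ ≤ ∑ h ∈ F, ρ.real {x' | h x' ≠ hstar x'} := measureReal_biUnion_finset_le _ _
    _ ≤ ∑ _h ∈ F, r := Finset.sum_le_sum fun h hh => (Finset.mem_filter.1 hh).2
    _ = F.card * r := by simp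
    _ ≤ H.card * r := by
        gcongr
        exact Finset.filter_subset _ _

/-! ### Inputs of the algorithm -/

/-- Inputs of the algorithm: constants, confidence `δ`, number of epochs `M` and epoch
schedule `τ 0, …, τ M`. (`η` occurs only in the conditions on the constants.) -/
structure Params where
  c₁ : ℝ
  c₂ : ℝ
  c₃ : ℝ
  α : ℝ
  β : ℝ
  γ : ℝ
  η : ℝ
  ξ : ℝ
  δ : ℝ
  M : ℕ
  τ : ℕ → ℕ

/-- Number of examples in the stream: the end of the last epoch. -/
def Params.n (p : Params) : ℕ := p.τ p.M

/-- `ε_m = 32 (log (|H|/δ) + log τ_m) / τ_m`. -/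
def Params.eps (p : Params) (H : Finset (𝒳 → Bool)) (m : ℕ) : ℝ :=
  32 * (Real.log (H.card / p.δ) + Real.log (p.τ m)) / p.τ m

/-- Conditions on the epoch schedule and on the constants. -/
structure Params.Valid (p : Params) (H : Finset (𝒳 → Bool)) : Prop where
  one_le_M : 1 ≤ p.M
  τ_zero : p.τ 0 = 0
  τ_one : p.τ 1 = 3
  τ_lt : ∀ m, 1 ≤ m → m < p.M → p.τ m < p.τ (m + 1)
  τ_le : ∀ m, 1 ≤ m → m < p.M → p.τ (m + 1) ≤ 2 * p.τ m
  α_ge : 1 ≤ p.α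
  η_ge : 864 ≤ p.η
  ξ_le : p.ξ ≤ 1 / (8 * p.n * p.eps H p.M * Real.log p.n)
  β_le : p.β ^ 2 ≤ p.η / (864 * p.γ * p.n * p.eps H p.M * Real.log p.n)
  γ_ge : p.η / 4 ≤ p.γ
  c₁_ge : 2 * p.α * √6 ≤ p.c₁
  c₂_ge : p.η * p.c₁ ^ 2 / 4 ≤ p.c₂
  c₃_ge : 1 ≤ p.c₃

/-! ### One execution of the algorithm -/

/-- The quantities met in one execution: the examples `(x i, y i)` (`i ≥ 1`), the query
decisions `q i`, and for every epoch `m` the classifier `h m` and the query probability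
function `P m`. -/
structure Path (𝒳 : Type u) where
  x : ℕ → 𝒳
  y : ℕ → Bool
  q : ℕ → Bool
  h : ℕ → 𝒳 → Bool
  P : ℕ → 𝒳 → ℝ

/-- Importance weighted empirical error on a multiset of examples `(x, y, w)`. -/
def empErr (h : 𝒳 → Bool) (S : Multiset (𝒳 × Bool × ℝ)) : ℝ :=
  (S.map fun e => e.2.2 * (if h e.1 ≠ e.2.1 then 1 else 0)).sum / S.card

/-- `c₁ √(ε_m e) + c₂ ε_m log τ_m`. -/
def Params.radius (p : Params) (H : Finset (𝒳 → Bool)) (m : ℕ) (e : ℝ) : ℝ :=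
  p.c₁ * √(p.eps H m * e) + p.c₂ * p.eps H m * Real.log (p.τ m)

/-- The set `A_m`, computed from the sample `S` collected in the epochs before `m`;
`A_1` is the whole class. -/
def goodFrom (p : Params) (H : Finset (𝒳 → Bool)) (r : Path 𝒳) (m : ℕ)
    (S : Multiset (𝒳 × Bool × ℝ)) : Set (𝒳 → Bool) :=
  if m ≤ 1 then {g | g ∈ H}
  else {g | g ∈ H ∧
    empErr g S - empErr (r.h m) S ≤ p.γ * p.radius H (m - 1) (empErr (r.h m) S)}

open Classical in
/-- The weighted example that the algorithm stores for example `i` of epoch `m`, where `D` is the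
disagreement region of epoch `m`. In the first epoch all labels are queried and stored with
weight one. -/
def weightedExample (r : Path 𝒳) (D : Set 𝒳) (m i : ℕ) : 𝒳 × Bool × ℝ :=
  if m ≤ 1 then (r.x i, r.y i, 1)
  else if r.x i ∈ D then
    (if r.q i = true then (r.x i, r.y i, 1 / r.P m (r.x i)) else (r.x i, true, 0))
  else (r.x i, r.h m (r.x i), 1)

/-- The sample (multiset of weighted examples) collected in the epochs `1, …, m`. -/
def sample (p : Params) (H : Finset (𝒳 → Bool)) (r : Path 𝒳) : ℕ → Multiset (𝒳 × Bool × ℝ)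
  | 0 => 0
  | m + 1 => sample p H r m +
      (Finset.Ioc (p.τ m) (p.τ (m + 1))).val.map
        (weightedExample r (DIS (goodFrom p H r (m + 1) (sample p H r m))) (m + 1))

/-- The set `A_m` of empirically good classifiers in epoch `m ≥ 1`. -/
def good (p : Params) (H : Finset (𝒳 → Bool)) (r : Path 𝒳) (m : ℕ) : Set (𝒳 → Bool) :=
  goodFrom p H r m (sample p H r (m - 1))

/-- The disagreement region `D_m = DIS (A_m)` of epoch `m ≥ 1`. -/
def region (p : Params) (H : Finset (𝒳 → Bool)) (r : Path 𝒳) (m : ℕ) : Set 𝒳 :=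
  DIS (good p H r m)

/-- `Δ_m` for `m ≥ 1`, computed from the empirical error of the minimizer `h_{m+1}`. -/
def Delta (p : Params) (H : Finset (𝒳 → Bool)) (r : Path 𝒳) (m : ℕ) : ℝ :=
  p.radius H m (empErr (r.h (m + 1)) (sample p H r m))

/-- Number of labels queried among the `n` examples. -/
def numQueries (p : Params) (r : Path 𝒳) : ℕ :=
  ((Finset.Icc 1 p.n).filter fun i => r.q i = true).card

/-- Average over the epochs `1, …, m`, weighted by their lengths, of the expected error of `h`
inside the disagreement region. -/
def errAvg [MeasurableSpace 𝒳] (ν : Measure (𝒳 × Bool)) (p : Params) (H : Finset (𝒳 → Bool))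
    (r : Path 𝒳) (m : ℕ) (h : 𝒳 → Bool) : ℝ :=
  1 / (p.τ m : ℝ) * ∑ j ∈ Finset.Icc 1 m,
    ((p.τ j : ℝ) - p.τ (j - 1)) * popErrOn ν (region p H r j) h

/-! ### The optimization problem for the query probabilities of epoch `m ≥ 2` -/

/-- `h` disagrees with `h_m` at a point of `D_m`. -/
def disSet (p : Params) (H : Finset (𝒳 → Bool)) (r : Path 𝒳) (m : ℕ) (h : 𝒳 → Bool) : Set 𝒳 :=
  {x | h x ≠ r.h m x ∧ x ∈ region p H r m}

/-- Right-hand side `b_m(h)` of the variance constraint. -/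
def varBound [MeasurableSpace 𝒳] (ν : Measure (𝒳 × Bool)) (p : Params) (H : Finset (𝒳 → Bool))
    (r : Path 𝒳) (m : ℕ) (h : 𝒳 → Bool) : ℝ :=
  2 * p.α ^ 2 * (ν.map Prod.fst).real (disSet p H r m h)
    + 2 * p.β ^ 2 * p.γ *
        (empErr h (sample p H r (m - 1)) - empErr (r.h m) (sample p H r (m - 1))) *
        p.τ (m - 1) * Delta p H r (m - 1)
    + p.ξ * p.τ (m - 1) * Delta p H r (m - 1) ^ 2

/-- Minimum query probability `P_{min,m}`. -/
def Pmin (p : Params) (H : Finset (𝒳 → Bool)) (r : Path 𝒳) (m : ℕ) : ℝ :=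
  min (p.c₃ / (√(p.τ (m - 1) * empErr (r.h m) (sample p H r (m - 1)) / (p.n * p.eps H p.M))
    + Real.log (p.τ (m - 1)))) (1 / 2)

/-- Feasibility of the query probability function `P` in epoch `m`. -/
structure Feasible [MeasurableSpace 𝒳] (ν : Measure (𝒳 × Bool)) (p : Params)
    (H : Finset (𝒳 → Bool)) (r : Path 𝒳) (m : ℕ) (P : 𝒳 → ℝ) : Prop where
  measurable : Measurable P
  nonneg : ∀ x, 0 ≤ P x
  le_one : ∀ x, P x ≤ 1
  ge_min : ∀ x ∈ region p H r m, Pmin p H r m ≤ P x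
  variance : ∀ h ∈ H,
    ∫ x, (disSet p H r m h).indicator (fun x => 1 / P x) x ∂(ν.map Prod.fst) ≤ varBound ν p H r m h

/-- Objective `E [1 / (1 - P(X))]`, with value `∞` allowed. -/
def objective [MeasurableSpace 𝒳] (ν : Measure (𝒳 × Bool)) (P : 𝒳 → ℝ) : ENNReal :=
  ∫⁻ x, (ENNReal.ofReal (1 - P x))⁻¹ ∂(ν.map Prod.fst)

/-- `P` is a solution of the optimization problem in epoch `m`. -/
def IsSolution [MeasurableSpace 𝒳] (ν : Measure (𝒳 × Bool)) (p : Params)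
    (H : Finset (𝒳 → Bool)) (r : Path 𝒳) (m : ℕ) (P : 𝒳 → ℝ) : Prop :=
  Feasible ν p H r m P ∧ ∀ P', Feasible ν p H r m P' → objective ν P ≤ objective ν P'

/-! ### The random execution -/

/-- `R` is a random execution of the algorithm on an i.i.d. stream with distribution `ν`, where
`ℱ i` contains everything known after example `i`. Ties between empirical error minimizers and
between solutions of the optimization problem may be broken in any way that does not look into
the future. -/
structure IsRun [MeasurableSpace 𝒳] {Ω : Type v} [mΩ : MeasurableSpace Ω] (μ : Measure Ω)
    (ℱ : Filtration ℕ mΩ) (ν : Measure (𝒳 × Bool)) (p : Params) (H : Finset (𝒳 → Bool))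
    (R : Ω → Path 𝒳) : Prop where
  /-- example `i` and its query decision are known after step `i` -/
  x_adapted : ∀ i, 1 ≤ i → i ≤ p.n → Measurable[ℱ i] fun ω => (R ω).x i
  y_adapted : ∀ i, 1 ≤ i → i ≤ p.n → Measurable[ℱ i] fun ω => (R ω).y i
  q_adapted : ∀ i, 1 ≤ i → i ≤ p.n → Measurable[ℱ i] fun ω => (R ω).q i
  /-- the examples have law `ν` and each is independent of the past -/
  law : ∀ i, i < p.n → μ.map (fun ω => ((R ω).x (i + 1), (R ω).y (i + 1))) = ν
  indep : ∀ i, i < p.n →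
    Indep (MeasurableSpace.comap (fun ω => ((R ω).x (i + 1), (R ω).y (i + 1))) inferInstance)
      (ℱ i) μ
  /-- `h_{m+1}` minimizes the empirical error on the sample of the first `m` epochs -/
  erm_mem : ∀ m, 1 ≤ m → m ≤ p.M → ∀ ω, (R ω).h (m + 1) ∈ H
  erm_min : ∀ m, 1 ≤ m → m ≤ p.M → ∀ ω, ∀ g ∈ H,
    empErr ((R ω).h (m + 1)) (sample p H (R ω) m) ≤ empErr g (sample p H (R ω) m)
  erm_measurable : ∀ m, 1 ≤ m → m ≤ p.M → ∀ g ∈ H,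
    MeasurableSet[ℱ (p.τ m)] {ω | (R ω).h (m + 1) = g}
  /-- `P_{m+1}` solves the optimization problem at the start of epoch `m + 1` -/
  solves : ∀ m, 1 ≤ m → m < p.M → ∀ ω, IsSolution ν p H (R ω) (m + 1) ((R ω).P (m + 1))
  P_measurable : ∀ m, 1 ≤ m → m < p.M →
    Measurable[(ℱ (p.τ m)).prod inferInstance] fun z : Ω × 𝒳 => (R z.1).P (m + 1) z.2
  /-- the first three labels are queried -/
  query_first : ∀ i, 1 ≤ i → i ≤ 3 → ∀ ω, (R ω).q i = true
  /-- no label is queried outside the disagreement region -/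
  query_outside : ∀ m, 1 ≤ m → m < p.M → ∀ i, p.τ m ≤ i → i < p.τ (m + 1) → ∀ ω,
    (R ω).x (i + 1) ∉ region p H (R ω) (m + 1) → (R ω).q (i + 1) = false
  /-- inside it, given the past and the example, the decision is Bernoulli with parameter
  `P_{m+1}(x)` -/
  query_inside : ∀ m, 1 ≤ m → m < p.M → ∀ i, p.τ m ≤ i → i < p.τ (m + 1) →
    μ[fun ω => if (R ω).q (i + 1) = true then (1 : ℝ) else 0 |
        ℱ i ⊔ MeasurableSpace.comap (fun ω => ((R ω).x (i + 1), (R ω).y (i + 1))) inferInstance]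
      =ᵐ[μ] fun ω =>
        (region p H (R ω) (m + 1)).indicator ((R ω).P (m + 1)) ((R ω).x (i + 1))

end

end ActiveCover

/-! After the first epoch a label can be queried only inside the current region `D_m`, so it
suffices to bound the number of examples that fall there. Suppose `hstar` survives and every
surviving `h` has small regret. Survivors disagree with `hstar` with probability at most twice the
error of `hstar` inside `D_m` plus the regret. Each point of `D_m` is witnessed by a survivor that
differs from `hstar` there, so the disagreement coefficient bounds the mass of `D_m`
(`IsPath.regionMass_le`). Summed over epochs, the first term gives `2 θ err n` and the second is of
order `θ γ log n` times the scaled radius `amp = τ_M Δ_M`. A Chernoff bound passes from masses to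
counts (`IsRun.measure_regionCount_le`).

Survival and small regret are proved by strong induction on the epoch (`IsPath.tracked`). The stored
sample is biased, since labels outside `D_m` are replaced by predictions of `h_m`. While `hstar`
survives, those predictions agree with `hstar`, so the bias only raises the regret of its
competitors: the mean regret under the biased sampling dominates the true one. The weighted sums
fluctuate around these conditional means with second moments controlled by the variance constraint
on `P_m`. Its right-hand side is an empirical regret and a radius of the previous epoch, which the
induction already controls. The doubling of the schedule makes the sum over epochs cost only a
logarithm.

The fluctuations are handled by an exponential supermartingale with a fixed tilt `l` that stays
below all query probabilities (`lintegral_mul_exp_weighted_step_le`,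
`IsRun.measure_wsum_deviation_le`). The right tilt is about `100 log(|H| τ_m / δ) / (η amp)`, which
is random, so the tail bound is made uniform over a grid of `34 τ_m` tilts (`IsPath.exists_tilt`,
`IsRun.measureReal_not_concentrated_le`).

Finally `amp` contains the square root of the minimal weighted loss. That loss is at most the
weighted loss of `hstar`, which concentrates up to a multiple of `amp`. Solving this self-bounding
inequality (`amp_le_of_self_bound`) gives the square root term of the theorem. -/

/-! ### Conditioning on the past in lower Lebesgue integrals -/

section Conditioning

variable {Ω Z : Type*} {m mΩ : MeasurableSpace Ω} [MeasurableSpace Z] {μ : Measure Ω}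

/-- The identity, seen as a map into `Ω` with the smaller σ-algebra `m`, is independent of `z`. The
joint law is then a product and Tonelli applies. -/
theorem lintegral_of_indep_past [IsProbabilityMeasure μ] (hm : m ≤ mΩ)
    {z : Ω → Z} (hz : Measurable z)
    (hind : Indep (MeasurableSpace.comap z inferInstance) m μ)
    {G : Ω × Z → ENNReal} (hG : Measurable[m.prod inferInstance] G) :
    ∫⁻ ω, G (ω, z ω) ∂μ = ∫⁻ ω, ∫⁻ z', G (ω, z') ∂(μ.map z) ∂μ := by
  have hid : @Measurable Ω Ω mΩ m id := measurable_id'' hm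
  have hindf : @IndepFun Ω Ω Z mΩ m inferInstance id z μ := by
    refine (@IndepFun_iff_Indep Ω Ω Z mΩ m inferInstance id z μ).2 ?_
    rw [MeasurableSpace.comap_id]
    exact hind.symm
  have hmap := (@indepFun_iff_map_prod_eq_prod_map_map Ω Ω Z mΩ μ id z m inferInstance
    inferInstance (@Measurable.aemeasurable Ω Ω mΩ m id μ hid) hz.aemeasurable).1 hindf
  have hpair : @Measurable Ω (Ω × Z) mΩ (m.prod inferInstance) (fun ω => (id ω, z ω)) :=
    @Measurable.prodMk _ mΩ _ _ m inferInstance _ _ hid hz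
  have h1 : ∫⁻ ω, G (ω, z ω) ∂μ
      = @lintegral _ (m.prod inferInstance)
        (@Measure.map _ _ mΩ (m.prod inferInstance) (fun ω => (id ω, z ω)) μ) G := by
    rw [@lintegral_map _ _ mΩ (m.prod inferInstance) μ G _ hG hpair]
    rfl
  have : IsProbabilityMeasure (μ.map z) := Measure.isProbabilityMeasure_map hz.aemeasurable
  rw [h1, hmap, @lintegral_prod _ _ m inferInstance _ _ _ _ hG.aemeasurable]
  rw [@lintegral_map _ _ mΩ m μ _ _ _ hid]
  · rfl
  · exact @Measurable.lintegral_prod_right' _ _ m inferInstance _ _ _ hG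

/-- The restriction of `μ` to `s` and the measure with density `f` have the same trim to `m`.
Working in `[0, ∞]` avoids any integrability condition on `J`. -/
theorem setLIntegral_of_condExp_indicator [IsProbabilityMeasure μ]
    (hm : m ≤ mΩ) {s : Set Ω} (hs : MeasurableSet s) {f : Ω → ℝ} (hf : Measurable[m] f)
    (hf0 : ∀ ω, 0 ≤ f ω) (hf1 : ∀ ω, f ω ≤ 1)
    (hc : μ[s.indicator fun _ => (1 : ℝ) | m] =ᵐ[μ] f)
    {J : Ω → ENNReal} (hJ : Measurable[m] J) :
    ∫⁻ ω in s, J ω ∂μ = ∫⁻ ω, ENNReal.ofReal (f ω) * J ω ∂μ := by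
  have hfm : Measurable f := hf.mono hm le_rfl
  have hfi : Integrable f μ :=
    Integrable.of_bound hfm.aestronglyMeasurable 1
      (Filter.Eventually.of_forall fun ω => by
        rw [Real.norm_eq_abs, abs_of_nonneg (hf0 ω)]; exact hf1 ω)
  have hsi : Integrable (s.indicator fun _ => (1 : ℝ)) μ := (integrable_const 1).indicator hs
  have hmeas : (μ.restrict s).trim hm
      = (μ.withDensity fun ω => ENNReal.ofReal (f ω)).trim hm := by
    refine @Measure.ext _ m _ _ fun t ht => ?_
    rw [trim_measurableSet_eq hm ht, trim_measurableSet_eq hm ht,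
      Measure.restrict_apply (hm t ht), withDensity_apply _ (hm t ht)]
    have h1 : ∫ ω in t, f ω ∂μ = μ.real (t ∩ s) := by
      rw [← setIntegral_congr_ae (hm t ht) (hc.mono fun ω h _ => h), setIntegral_condExp hm hsi ht]
      rw [setIntegral_indicator hs]; simp
    rw [← ofReal_integral_eq_lintegral_ofReal hfi.integrableOn
      (Filter.Eventually.of_forall hf0), h1]
    simp [measureReal_def]
  rw [← lintegral_trim hm hJ, hmeas, lintegral_trim hm hJ,
    lintegral_withDensity_eq_lintegral_mul _ hfm.ennreal_ofReal (hJ.mono hm le_rfl)]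
  rfl

/-- Integrating out a fresh example `z` and a Bernoulli decision `q` with parameter
`π (past, z)`. -/
theorem lintegral_fresh_decision [IsProbabilityMeasure μ] (hm : m ≤ mΩ)
    {z : Ω → Z} (hz : Measurable z)
    (hind : Indep (MeasurableSpace.comap z inferInstance) m μ)
    {q : Ω → Bool} (hq : Measurable q) {π : Ω × Z → ℝ}
    (hπ : Measurable[m.prod inferInstance] π) (hπ0 : ∀ a, 0 ≤ π a) (hπ1 : ∀ a, π a ≤ 1)
    (hc : μ[fun ω => if q ω = true then (1 : ℝ) else 0 | m ⊔ MeasurableSpace.comap z inferInstance]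
      =ᵐ[μ] fun ω => π (ω, z ω))
    {K₁ K₀ : Ω × Z → ENNReal} (hK₁ : Measurable[m.prod inferInstance] K₁)
    (hK₀ : Measurable[m.prod inferInstance] K₀) :
    ∫⁻ ω, (if q ω = true then K₁ (ω, z ω) else K₀ (ω, z ω)) ∂μ
      = ∫⁻ ω, ∫⁻ z', (ENNReal.ofReal (π (ω, z')) * K₁ (ω, z')
          + ENNReal.ofReal (1 - π (ω, z')) * K₀ (ω, z')) ∂(μ.map z) ∂μ := by
  set 𝒢 : MeasurableSpace Ω := m ⊔ MeasurableSpace.comap z inferInstance with h𝒢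
  have hle : 𝒢 ≤ mΩ := sup_le hm hz.comap_le
  have hpair : @Measurable Ω (Ω × Z) 𝒢 (m.prod inferInstance) (fun ω => (ω, z ω)) :=
    @Measurable.prodMk _ 𝒢 _ _ m inferInstance _ _ (measurable_id'' le_sup_left)
      ((comap_measurable z).mono le_sup_right le_rfl)
  have hs : MeasurableSet[mΩ] {ω | q ω = true} := hq (measurableSet_singleton true)
  have hpf : Measurable[𝒢] fun ω => π (ω, z ω) := hπ.comp hpair
  have hsi : Integrable ({ω | q ω = true}.indicator fun _ => (1 : ℝ)) μ :=
    (integrable_const 1).indicator hs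
  have hc1 : μ[{ω | q ω = true}.indicator fun _ => (1 : ℝ) | 𝒢] =ᵐ[μ] fun ω => π (ω, z ω) := by
    have e : ({ω | q ω = true}.indicator fun _ => (1 : ℝ))
        = fun ω => if q ω = true then (1 : ℝ) else 0 := by
      funext ω; simp [Set.indicator_apply]
    rw [e]; exact hc
  have hc0 : μ[{ω | q ω = true}ᶜ.indicator fun _ => (1 : ℝ) | 𝒢]
      =ᵐ[μ] fun ω => 1 - π (ω, z ω) := by
    have e : ({ω | q ω = true}ᶜ.indicator fun _ => (1 : ℝ))
        = (fun _ => (1 : ℝ)) - {ω | q ω = true}.indicator fun _ => (1 : ℝ) := by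
      rw [Set.indicator_compl]
    rw [e]
    refine (condExp_sub (integrable_const 1) hsi 𝒢).trans ?_
    filter_upwards [hc1] with ω h
    rw [Pi.sub_apply, h, condExp_const hle]
  have h1 := setLIntegral_of_condExp_indicator hle hs hpf (fun ω => hπ0 _) (fun ω => hπ1 _) hc1
    (hK₁.comp hpair)
  have h0 := setLIntegral_of_condExp_indicator hle hs.compl (measurable_const.sub hpf)
    (fun ω => sub_nonneg.2 (hπ1 _)) (fun ω => sub_le_self _ (hπ0 _)) hc0 (hK₀.comp hpair)
  have hG : Measurable[m.prod inferInstance] fun a : Ω × Z =>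
      ENNReal.ofReal (π a) * K₁ a + ENNReal.ofReal (1 - π a) * K₀ a :=
    (hπ.ennreal_ofReal.mul hK₁).add ((measurable_const.sub hπ).ennreal_ofReal.mul hK₀)
  rw [← lintegral_of_indep_past hm hz hind hG, ← lintegral_add_compl _ hs]
  have g1 : ∫⁻ ω in {ω | q ω = true}, (if q ω = true then K₁ (ω, z ω) else K₀ (ω, z ω)) ∂μ
      = ∫⁻ ω, ENNReal.ofReal (π (ω, z ω)) * K₁ (ω, z ω) ∂μ :=
    (setLIntegral_congr_fun hs fun ω hω => if_pos hω).trans h1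
  have g0 : ∫⁻ ω in {ω | q ω = true}ᶜ, (if q ω = true then K₁ (ω, z ω) else K₀ (ω, z ω)) ∂μ
      = ∫⁻ ω, ENNReal.ofReal (1 - π (ω, z ω)) * K₀ (ω, z ω) ∂μ :=
    (setLIntegral_congr_fun hs.compl fun ω hω => if_neg hω).trans h0
  rw [g1, g0, ← lintegral_add_left]
  exact (hpf.ennreal_ofReal.mul (hK₁.comp hpair)).mono hle le_rfl

/-- Chernoff bound for a sum of log-increments whose exponentials have conditional mean at most
one. -/
theorem measure_sum_ge_le_exp_neg [IsProbabilityMeasure μ] (ℱ : Filtration ℕ mΩ) (ψ : ℕ → Ω → ℝ)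
    (n : ℕ) (hmeas : ∀ i < n, Measurable[ℱ (i + 1)] (ψ i))
    (hstep : ∀ i < n, ∀ F : Ω → ENNReal, Measurable[ℱ i] F →
      ∫⁻ ω, F ω * ENNReal.ofReal (Real.exp (ψ i ω)) ∂μ ≤ ∫⁻ ω, F ω ∂μ) (x : ℝ) :
    μ {ω | x ≤ ∑ i ∈ Finset.range n, ψ i ω} ≤ ENNReal.ofReal (Real.exp (-x)) := by
  have hsm : ∀ k ≤ n, Measurable[ℱ k] fun ω => ∑ i ∈ Finset.range k, ψ i ω := by
    intro k hk
    refine Finset.measurable_fun_sum _ fun i hi => ?_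
    have := Finset.mem_range.1 hi
    exact (hmeas i (by omega)).mono (ℱ.mono (by omega)) le_rfl
  -- The exponentials of the partial sums have mean at most one: `hstep` is applied with `F` the
  -- exponential of the sum so far. Markov's inequality then finishes.
  have key : ∀ k ≤ n,
      ∫⁻ ω, ENNReal.ofReal (Real.exp (∑ i ∈ Finset.range k, ψ i ω)) ∂μ ≤ 1 := by
    intro k
    induction k with
    | zero => intro _; simp
    | succ k ih =>
      intro hk
      have e : ∀ ω, ENNReal.ofReal (Real.exp (∑ i ∈ Finset.range (k + 1), ψ i ω))
          = ENNReal.ofReal (Real.exp (∑ i ∈ Finset.range k, ψ i ω))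
            * ENNReal.ofReal (Real.exp (ψ k ω)) := by
        intro ω
        rw [Finset.sum_range_succ, Real.exp_add, ENNReal.ofReal_mul (Real.exp_pos _).le]
      simp_rw [e]
      refine (hstep k (by omega) _ ?_).trans (ih (by omega))
      exact (Real.measurable_exp.comp (hsm k (by omega))).ennreal_ofReal
  have hmk := mul_meas_ge_le_lintegral (μ := μ)
    ((Real.measurable_exp.comp ((hsm n le_rfl).mono (ℱ.le n) le_rfl)).ennreal_ofReal)
    (ENNReal.ofReal (Real.exp x))
  have hset : {ω | x ≤ ∑ i ∈ Finset.range n, ψ i ω}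
      ⊆ {ω | ENNReal.ofReal (Real.exp x)
        ≤ ENNReal.ofReal (Real.exp (∑ i ∈ Finset.range n, ψ i ω))} :=
    fun ω hω => ENNReal.ofReal_le_ofReal (Real.exp_le_exp.2 hω)
  have h2 := (mul_le_mul_right (measure_mono (μ := μ) hset) (ENNReal.ofReal (Real.exp x))).trans
    (hmk.trans (key n le_rfl))
  rw [Real.exp_neg, ENNReal.ofReal_inv_of_pos (Real.exp_pos x)]
  rw [ENNReal.le_inv_iff_mul_le, mul_comm]
  exact h2

end Conditioning

/-! ### Exponential moment of one importance weighted step. -/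

section StepBound

variable {Ω Z : Type*} {m mΩ : MeasurableSpace Ω} [MeasurableSpace Z] {μ : Measure Ω}

/-- The exponential moment of an importance weighted decision is at most
`1 + l a + l² a² / P`. -/
theorem mul_exp_div_add_le {l a P : ℝ} (hl : 0 < l) (ha : |a| ≤ 1) (hP : l ≤ P) :
    P * Real.exp (l * (1 / P * a)) + (1 - P) ≤ 1 + l * a + l ^ 2 * (1 / P * a ^ 2) := by
  have hP0 : 0 < P := hl.trans_le hP
  -- The condition `l ≤ P` keeps the exponent in `[-1, 1]`, where `exp u ≤ 1 + u + u ^ 2`. The outer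
  -- factor `P` then cancels one factor `1 / P` of the square.
  have hu : |l * (1 / P * a)| ≤ 1 := by
    rw [show l * (1 / P * a) = l / P * a by ring, abs_mul, abs_of_pos (div_pos hl hP0)]
    exact mul_le_one₀ ((div_le_one hP0).2 hP) (abs_nonneg _) ha
  have h := (abs_le.1 (Real.abs_exp_sub_one_sub_id_le hu)).2
  have h2 : P * Real.exp (l * (1 / P * a))
      ≤ P * (1 + l * (1 / P * a) + (l * (1 / P * a)) ^ 2) :=
    mul_le_mul_of_nonneg_left (by linarith) hP0.le
  have e : P * (1 + l * (1 / P * a) + (l * (1 / P * a)) ^ 2)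
      = P + l * a + l ^ 2 * (1 / P * a ^ 2) := by
    field_simp
  linarith

-- Averaging over the decision turns the exponential into at most `1 + l a + l² a² / P` on `D`.
-- Averaging over the example gives `1 + u ≤ exp u`, and the compensator `u` cancels it. The
-- increment is switched off outside the past event `C`, because the first bound needs `l ≤ P`.
open Classical in
theorem lintegral_mul_exp_weighted_step_le [IsProbabilityMeasure μ] (hm : m ≤ mΩ)
    {z : Ω → Z} (hz : Measurable z)
    (hind : Indep (MeasurableSpace.comap z inferInstance) m μ)
    {q : Ω → Bool} (hq : Measurable q) {D : Set (Ω × Z)}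
    (hD : MeasurableSet[m.prod inferInstance] D) {P : Ω × Z → ℝ}
    (hP : Measurable[m.prod inferInstance] P) (hP0 : ∀ a, 0 ≤ P a) (hP1 : ∀ a, P a ≤ 1)
    (hc : μ[fun ω => if q ω = true then (1 : ℝ) else 0 | m ⊔ MeasurableSpace.comap z inferInstance]
      =ᵐ[μ] fun ω => if (ω, z ω) ∈ D then P (ω, z ω) else 0)
    {a : Ω × Z → ℝ} (ha : Measurable[m.prod inferInstance] a) (ha1 : ∀ b, |a b| ≤ 1)
    {l : ℝ} (hl : 0 < l) (hl1 : l ≤ 1) {C : Set Ω} (hC : MeasurableSet[m] C)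
    (hCD : ∀ ω ∈ C, ∀ z', (ω, z') ∈ D → l ≤ P (ω, z'))
    {F : Ω → ENNReal} (hF : Measurable[m] F) :
    ∫⁻ ω, F ω * ENNReal.ofReal (Real.exp (if ω ∈ C then
        l * (if (ω, z ω) ∈ D then (if q ω = true then 1 / P (ω, z ω) * a (ω, z ω) else 0)
          else a (ω, z ω))
        - l * ∫ z', a (ω, z') ∂(μ.map z)
        - l ^ 2 * ∫ z', (if (ω, z') ∈ D then 1 / P (ω, z') * a (ω, z') ^ 2 else a (ω, z') ^ 2)
            ∂(μ.map z) else 0)) ∂μ ≤ ∫⁻ ω, F ω ∂μ := by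
  have : IsProbabilityMeasure (μ.map z) := Measure.isProbabilityMeasure_map hz.aemeasurable
  set b : Ω × Z → ℝ := fun y => if y ∈ D then 1 / P y * a y ^ 2 else a y ^ 2 with hb
  have hbm : Measurable[m.prod inferInstance] b :=
    Measurable.ite hD ((hP.const_div 1).mul (ha.pow_const 2)) (ha.pow_const 2)
  set u : Ω → ℝ := fun ω => l * ∫ z', a (ω, z') ∂(μ.map z) + l ^ 2 * ∫ z', b (ω, z') ∂(μ.map z)
    with hu
  have hum : Measurable[m] u :=
    ((@StronglyMeasurable.integral_prod_right' _ _ _ m _ _ _ _ _ _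
      ha.stronglyMeasurable).measurable.const_mul
        l).add
    ((@StronglyMeasurable.integral_prod_right' _ _ _ m _ _ _ _ _ _
      hbm.stronglyMeasurable).measurable.const_mul
        (l ^ 2))
  set π : Ω × Z → ℝ := fun y => if y ∈ D then P y else 0 with hπ
  have hπm : Measurable[m.prod inferInstance] π := Measurable.ite hD hP measurable_const
  have hπ0 : ∀ y, 0 ≤ π y := fun y => by simp only [hπ]; split_ifs <;> simp [hP0]
  have hπ1 : ∀ y, π y ≤ 1 := fun y => by simp only [hπ]; split_ifs <;> simp [hP1]
  set e₁ : Ω × Z → ℝ := fun y => Real.exp (if y.1 ∈ C then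
    l * (if y ∈ D then 1 / P y * a y else a y) - u y.1 else 0) with he₁
  set e₀ : Ω × Z → ℝ := fun y => Real.exp (if y.1 ∈ C then
    l * (if y ∈ D then 0 else a y) - u y.1 else 0) with he₀
  have hfst : @Measurable _ _ (m.prod inferInstance) m (Prod.fst : Ω × Z → Ω) :=
    @measurable_fst _ _ m _
  have he₁m : Measurable[m.prod inferInstance] e₁ := by
    refine Real.measurable_exp.comp (Measurable.ite (hfst hC) (Measurable.sub ?_ (hum.comp hfst))
      measurable_const)
    exact (Measurable.ite hD ((hP.const_div 1).mul ha) ha).const_mul l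
  have he₀m : Measurable[m.prod inferInstance] e₀ := by
    refine Real.measurable_exp.comp (Measurable.ite (hfst hC) (Measurable.sub ?_ (hum.comp hfst))
      measurable_const)
    exact (Measurable.ite hD measurable_const ha).const_mul l
  have hfresh := lintegral_fresh_decision hm hz hind hq hπm hπ0 hπ1 hc
    (K₁ := fun y => F y.1 * ENNReal.ofReal (e₁ y)) (K₀ := fun y => F y.1 * ENNReal.ofReal (e₀ y))
    ((hF.comp hfst).mul he₁m.ennreal_ofReal) ((hF.comp hfst).mul he₀m.ennreal_ofReal)
  have hL : ∀ ω, F ω * ENNReal.ofReal (Real.exp (if ω ∈ C then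
        l * (if (ω, z ω) ∈ D then (if q ω = true then 1 / P (ω, z ω) * a (ω, z ω) else 0)
          else a (ω, z ω)) - l * ∫ z', a (ω, z') ∂(μ.map z)
        - l ^ 2 * ∫ z', b (ω, z') ∂(μ.map z) else 0))
      = if q ω = true then F ω * ENNReal.ofReal (e₁ (ω, z ω))
        else F ω * ENNReal.ofReal (e₀ (ω, z ω)) := by
    intro ω
    simp only [he₁, he₀, hu]
    split_ifs <;> first | rfl | simp only [sub_sub]
  refine (lintegral_congr hL).trans_le (hfresh.trans_le (lintegral_mono fun ω => ?_))
  have hsec : @Measurable Z (Ω × Z) _ (m.prod inferInstance) (fun z' => (ω, z')) :=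
    @Measurable.prodMk _ _ _ _ m _ _ _ (@measurable_const _ _ m _ ω) measurable_id
  set f : Z → ℝ := fun z' => π (ω, z') * e₁ (ω, z') + (1 - π (ω, z')) * e₀ (ω, z') with hf
  have hfm : Measurable f :=
    ((hπm.comp hsec).mul (he₁m.comp hsec)).add
      ((measurable_const.sub (hπm.comp hsec)).mul (he₀m.comp hsec))
  have hin : ∀ z', ENNReal.ofReal (π (ω, z')) * (F ω * ENNReal.ofReal (e₁ (ω, z')))
      + ENNReal.ofReal (1 - π (ω, z')) * (F ω * ENNReal.ofReal (e₀ (ω, z')))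
      = F ω * ENNReal.ofReal (f z') := by
    intro z'
    rw [hf, ENNReal.ofReal_add (mul_nonneg (hπ0 _) (Real.exp_pos _).le)
      (mul_nonneg (sub_nonneg.2 (hπ1 _)) (Real.exp_pos _).le), ENNReal.ofReal_mul (hπ0 _),
      ENNReal.ofReal_mul (sub_nonneg.2 (hπ1 _))]
    ring
  simp only [hin]
  rw [lintegral_const_mul _ hfm.ennreal_ofReal]
  refine mul_le_of_le_one_right' ?_
  by_cases hω : ω ∈ C
  · have hb0 : ∀ z', 0 ≤ b (ω, z') := fun z' => by
      simp only [hb]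
      split_ifs
      · exact mul_nonneg (one_div_nonneg.2 (hP0 _)) (sq_nonneg _)
      · exact sq_nonneg _
    have hb1 : ∀ z', b (ω, z') ≤ 1 / l := fun z' => by
      have hsq : a (ω, z') ^ 2 ≤ 1 := (sq_le_one_iff_abs_le_one _).2 (ha1 _)
      have hl' : 1 ≤ 1 / l := by rw [le_div_iff₀ hl]; linarith
      simp only [hb]
      split_ifs with h
      · have := hCD ω hω z' h
        calc 1 / P (ω, z') * a (ω, z') ^ 2 ≤ 1 / P (ω, z') * 1 :=
              mul_le_mul_of_nonneg_left hsq (one_div_nonneg.2 (hP0 _))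
          _ ≤ 1 / l := by rw [mul_one]; exact one_div_le_one_div_of_le hl this
      · exact hsq.trans hl'
    have hai : Integrable (fun z' => a (ω, z')) (μ.map z) :=
      Integrable.of_bound (ha.comp hsec).aestronglyMeasurable 1
        (Filter.Eventually.of_forall fun z' => ha1 _)
    have hbi : Integrable (fun z' => b (ω, z')) (μ.map z) :=
      Integrable.of_bound (hbm.comp hsec).aestronglyMeasurable (1 / l)
        (Filter.Eventually.of_forall fun z' => by
          rw [Real.norm_eq_abs, abs_of_nonneg (hb0 z')]; exact hb1 z')
    have hpt : ∀ z', f z' ≤ Real.exp (-u ω) * (1 + l * a (ω, z') + l ^ 2 * b (ω, z')) := by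
      intro z'
      have h1 : f z' = Real.exp (-u ω) *
          (π (ω, z') * Real.exp (l * (if (ω, z') ∈ D then 1 / P (ω, z') * a (ω, z')
            else a (ω, z'))) + (1 - π (ω, z')) * Real.exp (l * (if (ω, z') ∈ D then 0
            else a (ω, z')))) := by
        simp only [hf, he₁, he₀, if_pos hω, sub_eq_add_neg, Real.exp_add]
        ring
      rw [h1]
      refine mul_le_mul_of_nonneg_left ?_ (Real.exp_pos _).le
      by_cases h : (ω, z') ∈ D
      · simp only [hπ, hb, if_pos h]
        have := mul_exp_div_add_le hl (ha1 (ω, z')) (hCD ω hω z' h)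
        simpa using this
      · simp only [hπ, hb, if_neg h]
        -- Off `D` nothing is random beyond the example, which is the case of query probability one.
        have := mul_exp_div_add_le hl (ha1 (ω, z')) hl1
        simpa using this
    have hint1 : Integrable (fun z' => 1 + l * a (ω, z')) (μ.map z) :=
      (integrable_const 1).add (hai.const_mul l)
    have hint : Integrable (fun z' => 1 + l * a (ω, z') + l ^ 2 * b (ω, z')) (μ.map z) :=
      hint1.add (hbi.const_mul (l ^ 2))
    have hnn : ∀ z', 0 ≤ Real.exp (-u ω) * (1 + l * a (ω, z') + l ^ 2 * b (ω, z')) := by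
      intro z'
      have := (abs_le.1 (ha1 (ω, z'))).1
      have h3 : 0 ≤ l ^ 2 * b (ω, z') := mul_nonneg (sq_nonneg _) (hb0 z')
      refine mul_nonneg (Real.exp_pos _).le ?_
      nlinarith
    calc ∫⁻ z', ENNReal.ofReal (f z') ∂(μ.map z)
        ≤ ∫⁻ z', ENNReal.ofReal (Real.exp (-u ω) * (1 + l * a (ω, z') + l ^ 2 * b (ω, z')))
            ∂(μ.map z) := lintegral_mono fun z' => ENNReal.ofReal_le_ofReal (hpt z')
      _ = ENNReal.ofReal (∫ z', Real.exp (-u ω) * (1 + l * a (ω, z') + l ^ 2 * b (ω, z'))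
            ∂(μ.map z)) :=
          (ofReal_integral_eq_lintegral_ofReal (hint.const_mul _)
            (Filter.Eventually.of_forall hnn)).symm
      _ = ENNReal.ofReal (Real.exp (-u ω) * (1 + u ω)) := by
          congr 1
          rw [integral_const_mul, integral_add hint1 (hbi.const_mul (l ^ 2)),
            integral_add (integrable_const 1) (hai.const_mul l),
            integral_const_mul, integral_const_mul]
          simp [hu, add_assoc]
      _ ≤ 1 := by
          rw [ENNReal.ofReal_le_one]
          have := Real.add_one_le_exp (u ω)
          calc Real.exp (-u ω) * (1 + u ω) ≤ Real.exp (-u ω) * Real.exp (u ω) :=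
                mul_le_mul_of_nonneg_left (by linarith) (Real.exp_pos _).le
            _ = 1 := by rw [← Real.exp_add]; simp
  · simp [hf, he₁, he₀, hω]

end StepBound

namespace ActiveCover

noncomputable section

universe u v

variable {𝒳 : Type u}

/-! ### Weighted sums over the collected sample -/

/-- Zero-one loss of `h`. -/
def loss (h : 𝒳 → Bool) (z : 𝒳 × Bool) : ℝ := if h z.1 ≠ z.2 then 1 else 0

/-- Weighted sum of `φ` over a sample. -/
def wsum (φ : 𝒳 × Bool → ℝ) (S : Multiset (𝒳 × Bool × ℝ)) : ℝ :=
  (S.map fun e => e.2.2 * φ (e.1, e.2.1)).sum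

theorem empErr_eq (h : 𝒳 → Bool) (S : Multiset (𝒳 × Bool × ℝ)) :
    empErr h S = wsum (loss h) S / S.card := rfl

/-- Points at which epoch `m` draws a random query decision; all of them in the first epoch. -/
def domain (p : Params) (H : Finset (𝒳 → Bool)) (r : Path 𝒳) (m : ℕ) : Set 𝒳 :=
  if m ≤ 1 then Set.univ else region p H r m

/-- Query probability in epoch `m`; one in the first epoch. -/
def prob (r : Path 𝒳) (m : ℕ) (x : 𝒳) : ℝ := if m ≤ 1 then 1 else r.P m x

/-- Lower bound on the query probability in epoch `m`. -/
def probFloor (p : Params) (H : Finset (𝒳 → Bool)) (r : Path 𝒳) (m : ℕ) : ℝ :=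
  if m ≤ 1 then 1 else Pmin p H r m

open Classical in
/-- Weighted value of `φ` at example `i` of epoch `m`. -/
def stepVal (p : Params) (H : Finset (𝒳 → Bool)) (r : Path 𝒳) (φ : 𝒳 × Bool → ℝ) (m i : ℕ) : ℝ :=
  if r.x i ∈ domain p H r m then
    (if r.q i = true then 1 / prob r m (r.x i) * φ (r.x i, r.y i) else 0)
  else φ (r.x i, r.h m (r.x i))

open Classical in
/-- Conditional mean of `stepVal` in epoch `m`. -/
def stepMean [MeasurableSpace 𝒳] (ν : Measure (𝒳 × Bool)) (p : Params) (H : Finset (𝒳 → Bool))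
    (r : Path 𝒳) (φ : 𝒳 × Bool → ℝ) (m : ℕ) : ℝ :=
  ∫ z, (if z.1 ∈ domain p H r m then φ z else φ (z.1, r.h m z.1)) ∂ν

open Classical in
/-- Conditional second moment of `stepVal` in epoch `m`. -/
def stepVar [MeasurableSpace 𝒳] (ν : Measure (𝒳 × Bool)) (p : Params) (H : Finset (𝒳 → Bool))
    (r : Path 𝒳) (φ : 𝒳 × Bool → ℝ) (m : ℕ) : ℝ :=
  ∫ z, (if z.1 ∈ domain p H r m then 1 / prob r m z.1 * φ z ^ 2
    else φ (z.1, r.h m z.1) ^ 2) ∂ν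

/-- Sum of a per-epoch quantity over the examples of the epochs `1, …, m`. -/
def epochSum (p : Params) (f : ℕ → ℝ) (m : ℕ) : ℝ :=
  ∑ k ∈ Finset.range m, ((p.τ (k + 1) : ℝ) - p.τ k) * f (k + 1)

namespace Params.Valid

variable {p : Params} {H : Finset (𝒳 → Bool)}

theorem τ_mono_succ (hp : p.Valid H) {m : ℕ} (hm : m < p.M) : p.τ m < p.τ (m + 1) := by
  rcases Nat.eq_zero_or_pos m with rfl | h
  · rw [hp.τ_zero, hp.τ_one]; norm_num
  · exact hp.τ_lt m h hm

theorem τ_mono (hp : p.Valid H) {a b : ℕ} (hab : a ≤ b) (hb : b ≤ p.M) : p.τ a ≤ p.τ b := by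
  induction b, hab using Nat.le_induction with
  | base => exact le_rfl
  | succ b _ ih => exact (ih (by omega)).trans (hp.τ_mono_succ (by omega)).le

theorem τ_ge (hp : p.Valid H) {m : ℕ} (h1 : 1 ≤ m) (hm : m ≤ p.M) : m + 2 ≤ p.τ m := by
  induction m, h1 using Nat.le_induction with
  | base => rw [hp.τ_one]
  | succ m h ih => have := ih (by omega); have := hp.τ_mono_succ (m := m) (by omega); omega

theorem τ_le_n (hp : p.Valid H) {m : ℕ} (hm : m ≤ p.M) : p.τ m ≤ p.n := hp.τ_mono hm le_rfl

end Params.Valid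

/-- The number of epochs completed before example `i + 1`. -/
def Params.epoch (p : Params) (i : ℕ) : ℕ := Nat.findGreatest (fun k => p.τ k ≤ i) p.M

section Structure

variable {p : Params} {H : Finset (𝒳 → Bool)}

theorem Params.Valid.epoch_eq (hp : p.Valid H) {k i : ℕ} (hk : k < p.M) (h1 : p.τ k ≤ i)
    (h2 : i < p.τ (k + 1)) : p.epoch i = k := by
  refine Nat.findGreatest_eq_iff.2 ⟨hk.le, fun _ => h1, fun n hn hnM hni => ?_⟩
  have := hp.τ_mono (a := k + 1) (b := n) hn hnM
  omega

theorem Params.Valid.epoch_spec (hp : p.Valid H) {i : ℕ} (hi : i < p.n) :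
    p.epoch i < p.M ∧ p.τ (p.epoch i) ≤ i ∧ i < p.τ (p.epoch i + 1) := by
  have h0 : p.τ (p.epoch i) ≤ i :=
    Nat.findGreatest_spec (P := fun k => p.τ k ≤ i) (Nat.zero_le p.M) (by simp [hp.τ_zero])
  have hle : p.epoch i ≤ p.M := Nat.findGreatest_le _
  have hlt : p.epoch i < p.M := by
    refine lt_of_le_of_ne hle fun h => ?_
    rw [h] at h0
    exact absurd h0 (not_le.2 hi)
  refine ⟨hlt, h0, ?_⟩
  by_contra hcon
  exact Nat.findGreatest_is_greatest (P := fun k => p.τ k ≤ i) (n := p.M)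
    (k := p.epoch i + 1) (Nat.lt_succ_self _) hlt (not_lt.1 hcon)

theorem Params.Valid.sum_range_τ (hp : p.Valid H) (f : ℕ → ℕ → ℝ) {m : ℕ} (hm : m ≤ p.M) :
    ∑ i ∈ Finset.range (p.τ m), f (p.epoch i) i
      = ∑ k ∈ Finset.range m, ∑ i ∈ Finset.Ico (p.τ k) (p.τ (k + 1)), f k i := by
  induction m with
  | zero => simp [hp.τ_zero]
  | succ m ih =>
    rw [Finset.sum_range_succ, ← ih (by omega),
      ← Finset.sum_range_add_sum_Ico _ (hp.τ_mono_succ (m := m) (by omega)).le]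
    congr 1
    refine Finset.sum_congr rfl fun i hi => ?_
    obtain ⟨h1, h2⟩ := Finset.mem_Ico.1 hi
    rw [hp.epoch_eq (by omega) h1 h2]

/-- An unqueried point has weight zero, so its dummy label plays no role. The hypothesis `hq` is
needed because in the first epoch `stepVal` still tests the query bit, whereas `weightedExample`
does not. -/
theorem wsum_weightedExample (r : Path 𝒳) (φ : 𝒳 × Bool → ℝ) {m i : ℕ}
    (hq : m ≤ 1 → r.q i = true) :
    (weightedExample r (region p H r m) m i).2.2 *
      φ ((weightedExample r (region p H r m) m i).1, (weightedExample r (region p H r m) m i).2.1)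
      = stepVal p H r φ m i := by
  by_cases hm : m ≤ 1
  · simp [weightedExample, stepVal, domain, prob, hm, hq hm]
  · have hd : domain p H r m = region p H r m := if_neg hm
    unfold stepVal weightedExample
    rw [hd]
    simp only [prob, hm, if_false]
    split_ifs <;> simp

theorem wsum_sample_succ (r : Path 𝒳) (φ : 𝒳 × Bool → ℝ) (m : ℕ)
    (hq : m = 0 → ∀ i ∈ Finset.Ico (p.τ 0) (p.τ 1), r.q (i + 1) = true) :
    wsum φ (sample p H r (m + 1)) = wsum φ (sample p H r m)
      + ∑ i ∈ Finset.Ico (p.τ m) (p.τ (m + 1)), stepVal p H r φ (m + 1) (i + 1) := by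
  rw [wsum, sample, Multiset.map_add, Multiset.sum_add, Multiset.map_map]
  congr 1
  have e : (Finset.Ioc (p.τ m) (p.τ (m + 1)))
      = (Finset.Ico (p.τ m) (p.τ (m + 1))).map (addRightEmbedding 1) := by
    ext i
    simp only [Finset.mem_Ioc, Finset.mem_map, Finset.mem_Ico, addRightEmbedding_apply]
    constructor
    · intro h; exact ⟨i - 1, by omega, by omega⟩
    · rintro ⟨j, hj, rfl⟩; omega
  change ∑ i ∈ Finset.Ioc (p.τ m) (p.τ (m + 1)), _ = _
  rw [e, Finset.sum_map]
  refine Finset.sum_congr rfl fun i hi => ?_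
  refine wsum_weightedExample r φ fun hm => ?_
  obtain rfl : m = 0 := by omega
  exact hq rfl i hi

theorem Params.Valid.card_sample (hp : p.Valid H) (r : Path 𝒳) {m : ℕ} (hm : m ≤ p.M) :
    (sample p H r m).card = p.τ m := by
  induction m with
  | zero => simp [sample, hp.τ_zero]
  | succ m ih =>
    have := hp.τ_mono_succ (m := m) (by omega)
    rw [sample, Multiset.card_add, ih (by omega), Multiset.card_map, Finset.card_val,
      Nat.card_Ioc]
    omega

theorem Params.Valid.empErr_sample (hp : p.Valid H) (r : Path 𝒳) (h : 𝒳 → Bool) {m : ℕ}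
    (hm : m ≤ p.M) :
    empErr h (sample p H r m) = wsum (loss h) (sample p H r m) / p.τ m := by
  rw [empErr_eq, hp.card_sample r hm]

theorem wsum_sample_eq_sum (hp : p.Valid H) (r : Path 𝒳)
    (hq : ∀ i, 1 ≤ i → i ≤ 3 → r.q i = true) (φ : 𝒳 × Bool → ℝ) {m : ℕ} (hm : m ≤ p.M) :
    wsum φ (sample p H r m)
      = ∑ i ∈ Finset.range (p.τ m), stepVal p H r φ (p.epoch i + 1) (i + 1) := by
  rw [hp.sum_range_τ (fun k i => stepVal p H r φ (k + 1) (i + 1)) hm]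
  clear hm
  induction m with
  | zero => simp [sample, wsum]
  | succ m ih =>
    rw [wsum_sample_succ, ih, Finset.sum_range_succ]
    rintro rfl i hi
    rw [hp.τ_zero, hp.τ_one, Finset.mem_Ico] at hi
    exact hq _ (by omega) (by omega)

theorem epochSum_eq_sum (hp : p.Valid H) (f : ℕ → ℝ) {m : ℕ} (hm : m ≤ p.M) :
    epochSum p f m = ∑ i ∈ Finset.range (p.τ m), f (p.epoch i + 1) := by
  rw [hp.sum_range_τ (fun k _ => f (k + 1)) hm, epochSum]
  refine Finset.sum_congr rfl fun k hk => ?_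
  have := hp.τ_mono_succ (m := k) (by have := Finset.mem_range.1 hk; omega)
  rw [Finset.sum_const, Nat.card_Ico, nsmul_eq_mul, Nat.cast_sub this.le]

end Structure

/-! ### Measurability of the quantities of a run -/

/-- Classifiers carry no σ-algebra here. A random classifier is handled by splitting according to
its finitely many values. -/
theorem measurable_finite_choice {ι α β : Type*} [MeasurableSpace α] [MeasurableSpace β]
    {H : Finset ι} {h : α → ι} (hH : ∀ a, h a ∈ H) (hm : ∀ g ∈ H, MeasurableSet {a | h a = g})
    {F : ι → α → β} (hF : ∀ g ∈ H, Measurable (F g)) : Measurable fun a => F (h a) a := by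
  intro s hs
  have e : (fun a => F (h a) a) ⁻¹' s = ⋃ g ∈ H, {a | h a = g} ∩ F g ⁻¹' s := by
    ext a
    simp only [Set.mem_preimage, Set.mem_iUnion, Set.mem_inter_iff, Set.mem_ofPred_eq]
    constructor
    · intro ha; exact ⟨h a, hH a, rfl, ha⟩
    · rintro ⟨g, _, rfl, ha⟩; exact ha
  rw [e]
  exact Finset.measurableSet_biUnion _ fun g hg => (hm g hg).inter (hF g hg hs)

theorem measurable_loss [MeasurableSpace 𝒳] {h : 𝒳 → Bool} (hh : Measurable h) :
    Measurable (loss h) := by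
  refine Measurable.ite ?_ measurable_const measurable_const
  exact (measurableSet_eq_fun (hh.comp measurable_fst) measurable_snd).compl

theorem Params.measurable_radius (p : Params) (H : Finset (𝒳 → Bool)) (m : ℕ) :
    Measurable (p.radius H m) := by
  unfold Params.radius
  fun_prop

section

variable [MeasurableSpace 𝒳] {Ω : Type v} {mΩ : MeasurableSpace Ω} {μ : Measure Ω}
  {ℱ : Filtration ℕ mΩ} {ν : Measure (𝒳 × Bool)} {p : Params} {H : Finset (𝒳 → Bool)}
  {R : Ω → Path 𝒳}

/-- The hypothesis `hS`, here and in the next lemmas, is the induction hypothesis of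
`measurable_wsum_sample`: the region of epoch `k + 1` is computed from the sample of the first `k`
epochs and then determines how that sample grows. -/
theorem measurable_empErr_of (hp : p.Valid H) (hH : ∀ h ∈ H, Measurable h) {k : ℕ}
    (hk : k ≤ p.M) {m : MeasurableSpace Ω}
    (hS : ∀ φ : 𝒳 × Bool → ℝ, Measurable φ → Measurable fun ω => wsum φ (sample p H (R ω) k))
    {g : 𝒳 → Bool} (hg : g ∈ H) : Measurable fun ω => empErr g (sample p H (R ω) k) := by
  simp_rw [hp.empErr_sample _ _ hk]
  exact (hS _ (measurable_loss (hH g hg))).div_const _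

theorem measurable_minErr_of (hp : p.Valid H) (hH : ∀ h ∈ H, Measurable h)
    (hR : IsRun μ ℱ ν p H R) {k : ℕ} (h1 : 1 ≤ k) (hk : k ≤ p.M)
    (hS : ∀ φ : 𝒳 × Bool → ℝ, Measurable φ →
      Measurable[ℱ (p.τ k)] fun ω => wsum φ (sample p H (R ω) k)) :
    Measurable[ℱ (p.τ k)] fun ω => empErr ((R ω).h (k + 1)) (sample p H (R ω) k) :=
  @measurable_finite_choice _ _ _ (ℱ (p.τ k)) _ H (fun ω => (R ω).h (k + 1))
    (hR.erm_mem k h1 hk) (hR.erm_measurable k h1 hk)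
    (fun g ω => empErr g (sample p H (R ω) k))
    (fun _ hg => @measurable_empErr_of _ _ _ _ _ _ hp hH _ hk (ℱ (p.τ k)) hS _ hg)

theorem measurableSet_good_of (hp : p.Valid H) (hH : ∀ h ∈ H, Measurable h)
    (hR : IsRun μ ℱ ν p H R) {k : ℕ} (hk : k < p.M)
    (hS : ∀ φ : 𝒳 × Bool → ℝ, Measurable φ →
      Measurable[ℱ (p.τ k)] fun ω => wsum φ (sample p H (R ω) k)) {g : 𝒳 → Bool} (hg : g ∈ H) :
    MeasurableSet[ℱ (p.τ k)] {ω | g ∈ good p H (R ω) (k + 1)} := by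
  rcases Nat.eq_zero_or_pos k with rfl | h1
  · simp [good, goodFrom, hg]
  · have e : {ω | g ∈ good p H (R ω) (k + 1)}
        = {ω | empErr g (sample p H (R ω) k) - empErr ((R ω).h (k + 1)) (sample p H (R ω) k)
          ≤ p.γ * p.radius H k (empErr ((R ω).h (k + 1)) (sample p H (R ω) k))} := by
      ext ω
      simp [good, goodFrom, hg, show k ≠ 0 by omega]
    rw [e]
    have hm := measurable_minErr_of hp hH hR h1 hk.le hS
    exact measurableSet_le
      ((@measurable_empErr_of _ _ _ _ _ _ hp hH _ hk.le (ℱ (p.τ k)) hS _ hg).sub hm)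
      (((p.measurable_radius H k).comp hm).const_mul p.γ)

theorem measurableSet_region_of (hp : p.Valid H) (hH : ∀ h ∈ H, Measurable h)
    (hR : IsRun μ ℱ ν p H R) {k : ℕ} (hk : k < p.M)
    (hS : ∀ φ : 𝒳 × Bool → ℝ, Measurable φ →
      Measurable[ℱ (p.τ k)] fun ω => wsum φ (sample p H (R ω) k)) :
    MeasurableSet[(ℱ (p.τ k)).prod inferInstance]
      {a : Ω × 𝒳 | a.2 ∈ region p H (R a.1) (k + 1)} := by
  have hsub : ∀ ω, good p H (R ω) (k + 1) ⊆ {g | g ∈ H} := by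
    intro ω g hg
    rw [good, goodFrom] at hg
    split_ifs at hg
    · exact hg
    · exact hg.1
  have e : {a : Ω × 𝒳 | a.2 ∈ region p H (R a.1) (k + 1)}
      = ⋃ g ∈ H, ⋃ g' ∈ H, (Prod.fst ⁻¹' {ω | g ∈ good p H (R ω) (k + 1)} ∩
          Prod.fst ⁻¹' {ω | g' ∈ good p H (R ω) (k + 1)}) ∩
          Prod.snd ⁻¹' {x | g x ≠ g' x} := by
    ext ⟨ω, x⟩
    simp only [region, DIS, Set.mem_ofPred_eq, Set.mem_iUnion, Set.mem_inter_iff, Set.mem_preimage]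
    constructor
    · rintro ⟨g, hg, g', hg', hx⟩
      exact ⟨g, hsub ω hg, g', hsub ω hg', ⟨hg, hg'⟩, hx⟩
    · rintro ⟨g, _, g', _, ⟨hg, hg'⟩, hx⟩
      exact ⟨g, hg, g', hg', hx⟩
  rw [e]
  refine @Finset.measurableSet_biUnion _ _ ((ℱ (p.τ k)).prod inferInstance) _ H fun g hg =>
    @Finset.measurableSet_biUnion _ _ ((ℱ (p.τ k)).prod inferInstance) _ H fun g' hg' => ?_
  have hf : @Measurable _ _ ((ℱ (p.τ k)).prod inferInstance) (ℱ (p.τ k)) (Prod.fst : Ω × 𝒳 → Ω) :=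
    @measurable_fst _ _ (ℱ (p.τ k)) _
  have hs : @Measurable _ _ ((ℱ (p.τ k)).prod inferInstance) _ (Prod.snd : Ω × 𝒳 → 𝒳) :=
    @measurable_snd _ _ (ℱ (p.τ k)) _
  exact ((hf (measurableSet_good_of hp hH hR hk hS hg)).inter
    (hf (measurableSet_good_of hp hH hR hk hS hg'))).inter
    (hs (measurableSet_eq_fun (hH g hg) (hH g' hg')).compl)

theorem measurableSet_domain_of (hp : p.Valid H) (hH : ∀ h ∈ H, Measurable h)
    (hR : IsRun μ ℱ ν p H R) {k : ℕ} (hk : k < p.M)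
    (hS : ∀ φ : 𝒳 × Bool → ℝ, Measurable φ →
      Measurable[ℱ (p.τ k)] fun ω => wsum φ (sample p H (R ω) k)) :
    MeasurableSet[(ℱ (p.τ k)).prod inferInstance]
      {a : Ω × 𝒳 | a.2 ∈ domain p H (R a.1) (k + 1)} := by
  rcases Nat.eq_zero_or_pos k with rfl | h1
  · simp [domain]
  · simpa [domain, show k ≠ 0 by omega] using measurableSet_region_of hp hH hR hk hS

theorem measurable_prob (hR : IsRun μ ℱ ν p H R) {k : ℕ} (hk : k < p.M) :
    Measurable[(ℱ (p.τ k)).prod inferInstance] fun a : Ω × 𝒳 => prob (R a.1) (k + 1) a.2 := by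
  rcases Nat.eq_zero_or_pos k with rfl | h1
  · simp [prob]
  · simpa [prob, show k ≠ 0 by omega] using hR.P_measurable k h1 hk

/-- The value of `φ` at a point labelled by the current classifier. In the first epoch the
domain is the whole space and no such label is used. -/
theorem measurable_label (hH : ∀ h ∈ H, Measurable h)
    (hR : IsRun μ ℱ ν p H R) {k : ℕ} (h1 : 1 ≤ k) (hk : k < p.M) {φ : 𝒳 × Bool → ℝ}
    (hφ : Measurable φ) :
    Measurable[(ℱ (p.τ k)).prod inferInstance]
      fun a : Ω × 𝒳 => φ (a.2, (R a.1).h (k + 1) a.2) := by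
  have hf : @Measurable _ _ ((ℱ (p.τ k)).prod inferInstance) (ℱ (p.τ k)) (Prod.fst : Ω × 𝒳 → Ω) :=
    @measurable_fst _ _ (ℱ (p.τ k)) _
  have hs : @Measurable _ _ ((ℱ (p.τ k)).prod inferInstance) _ (Prod.snd : Ω × 𝒳 → 𝒳) :=
    @measurable_snd _ _ (ℱ (p.τ k)) _
  refine @measurable_finite_choice _ _ _ ((ℱ (p.τ k)).prod inferInstance) _ H
    (fun a : Ω × 𝒳 => (R a.1).h (k + 1)) (fun a => hR.erm_mem k h1 hk.le a.1)
    (fun g hg => hf (hR.erm_measurable k h1 hk.le g hg))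
    (fun g a => φ (a.2, g a.2)) (fun g hg => ?_)
  exact hφ.comp (hs.prodMk ((hH g hg).comp hs))

open Classical in
theorem measurable_domain_ite (hp : p.Valid H) (hH : ∀ h ∈ H, Measurable h)
    (hR : IsRun μ ℱ ν p H R) {k : ℕ} (hk : k < p.M)
    (hS : ∀ φ : 𝒳 × Bool → ℝ, Measurable φ →
      Measurable[ℱ (p.τ k)] fun ω => wsum φ (sample p H (R ω) k))
    {φ : 𝒳 × Bool → ℝ} (hφ : Measurable φ) {F : Ω × (𝒳 × Bool) → ℝ}
    (hF : Measurable[(ℱ (p.τ k)).prod inferInstance] F) :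
    Measurable[(ℱ (p.τ k)).prod inferInstance] fun a : Ω × (𝒳 × Bool) =>
      if a.2.1 ∈ domain p H (R a.1) (k + 1) then F a else φ (a.2.1, (R a.1).h (k + 1) a.2.1) := by
  rcases Nat.eq_zero_or_pos k with rfl | h1
  · simpa [domain] using hF
  · have hpr : @Measurable _ _ ((ℱ (p.τ k)).prod inferInstance) ((ℱ (p.τ k)).prod inferInstance)
        (fun a : Ω × (𝒳 × Bool) => (a.1, a.2.1)) :=
      @Measurable.prodMk _ ((ℱ (p.τ k)).prod inferInstance) _ _ (ℱ (p.τ k)) _ _ _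
        (@measurable_fst _ _ (ℱ (p.τ k)) _)
        (measurable_fst.comp (@measurable_snd _ _ (ℱ (p.τ k)) _))
    exact Measurable.ite (hpr (measurableSet_domain_of hp hH hR hk hS)) hF
      ((measurable_label hH hR h1 hk hφ).comp hpr)

theorem measurable_stepVal_of (hp : p.Valid H) (hH : ∀ h ∈ H, Measurable h)
    (hR : IsRun μ ℱ ν p H R) {k : ℕ} (hk : k < p.M)
    (hS : ∀ φ : 𝒳 × Bool → ℝ, Measurable φ →
      Measurable[ℱ (p.τ k)] fun ω => wsum φ (sample p H (R ω) k))
    {φ : 𝒳 × Bool → ℝ} (hφ : Measurable φ) {i : ℕ} (hi : p.τ k ≤ i) (hi' : i < p.τ (k + 1)) :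
    Measurable[ℱ (i + 1)] fun ω => stepVal p H (R ω) φ (k + 1) (i + 1) := by
  classical
  have hin : i + 1 ≤ p.n := by have := hp.τ_le_n (m := k + 1) (by omega); omega
  have hx := hR.x_adapted (i + 1) (by omega) hin
  have hy := hR.y_adapted (i + 1) (by omega) hin
  have hq := hR.q_adapted (i + 1) (by omega) hin
  have hid : @Measurable Ω Ω (ℱ (i + 1)) (ℱ (p.τ k)) id := measurable_id'' (ℱ.mono (by omega))
  have hpair : @Measurable _ _ (ℱ (i + 1)) ((ℱ (p.τ k)).prod inferInstance)
      (fun ω => (ω, (R ω).x (i + 1))) :=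
    @Measurable.prodMk _ (ℱ (i + 1)) _ _ (ℱ (p.τ k)) _ _ _ hid hx
  have htriple : @Measurable _ _ (ℱ (i + 1)) ((ℱ (p.τ k)).prod inferInstance)
      (fun ω => (ω, ((R ω).x (i + 1), (R ω).y (i + 1)))) :=
    @Measurable.prodMk _ (ℱ (i + 1)) _ _ (ℱ (p.τ k)) _ _ _ hid (hx.prodMk hy)
  -- The inferred label is only measurable behind the domain test, since nothing is known about `h
  -- 1`; hence the doubled test in `e` below.
  have h0 := (measurable_domain_ite hp hH hR hk hS hφ
    (F := fun _ => 0) measurable_const).comp htriple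
  have hset := hpair (measurableSet_domain_of hp hH hR hk hS)
  have hval : Measurable[ℱ (i + 1)] fun ω => if (R ω).q (i + 1) = true then
      1 / prob (R ω) (k + 1) ((R ω).x (i + 1)) * φ ((R ω).x (i + 1), (R ω).y (i + 1)) else 0 :=
    Measurable.ite (hq (measurableSet_singleton true))
      ((((measurable_prob hR hk).comp hpair).const_div 1).mul (hφ.comp (hx.prodMk hy)))
      measurable_const
  have e : (fun ω => stepVal p H (R ω) φ (k + 1) (i + 1)) = fun ω =>
      if (R ω).x (i + 1) ∈ domain p H (R ω) (k + 1) then (if (R ω).q (i + 1) = true then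
        1 / prob (R ω) (k + 1) ((R ω).x (i + 1)) * φ ((R ω).x (i + 1), (R ω).y (i + 1)) else 0)
      else (if (R ω).x (i + 1) ∈ domain p H (R ω) (k + 1) then 0 else
        φ ((R ω).x (i + 1), (R ω).h (k + 1) ((R ω).x (i + 1)))) := by
    funext ω
    unfold stepVal
    split_ifs <;> rfl
  rw [e]
  exact Measurable.ite hset hval h0

theorem measurable_wsum_sample (hp : p.Valid H) (hH : ∀ h ∈ H, Measurable h)
    (hR : IsRun μ ℱ ν p H R) {k : ℕ} (hk : k ≤ p.M) (φ : 𝒳 × Bool → ℝ) (hφ : Measurable φ) :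
    Measurable[ℱ (p.τ k)] fun ω => wsum φ (sample p H (R ω) k) := by
  induction k generalizing φ with
  | zero => simp [wsum, sample]
  | succ k ih =>
    have hS := ih (by omega)
    have e : (fun ω => wsum φ (sample p H (R ω) (k + 1))) = fun ω =>
        wsum φ (sample p H (R ω) k) + ∑ i ∈ Finset.Ico (p.τ k) (p.τ (k + 1)),
          stepVal p H (R ω) φ (k + 1) (i + 1) := by
      funext ω
      refine wsum_sample_succ _ _ _ ?_
      rintro rfl i hi
      rw [hp.τ_zero, hp.τ_one, Finset.mem_Ico] at hi
      exact hR.query_first _ (by omega) (by omega) ω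
    rw [e]
    refine ((hS φ hφ).mono (ℱ.mono (hp.τ_mono_succ (by omega)).le) le_rfl).add ?_
    refine Finset.measurable_fun_sum _ fun i hi => ?_
    obtain ⟨h1, h2⟩ := Finset.mem_Ico.1 hi
    exact (measurable_stepVal_of hp hH hR (by omega) hS hφ h1 h2).mono (ℱ.mono h2) le_rfl

theorem measurable_probFloor (hp : p.Valid H) (hH : ∀ h ∈ H, Measurable h)
    (hR : IsRun μ ℱ ν p H R) {k : ℕ} (hk : k < p.M) :
    Measurable[ℱ (p.τ k)] fun ω => probFloor p H (R ω) (k + 1) := by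
  rcases Nat.eq_zero_or_pos k with rfl | h1
  · simp [probFloor]
  · have hm := measurable_minErr_of hp hH hR h1 hk.le (measurable_wsum_sample hp hH hR hk.le)
    simp only [probFloor, Pmin, show ¬ k + 1 ≤ 1 by omega, if_false, Nat.add_sub_cancel]
    exact (((((hm.const_mul _).div_const _).sqrt).add_const _).const_div _).min measurable_const

end

/-! ### Exponential tail bounds along a run -/

section

variable [MeasurableSpace 𝒳] {Ω : Type v} {mΩ : MeasurableSpace Ω} {μ : Measure Ω}
  {ℱ : Filtration ℕ mΩ} {ν : Measure (𝒳 × Bool)} {p : Params} {H : Finset (𝒳 → Bool)}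
  {R : Ω → Path 𝒳}

theorem Filtration.prod_mono {Z : Type*} [MeasurableSpace Z] (ℱ : Filtration ℕ mΩ) {a b : ℕ}
    (hab : a ≤ b) :
    (ℱ a).prod (inferInstance : MeasurableSpace Z) ≤ (ℱ b).prod inferInstance :=
  sup_le_sup (MeasurableSpace.comap_mono (ℱ.mono hab)) le_rfl

theorem IsRun.measurable_example (hR : IsRun μ ℱ ν p H R) {i : ℕ} (hi : i < p.n) :
    Measurable fun ω => ((R ω).x (i + 1), (R ω).y (i + 1)) :=
  (((hR.x_adapted (i + 1) (by omega) hi).mono (ℱ.le _) le_rfl)).prodMk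
    ((hR.y_adapted (i + 1) (by omega) hi).mono (ℱ.le _) le_rfl)

theorem IsRun.prob_mem_unit (hR : IsRun μ ℱ ν p H R) {k : ℕ} (hk : k < p.M) (ω : Ω) (x : 𝒳) :
    0 ≤ prob (R ω) (k + 1) x ∧ prob (R ω) (k + 1) x ≤ 1 := by
  rcases Nat.eq_zero_or_pos k with rfl | h1
  · simp [prob]
  · have h := (hR.solves k h1 hk ω).1
    simpa [prob, show k ≠ 0 by omega] using And.intro (h.nonneg x) (h.le_one x)

theorem IsRun.probFloor_le_prob (hR : IsRun μ ℱ ν p H R) {k : ℕ} (hk : k < p.M) (ω : Ω) {x : 𝒳}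
    (hx : x ∈ domain p H (R ω) (k + 1)) :
    probFloor p H (R ω) (k + 1) ≤ prob (R ω) (k + 1) x := by
  rcases Nat.eq_zero_or_pos k with rfl | h1
  · simp [prob, probFloor]
  · have h := (hR.solves k h1 hk ω).1
    simp only [domain, prob, probFloor, show ¬ k + 1 ≤ 1 by omega, if_false] at hx ⊢
    exact h.ge_min x hx

open Classical in
theorem IsRun.condExp_query [IsProbabilityMeasure μ] (hp : p.Valid H) (hR : IsRun μ ℱ ν p H R)
    {k i : ℕ} (hk : k < p.M) (h1 : p.τ k ≤ i) (h2 : i < p.τ (k + 1)) :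
    μ[fun ω => if (R ω).q (i + 1) = true then (1 : ℝ) else 0 |
        ℱ i ⊔ MeasurableSpace.comap (fun ω => ((R ω).x (i + 1), (R ω).y (i + 1))) inferInstance]
      =ᵐ[μ] fun ω => if (R ω).x (i + 1) ∈ domain p H (R ω) (k + 1) then
        prob (R ω) (k + 1) ((R ω).x (i + 1)) else 0 := by
  have hin : i < p.n := h2.trans_le (hp.τ_le_n (by omega))
  rcases Nat.eq_zero_or_pos k with rfl | hk1
  · rw [hp.τ_one] at h2
    have e : (fun ω => if (R ω).q (i + 1) = true then (1 : ℝ) else 0) = fun _ => 1 := by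
      funext ω
      rw [if_pos (hR.query_first (i + 1) (by omega) (by omega) ω)]
    rw [e, condExp_const (sup_le (ℱ.le i) (hR.measurable_example hin).comap_le)]
    simp [domain, prob]
  · refine (hR.query_inside k hk1 hk i h1 h2).trans (Filter.Eventually.of_forall fun ω => ?_)
    simp only [domain, prob, show ¬ k + 1 ≤ 1 by omega, if_false, Set.indicator_apply]

-- A Freedman type bound with deterministic tilt. The floors are random, so each increment is
-- switched off when the floor of its own epoch, known when that epoch starts, is below `l`. On the
-- event in the statement nothing is switched off, and the sum of increments is the displayed
-- statistic.
open Classical in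
theorem IsRun.measure_wsum_deviation_le [IsProbabilityMeasure μ] (hp : p.Valid H)
    (hH : ∀ h ∈ H, Measurable h) (hR : IsRun μ ℱ ν p H R) {φ : 𝒳 × Bool → ℝ} (hφ : Measurable φ)
    (hφ1 : ∀ z, |φ z| ≤ 1) {l : ℝ} (hl : 0 < l) (hl1 : l ≤ 1) {m : ℕ} (hm : m ≤ p.M) (x : ℝ) :
    μ {ω | (∀ k < m, l ≤ probFloor p H (R ω) (k + 1)) ∧
        x ≤ l * (wsum φ (sample p H (R ω) m) - epochSum p (stepMean ν p H (R ω) φ) m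
          - l * epochSum p (stepVar ν p H (R ω) φ) m)} ≤ ENNReal.ofReal (Real.exp (-x)) := by
  set ψ : ℕ → Ω → ℝ := fun i ω =>
    if ω ∈ {ω | l ≤ probFloor p H (R ω) (p.epoch i + 1)} then
      l * stepVal p H (R ω) φ (p.epoch i + 1) (i + 1)
      - l * stepMean ν p H (R ω) φ (p.epoch i + 1)
      - l ^ 2 * stepVar ν p H (R ω) φ (p.epoch i + 1) else 0 with hψ
  have hS := fun k (hk : k ≤ p.M) => measurable_wsum_sample hp hH hR hk
  have hCm : ∀ i < p.τ m, MeasurableSet[ℱ i] {ω | l ≤ probFloor p H (R ω) (p.epoch i + 1)} := by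
    intro i hi
    obtain ⟨hk, h1, _⟩ := hp.epoch_spec (hi.trans_le (hp.τ_le_n hm))
    exact ℱ.mono h1 _ (measurableSet_le measurable_const (measurable_probFloor hp hH hR hk))
  have ham : ∀ i < p.τ m, Measurable[(ℱ i).prod inferInstance] fun a : Ω × (𝒳 × Bool) =>
      if a.2.1 ∈ domain p H (R a.1) (p.epoch i + 1) then φ a.2
      else φ (a.2.1, (R a.1).h (p.epoch i + 1) a.2.1) := by
    intro i hi
    obtain ⟨hk, h1, _⟩ := hp.epoch_spec (hi.trans_le (hp.τ_le_n hm))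
    refine (measurable_domain_ite hp hH hR hk (hS _ hk.le) hφ (F := fun a => φ a.2) ?_).mono
      (Filtration.prod_mono ℱ h1) le_rfl
    exact hφ.comp (@measurable_snd _ _ (ℱ (p.τ (p.epoch i))) _)
  have hfs : ∀ i, @Measurable _ _ ((ℱ i).prod inferInstance) ((ℱ i).prod inferInstance)
      (fun a : Ω × (𝒳 × Bool) => (a.1, a.2.1)) := fun i =>
    @Measurable.prodMk _ ((ℱ i).prod inferInstance) _ _ (ℱ i) _ _ _ (@measurable_fst _ _ (ℱ i) _)
      (measurable_fst.comp (@measurable_snd _ _ (ℱ i) _))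
  have hDm : ∀ i < p.τ m, MeasurableSet[(ℱ i).prod inferInstance]
      {a : Ω × (𝒳 × Bool) | a.2.1 ∈ domain p H (R a.1) (p.epoch i + 1)} := by
    intro i hi
    obtain ⟨hk, h1, _⟩ := hp.epoch_spec (hi.trans_le (hp.τ_le_n hm))
    exact hfs i (Filtration.prod_mono ℱ h1 _ (measurableSet_domain_of hp hH hR hk (hS _ hk.le)))
  have hPm : ∀ i < p.τ m, Measurable[(ℱ i).prod inferInstance]
      fun a : Ω × (𝒳 × Bool) => prob (R a.1) (p.epoch i + 1) a.2.1 := by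
    intro i hi
    obtain ⟨hk, h1, _⟩ := hp.epoch_spec (hi.trans_le (hp.τ_le_n hm))
    exact ((measurable_prob hR hk).mono (Filtration.prod_mono ℱ h1) le_rfl).comp (hfs i)
  have hmeas : ∀ i < p.τ m, Measurable[ℱ (i + 1)] (ψ i) := by
    intro i hi
    have hin := hi.trans_le (hp.τ_le_n hm)
    obtain ⟨hk, h1, h2⟩ := hp.epoch_spec hin
    have hν : IsProbabilityMeasure ν := by
      rw [← hR.law i hin]
      exact Measure.isProbabilityMeasure_map (hR.measurable_example hin).aemeasurable
    have hmean : Measurable[ℱ i] fun ω => stepMean ν p H (R ω) φ (p.epoch i + 1) :=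
      (@StronglyMeasurable.integral_prod_right' _ _ _ (ℱ i) _ _ _ _ _ _
        (ham i hi).stronglyMeasurable).measurable
    have hvar : Measurable[ℱ i] fun ω => stepVar ν p H (R ω) φ (p.epoch i + 1) := by
      refine (@StronglyMeasurable.integral_prod_right' _ _ _ (ℱ i) _ _ _ _ _
        (fun a : Ω × (𝒳 × Bool) => if a.2.1 ∈ domain p H (R a.1) (p.epoch i + 1) then
          1 / prob (R a.1) (p.epoch i + 1) a.2.1 * φ a.2 ^ 2
          else φ (a.2.1, (R a.1).h (p.epoch i + 1) a.2.1) ^ 2) ?_).measurable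
      have := @Measurable.ite _ _ _ _ ((ℱ i).prod inferInstance) _ _ (Classical.decPred _)
        (hDm i hi) (((hPm i hi).const_div 1).mul ((ham i hi).pow_const 2)) ((ham i hi).pow_const 2)
      refine Measurable.stronglyMeasurable
        ((congrArg (@Measurable _ _ ((ℱ i).prod inferInstance) _) ?_).mp this)
      funext a
      simp only [Pi.mul_apply]
      split_ifs <;> rfl
    have hle : ℱ i ≤ ℱ (i + 1) := ℱ.mono (Nat.le_succ i)
    refine Measurable.ite (hle _ (hCm i hi)) (Measurable.sub (Measurable.sub ?_ ?_) ?_)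
      measurable_const
    · exact (measurable_stepVal_of hp hH hR hk (hS _ hk.le) hφ h1 h2).const_mul l
    · exact (hmean.mono hle le_rfl).const_mul l
    · exact (hvar.mono hle le_rfl).const_mul (l ^ 2)
  have hstep : ∀ i < p.τ m, ∀ F : Ω → ENNReal, Measurable[ℱ i] F →
      ∫⁻ ω, F ω * ENNReal.ofReal (Real.exp (ψ i ω)) ∂μ ≤ ∫⁻ ω, F ω ∂μ := by
    intro i hi F hF
    have hin := hi.trans_le (hp.τ_le_n hm)
    obtain ⟨hk, h1, h2⟩ := hp.epoch_spec hin
    have hqm : Measurable fun ω => (R ω).q (i + 1) :=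
      (hR.q_adapted (i + 1) (by omega) hin).mono (ℱ.le _) le_rfl
    have key := lintegral_mul_exp_weighted_step_le (ℱ.le i) (hR.measurable_example hin)
      (hR.indep i hin) hqm (hDm i hi) (hPm i hi) (fun a => (hR.prob_mem_unit hk a.1 a.2.1).1)
      (fun a => (hR.prob_mem_unit hk a.1 a.2.1).2) (hR.condExp_query hp hk h1 h2) (ham i hi)
      (fun b => by split_ifs <;> exact hφ1 _) hl hl1 (hCm i hi)
      (fun ω hω z' hz' => le_trans hω (hR.probFloor_le_prob hk ω hz')) hF
    rw [hR.law i hin] at key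
    refine le_trans (le_of_eq (lintegral_congr fun ω => ?_)) key
    simp only [hψ, stepVal, stepMean, stepVar, Set.mem_ofPred_eq]
    congr 5
    · congr 2
      split_ifs <;> rfl
    · congr 1
      refine integral_congr_ae (Filter.Eventually.of_forall fun z' => ?_)
      simp only
      split_ifs <;> rfl
  refine (measure_mono ?_).trans (measure_sum_ge_le_exp_neg ℱ ψ (p.τ m) hmeas hstep x)
  rintro ω ⟨hC, hx⟩
  refine hx.trans (le_of_eq ?_)
  rw [wsum_sample_eq_sum hp _ (fun i h1 h3 => hR.query_first i h1 h3 ω) φ hm,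
    epochSum_eq_sum hp _ hm, epochSum_eq_sum hp _ hm, mul_sub, mul_sub, Finset.mul_sum,
    Finset.mul_sum, ← mul_assoc, Finset.mul_sum, ← Finset.sum_sub_distrib,
    ← Finset.sum_sub_distrib]
  refine Finset.sum_congr rfl fun i hi => ?_
  have hi' := Finset.mem_range.1 hi
  obtain ⟨hk, h1, h2⟩ := hp.epoch_spec (hi'.trans_le (hp.τ_le_n hm))
  have hlt : p.epoch i < m := by
    by_contra hcon
    have := hp.τ_mono (not_lt.1 hcon) hk.le
    omega
  simp only [hψ, Set.mem_ofPred_eq, if_pos (hC _ hlt), pow_two]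

open Classical in
/-- Number of examples after the first epoch that fall into the current disagreement region. -/
def regionCount (p : Params) (H : Finset (𝒳 → Bool)) (r : Path 𝒳) : ℝ :=
  ∑ i ∈ Finset.range p.n,
    if 1 ≤ p.epoch i ∧ r.x (i + 1) ∈ region p H r (p.epoch i + 1) then 1 else 0

/-- Probability of the disagreement region of epoch `m`, set to zero in the first epoch. -/
def regionMass (ν : Measure (𝒳 × Bool)) (p : Params) (H : Finset (𝒳 → Bool))
    (r : Path 𝒳) (m : ℕ) : ℝ :=
  if m ≤ 1 then 0 else (ν.map Prod.fst).real (region p H r m)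

-- The same supermartingale step, for indicators and `l = 1 / 2`. An indicator equals its square, so
-- the compensator is `1/2 + 1/4` times the mass, which becomes `3/2` after doubling.
open Classical in
theorem IsRun.measure_regionCount_le [IsProbabilityMeasure μ] (hp : p.Valid H)
    (hH : ∀ h ∈ H, Measurable h) (hR : IsRun μ ℱ ν p H R) (x : ℝ) :
    μ {ω | 3 / 2 * epochSum p (regionMass ν p H (R ω)) p.M + 2 * x ≤ regionCount p H (R ω)}
      ≤ ENNReal.ofReal (Real.exp (-x)) := by
  have hS := fun k (hk : k ≤ p.M) => measurable_wsum_sample hp hH hR hk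
  set a : ℕ → Ω × (𝒳 × Bool) → ℝ := fun i b =>
    if 1 ≤ p.epoch i ∧ b.2.1 ∈ region p H (R b.1) (p.epoch i + 1) then 1 else 0 with ha
  set ψ : ℕ → Ω → ℝ := fun i ω => 1 / 2 * a i (ω, ((R ω).x (i + 1), (R ω).y (i + 1)))
    - 1 / 2 * regionMass ν p H (R ω) (p.epoch i + 1)
    - (1 / 2) ^ 2 * regionMass ν p H (R ω) (p.epoch i + 1) with hψ
  have ham : ∀ i < p.n, Measurable[(ℱ i).prod inferInstance] (a i) := by
    intro i hi
    obtain ⟨hk, h1, _⟩ := hp.epoch_spec hi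
    have hfs : @Measurable _ _ ((ℱ i).prod inferInstance) ((ℱ i).prod inferInstance)
        (fun a : Ω × (𝒳 × Bool) => (a.1, a.2.1)) :=
      @Measurable.prodMk _ ((ℱ i).prod inferInstance) _ _ (ℱ i) _ _ _
        (@measurable_fst _ _ (ℱ i) _) (measurable_fst.comp (@measurable_snd _ _ (ℱ i) _))
    have hreg := hfs (Filtration.prod_mono ℱ h1 _
      (measurableSet_region_of hp hH hR hk (hS _ hk.le)))
    exact Measurable.ite ((MeasurableSet.const _).inter hreg) measurable_const measurable_const
  have hsec : ∀ i < p.n, ∀ ω, ∫ z', a i (ω, z') ∂ν = regionMass ν p H (R ω) (p.epoch i + 1) := by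
    intro i hi ω
    obtain ⟨hk, h1, _⟩ := hp.epoch_spec hi
    simp only [ha, regionMass]
    by_cases h : 1 ≤ p.epoch i
    · have hsm : MeasurableSet (region p H (R ω) (p.epoch i + 1)) := by
        have hsec : @Measurable 𝒳 (Ω × 𝒳) _ ((ℱ (p.τ (p.epoch i))).prod inferInstance)
            (fun x => (ω, x)) :=
          @Measurable.prodMk _ _ _ _ (ℱ (p.τ (p.epoch i))) _ _ _
            (@measurable_const _ _ (ℱ (p.τ (p.epoch i))) _ ω) measurable_id
        exact hsec (measurableSet_region_of hp hH hR hk (hS _ hk.le))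
      have e : (fun z' : 𝒳 × Bool => if 1 ≤ p.epoch i ∧ z'.1 ∈ region p H (R ω) (p.epoch i + 1)
          then (1 : ℝ) else 0)
          = (Prod.fst ⁻¹' region p H (R ω) (p.epoch i + 1)).indicator 1 := by
        funext z'
        simp [Set.indicator_apply, h]
      rw [e, integral_indicator_one (measurable_fst hsm), if_neg (by omega),
        map_measureReal_apply measurable_fst hsm]
    · simp [show p.epoch i = 0 by omega]
  have hmass : ∀ i < p.n,
      Measurable[ℱ i] fun ω => regionMass ν p H (R ω) (p.epoch i + 1) := by
    intro i hi
    have hν : IsProbabilityMeasure ν := by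
      rw [← hR.law i hi]
      exact Measure.isProbabilityMeasure_map (hR.measurable_example hi).aemeasurable
    have := (@StronglyMeasurable.integral_prod_right' _ _ _ (ℱ i) _ ν _ _ _ _
      (ham i hi).stronglyMeasurable).measurable
    simpa only [hsec i hi] using this
  have hmeas : ∀ i < p.n, Measurable[ℱ (i + 1)] (ψ i) := by
    intro i hi
    have hle : ℱ i ≤ ℱ (i + 1) := ℱ.mono (Nat.le_succ i)
    have hx := hR.x_adapted (i + 1) (by omega) hi
    have hy := hR.y_adapted (i + 1) (by omega) hi
    have htriple : @Measurable _ _ (ℱ (i + 1)) ((ℱ i).prod inferInstance)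
        (fun ω => (ω, ((R ω).x (i + 1), (R ω).y (i + 1)))) :=
      @Measurable.prodMk _ (ℱ (i + 1)) _ _ (ℱ i) _ _ _ (measurable_id'' hle) (hx.prodMk hy)
    have h2 := (hmass i hi).mono hle le_rfl
    exact ((((ham i hi).comp htriple).const_mul _).sub (h2.const_mul _)).sub (h2.const_mul _)
  have hstep : ∀ i < p.n, ∀ F : Ω → ENNReal, Measurable[ℱ i] F →
      ∫⁻ ω, F ω * ENNReal.ofReal (Real.exp (ψ i ω)) ∂μ ≤ ∫⁻ ω, F ω ∂μ := by
    intro i hi F hF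
    -- With `D = ∅` no decision enters: the decision is a constant and the probability function is
    -- trivial.
    have key := lintegral_mul_exp_weighted_step_le (ℱ.le i) (hR.measurable_example hi)
      (hR.indep i hi) (q := fun _ => false) measurable_const (D := ∅)
      (@MeasurableSet.empty _ ((ℱ i).prod inferInstance)) (P := fun _ => 1)
      measurable_const (fun _ => zero_le_one) (fun _ => le_rfl)
      (by simp) (ham i hi)
      (fun b => by simp only [ha]; split_ifs <;> simp) (l := 1 / 2) (by norm_num) (by norm_num)
      (C := Set.univ) MeasurableSet.univ (by simp) hF
    rw [hR.law i hi] at key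
    refine le_trans (le_of_eq (lintegral_congr fun ω => ?_)) key
    have hsq : ∀ b, a i b ^ 2 = a i b := fun b => by simp only [ha]; split_ifs <;> norm_num
    simp only [hψ, Set.mem_univ, if_true, Set.mem_empty_iff_false, if_false, hsq, hsec i hi]
  refine (measure_mono ?_).trans (measure_sum_ge_le_exp_neg ℱ ψ p.n hmeas hstep x)
  intro ω hω
  have e : ∑ i ∈ Finset.range p.n, ψ i ω = 1 / 2 * regionCount p H (R ω)
      - 3 / 4 * epochSum p (regionMass ν p H (R ω)) p.M := by
    rw [epochSum_eq_sum hp _ le_rfl, regionCount, Finset.mul_sum, Finset.mul_sum,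
      Params.n, ← Finset.sum_sub_distrib]
    refine Finset.sum_congr rfl fun i _ => ?_
    simp only [hψ, ha]
    ring
  have hω' : 3 / 2 * epochSum p (regionMass ν p H (R ω)) p.M + 2 * x ≤ regionCount p H (R ω) := hω
  change x ≤ _
  rw [e]
  linarith

end

/-! ### Pathwise facts -/

/-- What holds surely along every path of a run. -/
structure IsPath [MeasurableSpace 𝒳] (ν : Measure (𝒳 × Bool)) (p : Params)
    (H : Finset (𝒳 → Bool)) (r : Path 𝒳) : Prop where
  valid : p.Valid H
  measurable : ∀ h ∈ H, Measurable h
  δ_pos : 0 < p.δ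
  card_large : √192 < H.card / p.δ
  erm_mem : ∀ m, 1 ≤ m → m ≤ p.M → r.h (m + 1) ∈ H
  erm_min : ∀ m, 1 ≤ m → m ≤ p.M → ∀ g ∈ H,
    empErr (r.h (m + 1)) (sample p H r m) ≤ empErr g (sample p H r m)
  feasible : ∀ m, 1 ≤ m → m < p.M → Feasible ν p H r (m + 1) (r.P (m + 1))
  query_first : ∀ i, 1 ≤ i → i ≤ 3 → r.q i = true

/-- `log (|H|/δ) + log τ_m`. -/
def logTerm (p : Params) (H : Finset (𝒳 → Bool)) (m : ℕ) : ℝ :=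
  Real.log (H.card / p.δ) + Real.log (p.τ m)

/-- Minimal weighted number of mistakes after epoch `m`. -/
def minLoss (p : Params) (H : Finset (𝒳 → Bool)) (r : Path 𝒳) (m : ℕ) : ℝ :=
  wsum (loss (r.h (m + 1))) (sample p H r m)

/-- The radius `Δ_m` multiplied by the sample size. -/
def amp (p : Params) (H : Finset (𝒳 → Bool)) (r : Path 𝒳) (m : ℕ) : ℝ :=
  p.τ m * Delta p H r m

theorem wsum_sub (φ ψ : 𝒳 × Bool → ℝ) (S : Multiset (𝒳 × Bool × ℝ)) :
    wsum (fun z => φ z - ψ z) S = wsum φ S - wsum ψ S := by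
  simp only [wsum, mul_sub, Multiset.sum_map_sub]

theorem wsum_neg (φ : 𝒳 × Bool → ℝ) (S : Multiset (𝒳 × Bool × ℝ)) :
    wsum (fun z => -φ z) S = -wsum φ S := by
  have h := wsum_sub (fun _ => 0) φ S
  simp only [zero_sub] at h
  rw [h]
  simp [wsum]

theorem loss_nonneg (h : 𝒳 → Bool) (z : 𝒳 × Bool) : 0 ≤ loss h z := by
  unfold loss; split_ifs <;> norm_num

theorem loss_le_one (h : 𝒳 → Bool) (z : 𝒳 × Bool) : loss h z ≤ 1 := by
  unfold loss; split_ifs <;> norm_num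

theorem log_three_ge_one : (1 : ℝ) ≤ Real.log 3 := by
  rw [Real.le_log_iff_exp_le (by norm_num)]
  exact Real.exp_one_lt_three.le

theorem log_le_half_self {x : ℝ} (hx : 0 < x) : Real.log x ≤ x / 2 := by
  have h1 : Real.log x = 2 * Real.log (√x) := by
    rw [Real.log_sqrt hx.le]; ring
  have h2 := Real.log_le_sub_one_of_pos (Real.sqrt_pos.2 hx)
  nlinarith [Real.sq_sqrt hx.le, sq_nonneg (√x - 2)]

theorem goodFrom_subset (p : Params) (H : Finset (𝒳 → Bool)) (r : Path 𝒳) (m : ℕ)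
    (S : Multiset (𝒳 × Bool × ℝ)) : ∀ g ∈ goodFrom p H r m S, g ∈ H := by
  intro g hg
  rw [goodFrom] at hg
  split_ifs at hg
  · exact hg
  · exact hg.1

namespace Params.Valid

variable {p : Params} {H : Finset (𝒳 → Bool)}

theorem τ_ge_three (hp : p.Valid H) {m : ℕ} (h1 : 1 ≤ m) (hm : m ≤ p.M) :
    (3 : ℝ) ≤ p.τ m := by
  have := hp.τ_ge h1 hm
  exact_mod_cast (by omega : 3 ≤ p.τ m)

theorem log_τ_ge_one (hp : p.Valid H) {m : ℕ} (h1 : 1 ≤ m) (hm : m ≤ p.M) :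
    1 ≤ Real.log (p.τ m) :=
  log_three_ge_one.trans (Real.log_le_log (by norm_num) (hp.τ_ge_three h1 hm))

theorem log_τ_mono (hp : p.Valid H) {a b : ℕ} (h1 : 1 ≤ a) (hab : a ≤ b) (hb : b ≤ p.M) :
    Real.log (p.τ a) ≤ Real.log (p.τ b) :=
  Real.log_le_log (by linarith [hp.τ_ge_three h1 (hab.trans hb)])
    (by exact_mod_cast hp.τ_mono hab hb)

theorem c₁_pos (hp : p.Valid H) : 0 < p.c₁ := by
  have := hp.α_ge
  have h6 : (0 : ℝ) < √6 := by positivity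
  have := hp.c₁_ge
  nlinarith

theorem c₁_sq_ge (hp : p.Valid H) : 24 * p.α ^ 2 ≤ p.c₁ ^ 2 := by
  have hα := hp.α_ge
  have h := pow_le_pow_left₀ (by positivity) hp.c₁_ge 2
  have h6 : √6 ^ 2 = (6 : ℝ) := Real.sq_sqrt (by norm_num)
  calc 24 * p.α ^ 2 = (2 * p.α * √6) ^ 2 := by rw [mul_pow, mul_pow, h6]; ring
    _ ≤ _ := h

theorem c₁_ge_four (hp : p.Valid H) : 4 ≤ p.c₁ := by
  have h := hp.c₁_sq_ge
  have hα := hp.α_ge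
  have := hp.c₁_pos
  nlinarith

theorem c₂_ge_α (hp : p.Valid H) : 6 * p.η * p.α ^ 2 ≤ p.c₂ := by
  have h := hp.c₁_sq_ge
  have := hp.η_ge
  have h2 := hp.c₂_ge
  nlinarith

theorem c₂_ge_c₁ (hp : p.Valid H) : 864 * p.c₁ ≤ p.c₂ := by
  have h := hp.c₁_ge_four
  have h1 := hp.η_ge
  have h2 := hp.c₂_ge
  have h3 : 864 * (p.c₁ ^ 2) ≤ p.η * p.c₁ ^ 2 := mul_le_mul_of_nonneg_right h1 (sq_nonneg _)
  nlinarith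

theorem c₂_pos (hp : p.Valid H) : 0 < p.c₂ := by
  linarith [hp.c₂_ge_c₁, hp.c₁_pos]

theorem γ_pos (hp : p.Valid H) : 0 < p.γ := by linarith [hp.γ_ge, hp.η_ge]

end Params.Valid

theorem minLoss_eq {p : Params} {H : Finset (𝒳 → Bool)} (hp : p.Valid H) (r : Path 𝒳) {m : ℕ}
    (h1 : 1 ≤ m) (hm : m ≤ p.M) :
    p.τ m * empErr (r.h (m + 1)) (sample p H r m) = minLoss p H r m := by
  have := hp.τ_ge_three h1 hm
  rw [hp.empErr_sample _ _ hm, minLoss]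
  field_simp

/-! ### Monotonicity of losses and radii, and lower bounds on query probabilities. -/

namespace IsPath

variable [MeasurableSpace 𝒳] {ν : Measure (𝒳 × Bool)} {p : Params} {H : Finset (𝒳 → Bool)}
  {r : Path 𝒳}

theorem log_card_ge_one (hr : IsPath ν p H r) : 1 ≤ Real.log (H.card / p.δ) := by
  have h : (3 : ℝ) ≤ √192 := Real.le_sqrt_of_sq_le (by norm_num)
  exact log_three_ge_one.trans (Real.log_le_log (by norm_num) (h.trans hr.card_large.le))

theorem logTerm_ge_one (hr : IsPath ν p H r) {m : ℕ} (h1 : 1 ≤ m) (hm : m ≤ p.M) :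
    1 ≤ logTerm p H m := by
  have := hr.log_card_ge_one
  have := hr.valid.log_τ_ge_one h1 hm
  unfold logTerm
  linarith

theorem logTerm_mono (hr : IsPath ν p H r) {a b : ℕ} (h1 : 1 ≤ a) (hab : a ≤ b) (hb : b ≤ p.M) :
    logTerm p H a ≤ logTerm p H b := by
  have := hr.valid.log_τ_mono h1 hab hb
  unfold logTerm
  linarith

theorem τ_mul_eps (hr : IsPath ν p H r) {m : ℕ} (h1 : 1 ≤ m) (hm : m ≤ p.M) :
    p.τ m * p.eps H m = 32 * logTerm p H m := by
  have := hr.valid.τ_ge_three h1 hm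
  unfold Params.eps logTerm
  field_simp

theorem prob_mem_unit (hr : IsPath ν p H r) {k : ℕ} (hk : k < p.M) (x : 𝒳) :
    0 ≤ prob r (k + 1) x ∧ prob r (k + 1) x ≤ 1 := by
  rcases Nat.eq_zero_or_pos k with rfl | h1
  · simp [prob]
  · have h := hr.feasible k h1 hk
    simpa [prob, show k ≠ 0 by omega] using And.intro (h.nonneg x) (h.le_one x)

theorem probFloor_le_prob (hr : IsPath ν p H r) {k : ℕ} (hk : k < p.M) {x : 𝒳}
    (hx : x ∈ domain p H r (k + 1)) : probFloor p H r (k + 1) ≤ prob r (k + 1) x := by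
  rcases Nat.eq_zero_or_pos k with rfl | h1
  · simp [prob, probFloor]
  · have h := hr.feasible k h1 hk
    simp only [domain, prob, probFloor, show ¬ k + 1 ≤ 1 by omega, if_false] at hx ⊢
    exact h.ge_min x hx

theorem wsum_succ (hr : IsPath ν p H r) (φ : 𝒳 × Bool → ℝ) (m : ℕ) :
    wsum φ (sample p H r (m + 1)) = wsum φ (sample p H r m)
      + ∑ i ∈ Finset.Ico (p.τ m) (p.τ (m + 1)), stepVal p H r φ (m + 1) (i + 1) := by
  refine wsum_sample_succ r φ m ?_
  rintro rfl i hi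
  rw [hr.valid.τ_zero, hr.valid.τ_one, Finset.mem_Ico] at hi
  exact hr.query_first _ (by omega) (by omega)

theorem stepVal_nonneg (hr : IsPath ν p H r) {φ : 𝒳 × Bool → ℝ} (hφ : ∀ z, 0 ≤ φ z) {k : ℕ}
    (hk : k < p.M) (i : ℕ) : 0 ≤ stepVal p H r φ (k + 1) i := by
  unfold stepVal
  split_ifs
  · exact mul_nonneg (one_div_nonneg.2 (hr.prob_mem_unit hk _).1) (hφ _)
  · exact le_rfl
  · exact hφ _

theorem stepVal_le (hr : IsPath ν p H r) {φ : 𝒳 × Bool → ℝ} (hφ0 : ∀ z, 0 ≤ φ z)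
    (hφ : ∀ z, φ z ≤ 1) {k : ℕ} (hk : k < p.M) {l : ℝ} (hl : 0 < l) (hl1 : l ≤ 1)
    (hlf : l ≤ probFloor p H r (k + 1)) (i : ℕ) : stepVal p H r φ (k + 1) i ≤ 1 / l := by
  have h1 : 1 ≤ 1 / l := by rw [le_div_iff₀ hl]; linarith
  unfold stepVal
  split_ifs with hx
  · have h := one_div_le_one_div_of_le hl (hlf.trans (hr.probFloor_le_prob hk hx))
    calc _ ≤ 1 / l * 1 := mul_le_mul h (hφ _) (hφ0 _) (by positivity)
      _ = 1 / l := mul_one _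
  · positivity
  · exact (hφ _).trans h1

theorem wsum_le_succ (hr : IsPath ν p H r) {φ : 𝒳 × Bool → ℝ} (hφ : ∀ z, 0 ≤ φ z) {m : ℕ}
    (hm : m < p.M) : wsum φ (sample p H r m) ≤ wsum φ (sample p H r (m + 1)) := by
  rw [hr.wsum_succ]
  exact le_add_of_nonneg_right (Finset.sum_nonneg fun i _ => hr.stepVal_nonneg hφ hm _)

theorem wsum_nonneg (hr : IsPath ν p H r) {φ : 𝒳 × Bool → ℝ} (hφ : ∀ z, 0 ≤ φ z) {m : ℕ}
    (hm : m ≤ p.M) : 0 ≤ wsum φ (sample p H r m) := by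
  induction m with
  | zero => simp [wsum, sample]
  | succ m ih => exact (ih (by omega)).trans (hr.wsum_le_succ hφ hm)

theorem minLoss_nonneg (hr : IsPath ν p H r) {m : ℕ} (hm : m ≤ p.M) : 0 ≤ minLoss p H r m :=
  hr.wsum_nonneg (loss_nonneg _) hm

theorem minLoss_le (hr : IsPath ν p H r) {m : ℕ} (h1 : 1 ≤ m) (hm : m ≤ p.M) {g : 𝒳 → Bool}
    (hg : g ∈ H) : minLoss p H r m ≤ wsum (loss g) (sample p H r m) := by
  have h := hr.erm_min m h1 hm g hg
  have h3 := hr.valid.τ_ge_three h1 hm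
  rw [hr.valid.empErr_sample _ _ hm, hr.valid.empErr_sample _ _ hm,
    div_le_div_iff_of_pos_right (by linarith)] at h
  exact h

/-- The later minimizer competes in the earlier epoch, and weighted losses only accumulate. -/
theorem minLoss_mono (hr : IsPath ν p H r) {a b : ℕ} (h1 : 1 ≤ a) (hab : a ≤ b) (hb : b ≤ p.M) :
    minLoss p H r a ≤ minLoss p H r b := by
  induction b, hab using Nat.le_induction with
  | base => exact le_rfl
  | succ b hab ih =>
    refine (ih (by omega)).trans ((hr.minLoss_le (by omega) (by omega)
      (hr.erm_mem (b + 1) (by omega) hb)).trans ?_)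
    exact hr.wsum_le_succ (loss_nonneg _) (by omega)

/-- Multiplication by `τ_m` removes the `1 / τ_m` hidden in `ε_m`. What remains is built from
nondecreasing quantities, so `amp`, unlike `Delta`, is monotone in the epoch. -/
theorem amp_eq (hr : IsPath ν p H r) {m : ℕ} (h1 : 1 ≤ m) (hm : m ≤ p.M) :
    amp p H r m = p.c₁ * √(32 * logTerm p H m * minLoss p H r m)
      + 32 * p.c₂ * logTerm p H m * Real.log (p.τ m) := by
  have h3 := hr.valid.τ_ge_three h1 hm
  have e1 := hr.τ_mul_eps h1 hm
  have e2 := minLoss_eq hr.valid r h1 hm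
  have hs : (p.τ m : ℝ) * √(p.eps H m * empErr (r.h (m + 1)) (sample p H r m))
      = √(32 * logTerm p H m * minLoss p H r m) := by
    rw [← e1, ← e2, show p.τ m * p.eps H m * (p.τ m * empErr (r.h (m + 1)) (sample p H r m))
      = (p.τ m : ℝ) ^ 2 * (p.eps H m * empErr (r.h (m + 1)) (sample p H r m)) by ring,
      Real.sqrt_mul (sq_nonneg _), Real.sqrt_sq (by linarith)]
  rw [amp, Delta, Params.radius, ← hs]
  linear_combination p.c₂ * Real.log (p.τ m) * e1

theorem amp_ge (hr : IsPath ν p H r) {m : ℕ} (h1 : 1 ≤ m) (hm : m ≤ p.M) :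
    32 * p.c₂ * logTerm p H m * Real.log (p.τ m) ≤ amp p H r m := by
  rw [hr.amp_eq h1 hm]
  exact le_add_of_nonneg_left (mul_nonneg hr.valid.c₁_pos.le (Real.sqrt_nonneg _))

theorem amp_pos (hr : IsPath ν p H r) {m : ℕ} (h1 : 1 ≤ m) (hm : m ≤ p.M) : 0 < amp p H r m := by
  have h := hr.amp_ge h1 hm
  have := hr.valid.c₂_pos
  have := hr.logTerm_ge_one h1 hm
  have := hr.valid.log_τ_ge_one h1 hm
  refine lt_of_lt_of_le ?_ h
  positivity

theorem amp_mono (hr : IsPath ν p H r) {a b : ℕ} (h1 : 1 ≤ a) (hab : a ≤ b) (hb : b ≤ p.M) :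
    amp p H r a ≤ amp p H r b := by
  rw [hr.amp_eq h1 (hab.trans hb), hr.amp_eq (h1.trans hab) hb]
  have h2 := hr.logTerm_mono h1 hab hb
  have h3 := hr.minLoss_mono h1 hab hb
  have h4 := hr.valid.log_τ_mono h1 hab hb
  have := hr.valid.c₁_pos
  have := hr.valid.c₂_pos
  have := hr.logTerm_ge_one h1 (hab.trans hb)
  have := hr.logTerm_ge_one (h1.trans hab) hb
  have := hr.valid.log_τ_ge_one h1 (hab.trans hb)
  have := hr.minLoss_nonneg (hab.trans hb)
  gcongr

/-- A sufficient condition for `l` to lie below all query probabilities. -/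
theorem le_Pmin (hr : IsPath ν p H r) {m : ℕ} (h1 : 1 ≤ m) (hm : m < p.M) {l : ℝ}
    (hl2 : l ≤ 1 / 2)
    (hl : l * (√(minLoss p H r m / (32 * logTerm p H p.M)) + Real.log (p.τ m)) ≤ 1) :
    l ≤ probFloor p H r (m + 1) := by
  have hτ := hr.valid.log_τ_ge_one h1 hm.le
  have hn := hr.τ_mul_eps (hr.valid.one_le_M) le_rfl
  simp only [probFloor, show ¬ m + 1 ≤ 1 by omega, if_false, Pmin, Nat.add_sub_cancel]
  refine le_min ?_ hl2
  rw [minLoss_eq hr.valid r h1 hm.le, Params.n, hn, le_div_iff₀ (by positivity)]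
  exact hl.trans hr.valid.c₃_ge

/-- By monotonicity, the condition at epoch `m` covers all floors used up to then. The factor `2` on
the logarithm, which is at least one, forces `l ≤ 1 / 2`, the cap in `Pmin`. -/
theorem le_probFloor (hr : IsPath ν p H r) {m : ℕ} (h1 : 1 ≤ m) (hm : m ≤ p.M) {l : ℝ}
    (hl0 : 0 < l)
    (hl : l * (√(minLoss p H r m / (32 * logTerm p H m)) + 2 * Real.log (p.τ m)) ≤ 1) :
    ∀ k < m, l ≤ probFloor p H r (k + 1) := by
  intro k hk
  have hτ := hr.valid.log_τ_ge_one h1 hm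
  have hs := Real.sqrt_nonneg (minLoss p H r m / (32 * logTerm p H m))
  have hl2 : l ≤ 1 / 2 := by nlinarith
  rcases Nat.eq_zero_or_pos k with rfl | hk1
  · simp only [probFloor]; norm_num; linarith
  · refine hr.le_Pmin hk1 (by omega) hl2 (le_trans ?_ hl)
    have a1 := hr.minLoss_mono hk1 hk.le hm
    have a2 := hr.logTerm_mono h1 hm le_rfl
    have a3 := hr.valid.log_τ_mono hk1 hk.le hm
    have a4 := hr.logTerm_ge_one h1 hm
    have a5 := hr.minLoss_nonneg hm
    have a6 : √(minLoss p H r k / (32 * logTerm p H p.M))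
        ≤ √(minLoss p H r m / (32 * logTerm p H m)) := by
      gcongr
    refine mul_le_mul_of_nonneg_left ?_ hl0.le
    linarith

/-- A crude bound that keeps the grid of tilts polynomial in `τ_m`. If it holds at `m`, the next
floor is at least `1 / τ_m`, so new weights are at most `τ_m`, and `τ_m² + (τ_{m+1} - τ_m) τ_m ≤
τ_{m+1}²`. -/
theorem minLoss_le_sq (hr : IsPath ν p H r) {m : ℕ} (h1 : 1 ≤ m) (hm : m ≤ p.M) :
    minLoss p H r m ≤ (p.τ m : ℝ) ^ 2 := by
  have step : ∀ k < p.M, ∀ g l, 0 < l → l ≤ 1 → l ≤ probFloor p H r (k + 1) →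
      wsum (loss g) (sample p H r (k + 1)) ≤ wsum (loss g) (sample p H r k)
        + (p.τ (k + 1) - p.τ k) * (1 / l) := by
    intro k hk g l hl hl1 hlf
    have hτ := hr.valid.τ_mono_succ hk
    rw [hr.wsum_succ]
    gcongr
    refine (Finset.sum_le_sum fun i _ =>
      hr.stepVal_le (loss_nonneg g) (loss_le_one g) hk hl hl1 hlf (i + 1)).trans_eq ?_
    rw [Finset.sum_const, Nat.card_Ico, nsmul_eq_mul, Nat.cast_sub hτ.le]
  induction m, h1 using Nat.le_induction with
  | base =>
    have := step 0 (by omega) (r.h 2) 1 one_pos le_rfl (by simp [probFloor])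
    simp only [zero_add, hr.valid.τ_zero, hr.valid.τ_one] at this
    have e : wsum (loss (r.h 2)) (sample p H r 0) = 0 := by simp [wsum, sample]
    rw [e] at this
    rw [minLoss, hr.valid.τ_one]
    refine this.trans ?_
    norm_num
  | succ m h1 ih =>
    have ht := ih (by omega)
    have h3 := hr.valid.τ_ge_three h1 (by omega)
    have hτ : (p.τ m : ℝ) ≤ p.τ (m + 1) := by exact_mod_cast (hr.valid.τ_mono_succ hm).le
    have hM := hr.logTerm_ge_one (m := p.M) hr.valid.one_le_M le_rfl
    have hf : 1 / (p.τ m : ℝ) ≤ probFloor p H r (m + 1) := by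
      refine hr.le_Pmin h1 hm ?_ ?_
      · rw [div_le_div_iff₀ (by linarith) (by norm_num)]; linarith
      · have hs : √(minLoss p H r m / (32 * logTerm p H p.M)) ≤ p.τ m / 2 := by
          refine Real.sqrt_le_iff.2 ⟨by linarith, ?_⟩
          rw [div_le_iff₀ (by linarith)]
          nlinarith [sq_nonneg (p.τ m : ℝ)]
        have hlog := log_le_half_self (show (0 : ℝ) < p.τ m by linarith)
        rw [one_div, inv_mul_le_iff₀ (by linarith)]
        linarith
    have := step m (by omega) (r.h (m + 1)) (1 / p.τ m) (by positivity)
      (by rw [div_le_one (by linarith)]; linarith) hf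
    refine (hr.minLoss_le (by omega) hm (hr.erm_mem m h1 (by omega))).trans (this.trans ?_)
    rw [one_div_one_div]
    change minLoss p H r m + _ ≤ _
    nlinarith

theorem erm_mem_good (hr : IsPath ν p H r) {m : ℕ} (h1 : 1 ≤ m) (hm : m ≤ p.M) :
    r.h (m + 1) ∈ good p H r (m + 1) := by
  have hA := hr.amp_pos h1 hm
  have h3 := hr.valid.τ_ge_three h1 hm
  have hD : 0 < Delta p H r m := by
    by_contra h
    rw [amp] at hA
    nlinarith
  simp only [good, goodFrom, show ¬ m + 1 ≤ 1 by omega, if_false, Nat.add_sub_cancel]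
  refine ⟨hr.erm_mem m h1 hm, ?_⟩
  rw [sub_self]
  exact mul_nonneg hr.valid.γ_pos.le hD.le

theorem mem_good_iff (hr : IsPath ν p H r) {m : ℕ} (h1 : 1 ≤ m) (hm : m ≤ p.M) {g : 𝒳 → Bool} :
    g ∈ good p H r (m + 1) ↔ g ∈ H ∧
      wsum (loss g) (sample p H r m) - minLoss p H r m ≤ p.γ * amp p H r m := by
  have h3 := hr.valid.τ_ge_three h1 hm
  simp only [good, goodFrom, show ¬ m + 1 ≤ 1 by omega, if_false, Nat.add_sub_cancel]
  refine and_congr_right fun _ => ?_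
  change _ ≤ p.γ * Delta p H r m ↔ _
  rw [amp, hr.valid.empErr_sample _ _ hm, hr.valid.empErr_sample _ _ hm, ← sub_div,
    div_le_iff₀ (by linarith), minLoss, show p.γ * (p.τ m * Delta p H r m)
      = p.γ * Delta p H r m * p.τ m by ring]

end IsPath

/-! ### Population means and variances along a path -/

/-- Excess loss of `h` over `g`. -/
def excess (h g : 𝒳 → Bool) (z : 𝒳 × Bool) : ℝ := loss h z - loss g z

/-- Probability that two classifiers disagree. -/
def disagree [MeasurableSpace 𝒳] (ν : Measure (𝒳 × Bool)) (h g : 𝒳 → Bool) : ℝ :=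
  ν.real {z | h z.1 ≠ g z.1}

theorem loss_apply_self (h : 𝒳 → Bool) (x : 𝒳) : loss h (x, h x) = 0 := by simp [loss]

theorem abs_excess_le_one (h g : 𝒳 → Bool) (z : 𝒳 × Bool) : |excess h g z| ≤ 1 := by
  rw [abs_le, excess]
  constructor <;> linarith [loss_nonneg h z, loss_nonneg g z, loss_le_one h z, loss_le_one g z]

theorem abs_loss_le_one (h : 𝒳 → Bool) (z : 𝒳 × Bool) : |loss h z| ≤ 1 := by
  rw [abs_of_nonneg (loss_nonneg h z)]; exact loss_le_one h z

theorem excess_eq_zero {h g : 𝒳 → Bool} {x : 𝒳} (hx : h x = g x) (y : Bool) :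
    excess h g (x, y) = 0 := by simp [excess, loss, hx]

theorem excess_sq (h g : 𝒳 → Bool) (z : 𝒳 × Bool) :
    excess h g z ^ 2 = if h z.1 ≠ g z.1 then 1 else 0 := by
  obtain ⟨x, y⟩ := z
  simp only [excess, loss]
  cases h x <;> cases g x <;> cases y <;> simp

/-- At a disagreement exactly one of `h`, `g` errs: the excess is `1` if it is `h`, and `-1 + 2`
appears if it is `g`. -/
theorem ite_ne_le_excess (h g : 𝒳 → Bool) (z : 𝒳 × Bool) :
    (if h z.1 ≠ g z.1 then (1 : ℝ) else 0) ≤ excess h g z + 2 * loss g z := by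
  obtain ⟨x, y⟩ := z
  simp only [excess, loss]
  cases h x <;> cases g x <;> cases y <;> norm_num

/-- The label predicted by `g` is the one most favourable to `g`. This fixes the direction of the
sampling bias. -/
theorem excess_le_label (h g : 𝒳 → Bool) (x : 𝒳) (y : Bool) :
    excess h g (x, y) ≤ excess h g (x, g x) := by
  simp only [excess, loss]
  cases h x <;> cases g x <;> cases y <;> norm_num

theorem eq_of_notMem_region {p : Params} {H : Finset (𝒳 → Bool)} {r : Path 𝒳} {m : ℕ} {h g : 𝒳 → Bool} (hh : h ∈ good p H r m)
    (hg : g ∈ good p H r m) {x : 𝒳} (hx : x ∉ region p H r m) : h x = g x := by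
  by_contra hne
  exact hx ⟨h, hh, g, hg, hne⟩

section

variable [MeasurableSpace 𝒳] {ν : Measure (𝒳 × Bool)} {h g : 𝒳 → Bool}

theorem measurableSet_disagree (hh : Measurable h) (hg : Measurable g) :
    MeasurableSet {z : 𝒳 × Bool | h z.1 ≠ g z.1} :=
  (measurableSet_eq_fun (hh.comp measurable_fst) (hg.comp measurable_fst)).compl

theorem measurable_excess (hh : Measurable h) (hg : Measurable g) : Measurable (excess h g) :=
  (measurable_loss hh).sub (measurable_loss hg)

theorem integral_ite_eq_measureReal {s : Set (𝒳 × Bool)} (hs : MeasurableSet s)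
    [DecidablePred (· ∈ s)] :
    ∫ z, (if z ∈ s then (1 : ℝ) else 0) ∂ν = ν.real s := by
  rw [← integral_indicator_one hs]
  congr 1
  funext z
  simp [Set.indicator_apply]

theorem disagree_eq_integral (hh : Measurable h) (hg : Measurable g) :
    disagree ν h g = ∫ z, (if h z.1 ≠ g z.1 then (1 : ℝ) else 0) ∂ν :=
  (integral_ite_eq_measureReal (ν := ν) (measurableSet_disagree hh hg)).symm

theorem popErr_eq_integral (hh : Measurable h) : popErr ν h = ∫ z, loss h z ∂ν :=
  (integral_ite_eq_measureReal (ν := ν) (s := {z | h z.1 ≠ z.2})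
    (measurableSet_eq_fun (hh.comp measurable_fst) measurable_snd).compl).symm

theorem integrable_of_abs_le_one [IsFiniteMeasure ν] {φ : 𝒳 × Bool → ℝ} (hφ : Measurable φ)
    (hφ1 : ∀ z, |φ z| ≤ 1) : Integrable φ ν :=
  Integrable.of_bound hφ.aestronglyMeasurable 1 (Filter.Eventually.of_forall hφ1)

theorem integral_excess [IsFiniteMeasure ν] (hh : Measurable h) (hg : Measurable g) :
    ∫ z, excess h g z ∂ν = popErr ν h - popErr ν g := by
  rw [popErr_eq_integral hh, popErr_eq_integral hg, ← integral_sub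
    (integrable_of_abs_le_one (measurable_loss hh) (abs_loss_le_one h))
    (integrable_of_abs_le_one (measurable_loss hg) (abs_loss_le_one g))]
  rfl

end

namespace IsPath

variable [MeasurableSpace 𝒳] {ν : Measure (𝒳 × Bool)} {p : Params} {H : Finset (𝒳 → Bool)}
  {r : Path 𝒳}

theorem measurableSet_region (hr : IsPath ν p H r) (m : ℕ) :
    MeasurableSet (region p H r m) := by
  classical
  have e : region p H r m = ⋃ g ∈ H.filter (· ∈ good p H r m),
      ⋃ g' ∈ H.filter (· ∈ good p H r m), {x | g x ≠ g' x} := by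
    ext x
    simp only [region, DIS, Set.mem_ofPred_eq, Set.mem_iUnion, Finset.mem_filter]
    constructor
    · rintro ⟨g, hg, g', hg', hx⟩
      exact ⟨g, ⟨goodFrom_subset p H r m _ g hg, hg⟩, g',
        ⟨goodFrom_subset p H r m _ g' hg', hg'⟩, hx⟩
    · rintro ⟨g, ⟨_, hg⟩, g', ⟨_, hg'⟩, hx⟩
      exact ⟨g, hg, g', hg', hx⟩
  rw [e]
  refine Finset.measurableSet_biUnion _ fun g hg => Finset.measurableSet_biUnion _ fun g' hg' => ?_
  exact (measurableSet_eq_fun (hr.measurable g (Finset.mem_filter.1 hg).1)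
    (hr.measurable g' (Finset.mem_filter.1 hg').1)).compl

open Classical in
theorem measurable_ite_domain (hr : IsPath ν p H r) {k : ℕ} (hk : k < p.M)
    {F G : 𝒳 × Bool → ℝ} (hF : Measurable F) (hG : Measurable G) :
    Measurable fun z : 𝒳 × Bool =>
      if z.1 ∈ domain p H r (k + 1) then F z else G (z.1, r.h (k + 1) z.1) := by
  rcases Nat.eq_zero_or_pos k with rfl | h1
  · simpa [domain] using hF
  · have e : domain p H r (k + 1) = region p H r (k + 1) := if_neg (by omega)
    rw [e]
    refine Measurable.ite (measurable_fst (hr.measurableSet_region (k + 1))) hF ?_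
    exact hG.comp (measurable_fst.prodMk
      ((hr.measurable _ (hr.erm_mem k h1 hk.le)).comp measurable_fst))

open Classical in
theorem integrable_stepMean [IsFiniteMeasure ν] (hr : IsPath ν p H r) {k : ℕ} (hk : k < p.M)
    {φ : 𝒳 × Bool → ℝ} (hφ : Measurable φ) (hφ1 : ∀ z, |φ z| ≤ 1) :
    Integrable (fun z : 𝒳 × Bool =>
      if z.1 ∈ domain p H r (k + 1) then φ z else φ (z.1, r.h (k + 1) z.1)) ν :=
  integrable_of_abs_le_one (hr.measurable_ite_domain hk hφ hφ)
    fun z => by split_ifs <;> exact hφ1 _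

theorem exists_le_probFloor (hr : IsPath ν p H r) {k : ℕ} (hk : k < p.M) :
    ∃ l, 0 < l ∧ l ≤ 1 ∧ l ≤ probFloor p H r (k + 1) := by
  rcases Nat.eq_zero_or_pos k with rfl | h1
  · exact ⟨1, one_pos, le_rfl, by simp [probFloor]⟩
  · set B := √(minLoss p H r k / (32 * logTerm p H p.M)) + Real.log (p.τ k) with hB
    have hB1 : 1 ≤ B := (hr.valid.log_τ_ge_one h1 hk.le).trans
      (le_add_of_nonneg_left (Real.sqrt_nonneg _))
    have h2 : 1 / (2 * B) ≤ 1 / 2 := by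
      rw [div_le_div_iff₀ (by linarith) (by norm_num)]; linarith
    refine ⟨1 / (2 * B), by positivity, by linarith, hr.le_Pmin h1 hk h2 ?_⟩
    rw [← hB, div_mul_eq_mul_div, div_le_one (by linarith)]
    linarith

theorem stepMean_nonneg {φ : 𝒳 × Bool → ℝ} (hφ : ∀ z, 0 ≤ φ z) (k : ℕ) :
    0 ≤ stepMean ν p H r φ k := by
  refine integral_nonneg fun z => ?_
  simp only [Pi.zero_apply]
  split_ifs <;> exact hφ _

/-- The pointwise inequality `ite_ne_le_excess` holds for every label, hence also for the inferred
ones, while disagreement ignores labels. -/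
theorem disagree_le [IsFiniteMeasure ν] (hr : IsPath ν p H r) {k : ℕ} (hk : k < p.M)
    {h g : 𝒳 → Bool} (hh : h ∈ H) (hg : g ∈ H) :
    disagree ν h g ≤ stepMean ν p H r (excess h g) (k + 1)
      + 2 * stepMean ν p H r (loss g) (k + 1) := by
  have hmh := hr.measurable h hh
  have hmg := hr.measurable g hg
  have i1 := hr.integrable_stepMean (ν := ν) hk (measurable_excess hmh hmg) (abs_excess_le_one h g)
  have i2 := hr.integrable_stepMean (ν := ν) hk (measurable_loss hmg) (abs_loss_le_one g)
  rw [disagree_eq_integral hmh hmg, stepMean, stepMean, ← integral_const_mul,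
    ← integral_add i1 (i2.const_mul 2)]
  refine integral_mono_of_nonneg (Filter.Eventually.of_forall fun z => ?_)
    (i1.add (i2.const_mul 2)) (Filter.Eventually.of_forall fun z => ?_)
  · simp only [Pi.zero_apply]; split_ifs <;> norm_num
  · have h1 := ite_ne_le_excess h g z
    have h2 := ite_ne_le_excess h g (z.1, r.h (k + 1) z.1)
    simp only
    split_ifs at h1 h2 ⊢ <;> first | exact h1 | exact h2

/-- The labels inferred outside the disagreement region favour `g`. -/
theorem popErr_sub_le_stepMean [IsFiniteMeasure ν] (hr : IsPath ν p H r) {k : ℕ} (hk : k < p.M)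
    {h g : 𝒳 → Bool} (hh : h ∈ H) (hgood : g ∈ good p H r (k + 1)) :
    popErr ν h - popErr ν g ≤ stepMean ν p H r (excess h g) (k + 1) := by
  have hmh := hr.measurable h hh
  have hmg := hr.measurable g (goodFrom_subset _ _ _ _ _ _ hgood)
  have hme := measurable_excess hmh hmg
  rw [← integral_excess hmh hmg, stepMean]
  refine integral_mono (integrable_of_abs_le_one hme (abs_excess_le_one h g))
    (hr.integrable_stepMean hk hme (abs_excess_le_one h g)) fun z => ?_
  simp only
  split_ifs with hx
  · exact le_rfl
  · rcases Nat.eq_zero_or_pos k with rfl | h1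
    · simp [domain] at hx
    · have hx' : z.1 ∉ region p H r (k + 1) := by
        simpa [domain, show k ≠ 0 by omega] using hx
      -- Both `h_m` and `g` survive, so outside the region the inferred label is the prediction of
      -- `g`.
      rw [eq_of_notMem_region (hr.erm_mem_good h1 hk.le) hgood hx']
      exact excess_le_label h g z.1 z.2

/-- Two survivors agree off the region, where the inferred labels therefore cannot bias their
comparison. -/
theorem stepMean_excess_eq [IsFiniteMeasure ν] (hr : IsPath ν p H r) {k : ℕ} {h g : 𝒳 → Bool}
    (hh : h ∈ good p H r (k + 1)) (hg : g ∈ good p H r (k + 1)) :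
    stepMean ν p H r (excess h g) (k + 1) = popErr ν h - popErr ν g := by
  have hmh := hr.measurable h (goodFrom_subset _ _ _ _ _ _ hh)
  have hmg := hr.measurable g (goodFrom_subset _ _ _ _ _ _ hg)
  rw [← integral_excess hmh hmg, stepMean]
  refine integral_congr_ae (Filter.Eventually.of_forall fun z => ?_)
  simp only
  split_ifs with hx
  · rfl
  · have hx' : z.1 ∉ region p H r (k + 1) := by
      rw [domain] at hx
      split_ifs at hx
      · exact absurd (Set.mem_univ _) hx
      · exact hx
    have e := eq_of_notMem_region hh hg hx'
    rw [excess_eq_zero e, show z = (z.1, z.2) from rfl, excess_eq_zero e]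

theorem stepMean_loss_eq (hr : IsPath ν p H r) {k : ℕ} (h1 : 1 ≤ k) (hk : k < p.M)
    {g : 𝒳 → Bool} (hg : g ∈ good p H r (k + 1)) :
    stepMean ν p H r (loss g) (k + 1) = popErrOn ν (region p H r (k + 1)) g := by
  classical
  have hmg := hr.measurable g (goodFrom_subset _ _ _ _ _ _ hg)
  have hs : MeasurableSet {z : 𝒳 × Bool | g z.1 ≠ z.2 ∧ z.1 ∈ region p H r (k + 1)} :=
    (measurableSet_eq_fun (hmg.comp measurable_fst) measurable_snd).compl.inter
      (measurable_fst (hr.measurableSet_region (k + 1)))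
  rw [popErrOn, ← integral_ite_eq_measureReal hs, stepMean]
  refine integral_congr_ae (Filter.Eventually.of_forall fun z => ?_)
  have e : domain p H r (k + 1) = region p H r (k + 1) := if_neg (by omega)
  simp only [e, Set.mem_ofPred_eq]
  by_cases hx : z.1 ∈ region p H r (k + 1)
  · simp [hx, loss]
  · rw [if_neg hx, eq_of_notMem_region (hr.erm_mem_good h1 hk.le) hg hx, loss_apply_self]
    simp [hx]

theorem stepMean_loss_le_one [IsProbabilityMeasure ν] (hr : IsPath ν p H r) {k : ℕ} (hk : k < p.M)
    {g : 𝒳 → Bool} (hg : g ∈ H) : stepMean ν p H r (loss g) (k + 1) ≤ 1 := by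
  have i := hr.integrable_stepMean (ν := ν) hk (measurable_loss (hr.measurable g hg))
    (abs_loss_le_one g)
  calc stepMean ν p H r (loss g) (k + 1) ≤ ∫ _, (1 : ℝ) ∂ν :=
        integral_mono i (integrable_const 1) fun z => by
          simp only; split_ifs <;> exact loss_le_one _ _
    _ = 1 := by simp

theorem stepVar_loss_le [IsFiniteMeasure ν] (hr : IsPath ν p H r) {k : ℕ} (hk : k < p.M)
    {g : 𝒳 → Bool} (hg : g ∈ H) {l : ℝ} (hl : 0 < l) (hl1 : l ≤ 1)
    (hlf : l ≤ probFloor p H r (k + 1)) :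
    stepVar ν p H r (loss g) (k + 1) ≤ 1 / l * stepMean ν p H r (loss g) (k + 1) := by
  have i := hr.integrable_stepMean (ν := ν) hk (measurable_loss (hr.measurable g hg))
    (abs_loss_le_one g)
  have hsq : ∀ z, loss g z ^ 2 = loss g z := fun z => by unfold loss; split_ifs <;> norm_num
  have h1 : 1 ≤ 1 / l := by rw [le_div_iff₀ hl]; linarith
  rw [stepVar, stepMean, ← integral_const_mul]
  refine integral_mono_of_nonneg (Filter.Eventually.of_forall fun z => ?_) (i.const_mul _)
    (Filter.Eventually.of_forall fun z => ?_)
  · simp only [Pi.zero_apply]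
    split_ifs
    · exact mul_nonneg (one_div_nonneg.2 (hr.prob_mem_unit hk _).1) (sq_nonneg _)
    · exact sq_nonneg _
  · simp only [hsq]
    split_ifs with hx
    · exact mul_le_mul_of_nonneg_right (one_div_le_one_div_of_le hl
        (hlf.trans (hr.probFloor_le_prob hk hx))) (loss_nonneg _ _)
    · exact le_mul_of_one_le_left (loss_nonneg _ _) h1

theorem stepVar_excess_first (hr : IsPath ν p H r) {h g : 𝒳 → Bool} (hh : h ∈ H) (hg : g ∈ H) :
    stepVar ν p H r (excess h g) 1 = disagree ν h g := by
  rw [disagree_eq_integral (hr.measurable h hh) (hr.measurable g hg), stepVar]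
  simp [domain, prob, excess_sq]

/-- Where `h` and `g` differ, at least one of them differs from `h_m`, so inside the region the two
variance constraints cover the second moment. Outside it the weight is one. -/
theorem stepVar_excess_le_varBound [IsFiniteMeasure ν] (hr : IsPath ν p H r) {k : ℕ} (h1 : 1 ≤ k)
    (hk : k < p.M) {h g : 𝒳 → Bool} (hh : h ∈ H) (hg : g ∈ H) :
    stepVar ν p H r (excess h g) (k + 1) ≤ varBound ν p H r (k + 1) h
      + varBound ν p H r (k + 1) g
      + ν.real {z | h z.1 ≠ g z.1 ∧ z.1 ∉ region p H r (k + 1)} := by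
  classical
  have hmh := hr.measurable h hh
  have hmg := hr.measurable g hg
  have hf := hr.feasible k h1 hk
  have hdom : domain p H r (k + 1) = region p H r (k + 1) := if_neg (by omega)
  have hreg := hr.measurableSet_region (k + 1)
  obtain ⟨l, hl, hl1, hlf⟩ := hr.exists_le_probFloor hk
  have hmk := hr.measurable _ (hr.erm_mem k h1 hk.le)
  have hset : ∀ f ∈ H, MeasurableSet (disSet p H r (k + 1) f) := fun f hf =>
    (measurableSet_eq_fun (hr.measurable f hf) hmk).compl.inter hreg
  have hind : ∀ f ∈ H, Measurable ((disSet p H r (k + 1) f).indicator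
      fun x => 1 / r.P (k + 1) x) := fun f hf' =>
    (hf.measurable.const_div 1).indicator (hset f hf')
  have hfloor : ∀ x ∈ region p H r (k + 1), l ≤ r.P (k + 1) x := by
    intro x hx
    have := hr.probFloor_le_prob hk (x := x) (by rwa [hdom])
    rw [prob, if_neg (by omega)] at this
    exact hlf.trans this
  have hindnn : ∀ f x, 0 ≤ (disSet p H r (k + 1) f).indicator (fun x => 1 / r.P (k + 1) x) x :=
    fun f x => Set.indicator_nonneg (fun x _ => one_div_nonneg.2 (hf.nonneg x)) x
  have hii : ∀ f ∈ H, Integrable (fun z : 𝒳 × Bool =>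
      (disSet p H r (k + 1) f).indicator (fun x => 1 / r.P (k + 1) x) z.1) ν := by
    intro f hf'
    refine Integrable.of_bound ((hind f hf').comp measurable_fst).aestronglyMeasurable (1 / l)
      (Filter.Eventually.of_forall fun z => ?_)
    rw [Real.norm_eq_abs, abs_of_nonneg (hindnn f z.1)]
    refine Set.indicator_apply_le' (fun hz => ?_) fun _ => by positivity
    exact one_div_le_one_div_of_le hl (hfloor _ hz.2)
  have hint : ∀ f ∈ H, ∫ z, (disSet p H r (k + 1) f).indicator (fun x => 1 / r.P (k + 1) x) z.1 ∂ν
      ≤ varBound ν p H r (k + 1) f := by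
    intro f hf'
    have := hf.variance f hf'
    rwa [integral_map measurable_fst.aemeasurable (hind f hf').aestronglyMeasurable] at this
  have hout : MeasurableSet {z : 𝒳 × Bool | h z.1 ≠ g z.1 ∧ z.1 ∉ region p H r (k + 1)} :=
    (measurableSet_disagree hmh hmg).inter (measurable_fst hreg).compl
  have houti : Integrable (fun z => if z ∈ {z : 𝒳 × Bool | h z.1 ≠ g z.1 ∧
      z.1 ∉ region p H r (k + 1)} then (1 : ℝ) else 0) ν :=
    integrable_of_abs_le_one (Measurable.ite hout measurable_const measurable_const)
      fun z => by split_ifs <;> simp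
  have i12 : Integrable (fun z : 𝒳 × Bool =>
      (disSet p H r (k + 1) h).indicator (fun x => 1 / r.P (k + 1) x) z.1
        + (disSet p H r (k + 1) g).indicator (fun x => 1 / r.P (k + 1) x) z.1) ν :=
    (hii h hh).add (hii g hg)
  have key : stepVar ν p H r (excess h g) (k + 1)
      ≤ ∫ z, (((disSet p H r (k + 1) h).indicator (fun x => 1 / r.P (k + 1) x) z.1
        + (disSet p H r (k + 1) g).indicator (fun x => 1 / r.P (k + 1) x) z.1)
        + if z ∈ {z : 𝒳 × Bool | h z.1 ≠ g z.1 ∧ z.1 ∉ region p H r (k + 1)}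
          then (1 : ℝ) else 0) ∂ν := by
    refine integral_mono_of_nonneg (Filter.Eventually.of_forall fun z => ?_) (i12.add houti)
      (Filter.Eventually.of_forall fun z => ?_)
    · simp only [Pi.zero_apply]
      split_ifs
      · exact mul_nonneg (one_div_nonneg.2 (hr.prob_mem_unit hk _).1) (sq_nonneg _)
      · exact sq_nonneg _
    · have hpe : prob r (k + 1) z.1 = r.P (k + 1) z.1 := if_neg (by omega)
      simp only [hdom, excess_sq, hpe, Set.mem_ofPred_eq]
      by_cases hx : z.1 ∈ region p H r (k + 1)
      · have hP : 0 ≤ 1 / r.P (k + 1) z.1 := one_div_nonneg.2 (hf.nonneg _)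
        by_cases hne : h z.1 = g z.1
        · have := hindnn h z.1
          have := hindnn g z.1
          simp only [hx, hne, ne_eq, not_true, if_true, if_false, mul_zero, false_and, add_zero]
          linarith
        · by_cases hk' : h z.1 = r.h (k + 1) z.1
          · have hg' : z.1 ∈ disSet p H r (k + 1) g := ⟨fun e => hne (hk'.trans e.symm), hx⟩
            have := hindnn h z.1
            rw [Set.indicator_of_mem hg']
            simp only [hx, hne, ne_eq, not_false_eq_true, if_true, mul_one, not_true, and_false,
              if_false, add_zero]
            linarith
          · have hh' : z.1 ∈ disSet p H r (k + 1) h := ⟨hk', hx⟩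
            have := hindnn g z.1
            rw [Set.indicator_of_mem hh']
            simp only [hx, hne, ne_eq, not_false_eq_true, if_true, mul_one, not_true, and_false,
              if_false, add_zero]
            linarith
      · have := hindnn h z.1
        have := hindnn g z.1
        simp only [hx, if_false, not_false_eq_true, and_true]
        linarith
  refine key.trans ?_
  rw [integral_add i12 houti, integral_ite_eq_measureReal hout,
    integral_add (hii h hh) (hii g hg)]
  have := hint h hh
  have := hint g hg
  linarith

theorem varBound_eq (hr : IsPath ν p H r) {k : ℕ} (h1 : 1 ≤ k) (hk : k < p.M) (h : 𝒳 → Bool) :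
    varBound ν p H r (k + 1) h = 2 * p.α ^ 2 * (ν.map Prod.fst).real (disSet p H r (k + 1) h)
      + amp p H r k / p.τ k * (2 * p.β ^ 2 * p.γ *
        (wsum (loss h) (sample p H r k) - minLoss p H r k) + p.ξ * amp p H r k) := by
  have h3 := hr.valid.τ_ge_three h1 hk.le
  have ht : (p.τ k : ℝ) ≠ 0 := by linarith
  rw [varBound, Nat.add_sub_cancel, hr.valid.empErr_sample _ _ hk.le,
    hr.valid.empErr_sample _ _ hk.le, amp, minLoss]
  field_simp
  ring

/-- The reference classifier `h_m` is exchanged for `g` by the triangle inequality for disagreement.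
Since `2 α² ≥ 1`, the disagreement outside the region completes the one inside to `disagree ν h g`.
-/
theorem stepVar_excess_le [IsFiniteMeasure ν] (hr : IsPath ν p H r) {k : ℕ} (h1 : 1 ≤ k)
    (hk : k < p.M) {h g : 𝒳 → Bool} (hh : h ∈ H) (hg : g ∈ H) :
    stepVar ν p H r (excess h g) (k + 1)
      ≤ 2 * p.α ^ 2 * (disagree ν h g + 2 * disagree ν (r.h (k + 1)) g)
      + amp p H r k / p.τ k * (2 * p.β ^ 2 * p.γ * (wsum (loss h) (sample p H r k)
          + wsum (loss g) (sample p H r k) - 2 * minLoss p H r k) + 2 * p.ξ * amp p H r k) := by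
  have hv := hr.stepVar_excess_le_varBound (ν := ν) h1 hk hh hg
  rw [hr.varBound_eq h1 hk, hr.varBound_eq h1 hk] at hv
  have hmh := hr.measurable h hh
  have hmg := hr.measurable g hg
  have hmk := hr.measurable _ (hr.erm_mem k h1 hk.le)
  have hreg := hr.measurableSet_region (k + 1)
  have hset : ∀ f ∈ H, MeasurableSet (disSet p H r (k + 1) f) := fun f hf =>
    (measurableSet_eq_fun (hr.measurable f hf) hmk).compl.inter hreg
  have hgk : (ν.map Prod.fst).real (disSet p H r (k + 1) g) ≤ disagree ν (r.h (k + 1)) g := by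
    rw [map_measureReal_apply measurable_fst (hset g hg)]
    exact measureReal_mono (fun z hz => fun e => hz.1 e.symm) (measure_ne_top _ _)
  have hhk : (ν.map Prod.fst).real (disSet p H r (k + 1) h)
      ≤ ν.real {z | h z.1 ≠ g z.1 ∧ z.1 ∈ region p H r (k + 1)}
        + disagree ν (r.h (k + 1)) g := by
    rw [map_measureReal_apply measurable_fst (hset h hh)]
    refine (measureReal_mono (fun z hz => ?_) (measure_ne_top _ _)).trans
      (measureReal_union_le _ _)
    by_cases e : h z.1 = g z.1
    · exact Or.inr fun e' => hz.1 (e.trans e'.symm)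
    · exact Or.inl ⟨e, hz.2⟩
  have hsplit : ν.real {z | h z.1 ≠ g z.1 ∧ z.1 ∈ region p H r (k + 1)}
      + ν.real {z | h z.1 ≠ g z.1 ∧ z.1 ∉ region p H r (k + 1)} = disagree ν h g :=
    measureReal_inter_add_sdiff (measurable_fst hreg)
  have hα : 1 ≤ p.α ^ 2 := by nlinarith [hr.valid.α_ge]
  have hnn : 0 ≤ ν.real {z | h z.1 ≠ g z.1 ∧ z.1 ∉ region p H r (k + 1)} := measureReal_nonneg
  have hm := mul_le_mul_of_nonneg_left (add_le_add hhk hgk) (show 0 ≤ 2 * p.α ^ 2 by positivity)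
  rw [← hsplit]
  nlinarith

end IsPath

/-! ### Sums over epochs -/

section EpochSum

variable {p : Params} {H : Finset (𝒳 → Bool)}

theorem epochSum_le (hp : p.Valid H) {f g : ℕ → ℝ} {m : ℕ} (hm : m ≤ p.M)
    (hfg : ∀ k < m, f (k + 1) ≤ g (k + 1)) : epochSum p f m ≤ epochSum p g m := by
  refine Finset.sum_le_sum fun k hk => ?_
  have hk' := Finset.mem_range.1 hk
  have : (p.τ k : ℝ) ≤ p.τ (k + 1) := by exact_mod_cast (hp.τ_mono_succ (by omega)).le
  exact mul_le_mul_of_nonneg_left (hfg k hk') (by linarith)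

theorem epochSum_add (p : Params) (f g : ℕ → ℝ) (m : ℕ) :
    epochSum p (fun k => f k + g k) m = epochSum p f m + epochSum p g m := by
  simp only [epochSum, mul_add, Finset.sum_add_distrib]

theorem epochSum_const_mul (p : Params) (c : ℝ) (f : ℕ → ℝ) (m : ℕ) :
    epochSum p (fun k => c * f k) m = c * epochSum p f m := by
  simp only [epochSum, Finset.mul_sum]
  exact Finset.sum_congr rfl fun k _ => by ring

theorem epochSum_succ (p : Params) (f : ℕ → ℝ) (m : ℕ) :
    epochSum p f (m + 1) = epochSum p f m + ((p.τ (m + 1) : ℝ) - p.τ m) * f (m + 1) :=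
  Finset.sum_range_succ _ _

theorem epochSum_const (hp : p.Valid H) (c : ℝ) (m : ℕ) :
    epochSum p (fun _ => c) m = p.τ m * c := by
  rw [epochSum, ← Finset.sum_mul, Finset.sum_range_sub (fun k => (p.τ k : ℝ)), hp.τ_zero]
  simp

theorem epochSum_nonneg (hp : p.Valid H) {f : ℕ → ℝ} {m : ℕ} (hm : m ≤ p.M)
    (hf : ∀ k < m, 0 ≤ f (k + 1)) : 0 ≤ epochSum p f m := by
  have := epochSum_le hp (f := fun _ => 0) hm hf
  rwa [epochSum_const hp, mul_zero] at this

theorem epochSum_mono (hp : p.Valid H) {f : ℕ → ℝ} {a m : ℕ} (ham : a ≤ m) (hm : m ≤ p.M)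
    (hf : ∀ k < m, 0 ≤ f (k + 1)) : epochSum p f a ≤ epochSum p f m := by
  refine Finset.sum_le_sum_of_subset_of_nonneg (Finset.range_mono ham) fun k hk _ => ?_
  have hk' := Finset.mem_range.1 hk
  have : (p.τ k : ℝ) ≤ p.τ (k + 1) := by exact_mod_cast (hp.τ_mono_succ (by omega)).le
  exact mul_nonneg (by linarith) (hf k hk')

/-- Inverse of the sample size before epoch `m`, zero in the first epoch. -/
def recip (p : Params) (m : ℕ) : ℝ := if m ≤ 1 then 0 else 1 / p.τ (m - 1)

/-- With `s = τ_m` and `t = τ_{m+1} ≤ 2 s`, `(t - s) / s ≤ 2 (1 - s / t) ≤ 2 log (t / s)`, and the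
logarithms telescope. Here the doubling condition on the schedule enters. -/
theorem epochSum_recip_le (hp : p.Valid H) {m : ℕ} (h1 : 1 ≤ m) (hm : m ≤ p.M) :
    epochSum p (recip p) m ≤ 2 * Real.log (p.τ m) := by
  induction m, h1 using Nat.le_induction with
  | base =>
    have := hp.log_τ_ge_one le_rfl hm
    rw [epochSum_succ]
    simp only [recip, epochSum, Finset.range_zero, Finset.sum_empty]
    norm_num
    linarith
  | succ m h1 ih =>
    have h3 := hp.τ_ge_three h1 (by omega)
    have h3' := hp.τ_ge_three (m := m + 1) (by omega) hm
    have hle : (p.τ (m + 1) : ℝ) ≤ 2 * p.τ m := by exact_mod_cast hp.τ_le m h1 (by omega)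
    have hlt : (p.τ m : ℝ) ≤ p.τ (m + 1) := by exact_mod_cast (hp.τ_mono_succ hm).le
    have hlog := Real.one_sub_inv_le_log_of_pos
      (show (0 : ℝ) < p.τ (m + 1) / p.τ m by positivity)
    rw [Real.log_div (by positivity) (by positivity), inv_div] at hlog
    have e : recip p (m + 1) = 1 / p.τ m := by simp [recip, show m ≠ 0 by omega]
    have : ((p.τ (m + 1) : ℝ) - p.τ m) * (1 / p.τ m) ≤ 2 * (1 - p.τ m / p.τ (m + 1)) := by
      have e2 : 2 * (1 - (p.τ m : ℝ) / p.τ (m + 1)) - (p.τ (m + 1) - p.τ m) * (1 / p.τ m)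
          = (p.τ (m + 1) - p.τ m) * (2 * p.τ m - p.τ (m + 1)) / (p.τ m * p.τ (m + 1)) := by
        field_simp
      have : 0 ≤ ((p.τ (m + 1) : ℝ) - p.τ m) * (2 * p.τ m - p.τ (m + 1))
          / (p.τ m * p.τ (m + 1)) :=
        div_nonneg (mul_nonneg (by linarith) (by linarith)) (by positivity)
      linarith
    rw [epochSum_succ, e]
    linarith [ih (by omega)]

end EpochSum

/-! ### Deterministic analysis of a concentrated path -/

theorem wsum_excess (h hstar : 𝒳 → Bool) (S : Multiset (𝒳 × Bool × ℝ)) :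
    wsum (excess h hstar) S = wsum (loss h) S - wsum (loss hstar) S :=
  wsum_sub (loss h) (loss hstar) S

theorem mem_good_one {p : Params} {H : Finset (𝒳 → Bool)} {r : Path 𝒳} {h : 𝒳 → Bool} (hh : h ∈ H) : h ∈ good p H r (0 + 1) := by
  simpa [good, goodFrom] using hh

/-- The exponential tail parameter number `N`. -/
def tilt (p : Params) (N : ℕ) : ℝ := 100 / (p.c₂ * p.η * N)

/-- The weighted sums up to epoch `m` of `φ` are close to their conditional means. -/
def ConcentratedFor [MeasurableSpace 𝒳] (ν : Measure (𝒳 × Bool)) (p : Params)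
    (H : Finset (𝒳 → Bool)) (r : Path 𝒳) (φ : 𝒳 × Bool → ℝ) (m N : ℕ) : Prop :=
  (∀ k < m, tilt p N ≤ probFloor p H r (k + 1)) →
    |wsum φ (sample p H r m) - epochSum p (stepMean ν p H r φ) m|
      ≤ tilt p N * epochSum p (stepVar ν p H r φ) m + 4 * logTerm p H m / tilt p N

/-- All weighted sums used in the analysis are close to their conditional means. -/
def Concentrated [MeasurableSpace 𝒳] (ν : Measure (𝒳 × Bool)) (p : Params)
    (H : Finset (𝒳 → Bool)) (r : Path 𝒳) (hstar : 𝒳 → Bool) : Prop :=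
  ∀ m, 1 ≤ m → m ≤ p.M → ∀ N : ℕ, 1 ≤ N → N ≤ 34 * p.τ m →
    (∀ h ∈ H, ConcentratedFor ν p H r (excess h hstar) m N) ∧
      ConcentratedFor ν p H r (loss hstar) m N

namespace IsPath

variable [MeasurableSpace 𝒳] {ν : Measure (𝒳 × Bool)} {p : Params} {H : Finset (𝒳 → Bool)}
  {r : Path 𝒳} {hstar : 𝒳 → Bool}

theorem sqrt_le_amp (hr : IsPath ν p H r) {m : ℕ} (h1 : 1 ≤ m) (hm : m ≤ p.M) :
    128 * logTerm p H m * √(minLoss p H r m / (32 * logTerm p H m))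
      + 32 * p.c₂ * logTerm p H m * Real.log (p.τ m) ≤ amp p H r m := by
  have hℓ := hr.logTerm_ge_one h1 hm
  have ht := hr.minLoss_nonneg hm
  rw [hr.amp_eq h1 hm]
  have e : √(32 * logTerm p H m * minLoss p H r m)
      = 32 * logTerm p H m * √(minLoss p H r m / (32 * logTerm p H m)) := by
    rw [show 32 * logTerm p H m * minLoss p H r m
      = (32 * logTerm p H m) ^ 2 * (minLoss p H r m / (32 * logTerm p H m)) by field_simp,
      Real.sqrt_mul (sq_nonneg _), Real.sqrt_sq (by linarith)]
  rw [e]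
  have := hr.valid.c₁_ge_four
  have hs : 0 ≤ logTerm p H m * √(minLoss p H r m / (32 * logTerm p H m)) := by positivity
  nlinarith

/-- The target tilt is `100 logTerm / (η amp)`, that is `N = amp / (c₂ logTerm)`. This ratio is at
least `32`, so rounding up costs less than a factor two, and at most `17 τ_m` by `minLoss_le_sq`.
Keeping twice the tilt below the floors lets the variance of `loss hstar` be absorbed into half its
mean. -/
theorem exists_tilt (hr : IsPath ν p H r) {m : ℕ} (h1 : 1 ≤ m) (hm : m ≤ p.M) :
    ∃ N : ℕ, 1 ≤ N ∧ N ≤ 34 * p.τ m ∧ 0 < tilt p N ∧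
      tilt p N * (p.η * amp p H r m) ≤ 100 * logTerm p H m ∧
      4 * logTerm p H m / tilt p N ≤ 8 / 100 * (p.η * amp p H r m) ∧
      2 * tilt p N ≤ 1 ∧ ∀ k < m, 2 * tilt p N ≤ probFloor p H r (k + 1) := by
  have hℓ := hr.logTerm_ge_one h1 hm
  have hA := hr.amp_pos h1 hm
  have hc2 := hr.valid.c₂_pos
  have hc1 := hr.valid.c₁_pos
  have hη := hr.valid.η_ge
  have hlog := hr.valid.log_τ_ge_one h1 hm
  have hτ := hr.valid.τ_ge_three h1 hm
  set x := amp p H r m / (p.c₂ * logTerm p H m) with hx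
  have hxA : x * (p.c₂ * logTerm p H m) = amp p H r m := by rw [hx]; field_simp
  have hx1 : 32 ≤ x := by
    rw [hx, le_div_iff₀ (by positivity)]
    refine le_trans ?_ (hr.amp_ge h1 hm)
    have : 0 < p.c₂ * logTerm p H m := by positivity
    nlinarith
  have hx2 : x ≤ 17 * p.τ m := by
    rw [hx, div_le_iff₀ (by positivity), hr.amp_eq h1 hm]
    have hs : √(32 * logTerm p H m * minLoss p H r m) ≤ 6 * logTerm p H m * p.τ m := by
      refine Real.sqrt_le_iff.2 ⟨by positivity, ?_⟩
      have ht := hr.minLoss_le_sq h1 hm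
      calc 32 * logTerm p H m * minLoss p H r m ≤ 32 * logTerm p H m * (p.τ m : ℝ) ^ 2 := by gcongr
        _ ≤ 36 * (logTerm p H m * logTerm p H m) * (p.τ m : ℝ) ^ 2 := by
            gcongr ?_ * _
            nlinarith
        _ = _ := by ring
    have hl2 := log_le_half_self (show (0 : ℝ) < p.τ m by linarith)
    have hcc := hr.valid.c₂_ge_c₁
    have a1 : p.c₁ * √(32 * logTerm p H m * minLoss p H r m)
        ≤ p.c₁ * (6 * logTerm p H m * p.τ m) := by gcongr
    have a2 : p.c₁ * (6 * logTerm p H m * p.τ m) ≤ p.c₂ * (logTerm p H m * p.τ m) := by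
      have : 0 < logTerm p H m * p.τ m := by positivity
      nlinarith
    have a3 : 32 * p.c₂ * logTerm p H m * Real.log (p.τ m)
        ≤ 32 * p.c₂ * logTerm p H m * (p.τ m / 2) := by gcongr
    linarith
  set N := ⌈x⌉₊ with hN
  have hN1 : x ≤ N := Nat.le_ceil x
  have hN2 : (N : ℝ) < x + 1 := Nat.ceil_lt_add_one (by linarith)
  have hNpos : (0 : ℝ) < N := by linarith
  have htpos : 0 < tilt p N := by unfold tilt; positivity
  have h100 : tilt p N * (p.η * amp p H r m) ≤ 100 * logTerm p H m := by
    have : tilt p N * (p.η * amp p H r m) = 100 * logTerm p H m * (x / N) := by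
      rw [← hxA, tilt]; field_simp
    rw [this]
    exact mul_le_of_le_one_right (by positivity) ((div_le_one hNpos).2 hN1)
  -- Both terms of `amp` are used: it dominates `100 logTerm (s + 2 log τ_m)`, so the tilt times the
  -- bracket is at most `1 / η ≤ 1 / 864`.
  have hkey : 2 * tilt p N * (√(minLoss p H r m / (32 * logTerm p H m))
      + 2 * Real.log (p.τ m)) ≤ 1 := by
    set s := √(minLoss p H r m / (32 * logTerm p H m)) with hs
    have hsnn : 0 ≤ s := Real.sqrt_nonneg _
    have hb := hr.sqrt_le_amp h1 hm
    rw [← hs] at hb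
    have hcc : 3456 ≤ p.c₂ := by linarith [hr.valid.c₂_ge_c₁, hr.valid.c₁_ge_four]
    have hb2 : 100 * logTerm p H m * (s + 2 * Real.log (p.τ m)) ≤ amp p H r m := by
      have : 0 < logTerm p H m * Real.log (p.τ m) := by positivity
      have : 0 ≤ logTerm p H m * s := by positivity
      nlinarith
    have hb3 : tilt p N * (100 * logTerm p H m * (s + 2 * Real.log (p.τ m)))
        ≤ 100 * logTerm p H m / p.η := by
      rw [le_div_iff₀ (by linarith)]
      refine le_trans ?_ h100
      have := mul_le_mul_of_nonneg_left hb2 (show 0 ≤ tilt p N * p.η by positivity)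
      linarith
    have e : tilt p N * (s + 2 * Real.log (p.τ m)) ≤ 1 / p.η := by
      have h100p : 0 < 100 * logTerm p H m := by positivity
      rw [div_eq_mul_one_div] at hb3
      nlinarith
    have : 1 / p.η ≤ 1 / 864 := one_div_le_one_div_of_le (by norm_num) hη
    linarith
  refine ⟨N, ?_, ?_, htpos, h100, ?_, ?_, hr.le_probFloor h1 hm (by positivity) hkey⟩
  · exact Nat.ceil_pos.2 (by linarith)
  · have : (N : ℝ) ≤ ((34 * p.τ m : ℕ) : ℝ) := by push_cast; linarith
    exact_mod_cast this
  · have e : 4 * logTerm p H m / tilt p N = 4 / 100 * p.η * (p.c₂ * logTerm p H m * N) := by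
      rw [tilt]; field_simp
    rw [e, ← hxA]
    have : p.c₂ * logTerm p H m * N ≤ p.c₂ * logTerm p H m * (2 * x) := by
      gcongr; linarith
    have := mul_le_mul_of_nonneg_left this (show 0 ≤ 4 / 100 * p.η by positivity)
    linarith
  · have hs : 0 ≤ √(minLoss p H r m / (32 * logTerm p H m)) := Real.sqrt_nonneg _
    nlinarith

/-- Outcome of the analysis for epoch `m`. -/
structure Tracked (ν : Measure (𝒳 × Bool)) (p : Params) (H : Finset (𝒳 → Bool)) (r : Path 𝒳)
    (hstar : 𝒳 → Bool) (m : ℕ) : Prop where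
  mem_good : hstar ∈ good p H r (m + 1)
  slack_le : wsum (loss hstar) (sample p H r m) - minLoss p H r m ≤ p.η * amp p H r m / 8
  deviation_le : ∀ h ∈ H,
    |wsum (excess h hstar) (sample p H r m) - epochSum p (stepMean ν p H r (excess h hstar)) m|
      ≤ epochSum p (stepMean ν p H r (excess h hstar)) m / 2 + p.η * amp p H r m / 8
  erm_le : epochSum p (stepMean ν p H r (excess (r.h (m + 1)) hstar)) m ≤ p.η * amp p H r m / 4

theorem stepMean_excess_nonneg [IsFiniteMeasure ν] (hr : IsPath ν p H r) (hs : IsBest ν H hstar)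
    {k : ℕ} (hk : k < p.M) (hgood : hstar ∈ good p H r (k + 1)) {h : 𝒳 → Bool} (hh : h ∈ H) :
    0 ≤ stepMean ν p H r (excess h hstar) (k + 1) := by
  have := hr.popErr_sub_le_stepMean hk hh hgood
  have := hs.2 h hh
  linarith

/-- Variance of a single step when all earlier epochs are tracked. -/
theorem stepVar_excess_le_of_tracked [IsFiniteMeasure ν] (hr : IsPath ν p H r)
    (hs : IsBest ν H hstar) {m : ℕ} (hm : m ≤ p.M)
    (ih : ∀ k, 1 ≤ k → k < m → Tracked ν p H r hstar k) {h : 𝒳 → Bool} (hh : h ∈ H) {b x : ℝ}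
    (hb : p.β ^ 2 * p.γ ≤ b) (hx0 : 0 ≤ x) (hx : p.ξ ≤ x) {k : ℕ} (hk : k < m) :
    stepVar ν p H r (excess h hstar) (k + 1)
      ≤ (2 * p.α ^ 2 * stepMean ν p H r (excess h hstar) (k + 1)
        + 12 * p.α ^ 2 * stepMean ν p H r (loss hstar) (k + 1))
        + amp p H r m * (p.α ^ 2 * p.η
          + 2 * b * (3 / 2 * epochSum p (stepMean ν p H r (excess h hstar)) m
            + 3 / 8 * (p.η * amp p H r m)) + 2 * x * amp p H r m) * recip p (k + 1) := by
  have hkM : k < p.M := by omega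
  have hη := hr.valid.η_ge
  have hγ := hr.valid.γ_pos
  have hα : 1 ≤ p.α ^ 2 := by nlinarith [hr.valid.α_ge]
  have he : 0 ≤ stepMean ν p H r (loss hstar) (k + 1) := stepMean_nonneg (loss_nonneg _) _
  have hd := hr.disagree_le (ν := ν) hkM hh hs.1
  have hgood : ∀ j < m, hstar ∈ good p H r (j + 1) := by
    intro j hj
    rcases Nat.eq_zero_or_pos j with rfl | hj1
    · exact mem_good_one hs.1
    · exact (ih j hj1 hj).mem_good
  have hnn : ∀ g ∈ H, ∀ j < m, 0 ≤ stepMean ν p H r (excess g hstar) (j + 1) :=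
    fun g hg j hj => hr.stepMean_excess_nonneg hs (by omega) (hgood j hj) hg
  rcases Nat.eq_zero_or_pos k with rfl | hk1
  · rw [hr.stepVar_excess_first hh hs.1]
    have := hnn h hh 0 (by omega)
    simp only [recip, zero_add, le_refl, if_true, mul_zero, add_zero] at *
    nlinarith
  · have hv := hr.stepVar_excess_le (ν := ν) hk1 hkM hh hs.1
    have hT := ih k hk1 hk
    have hτ := hr.valid.τ_ge_three hk1 hkM.le
    have hA := hr.amp_pos hk1 hkM.le
    have hAm := hr.amp_mono hk1 hk.le hm
    have herm := hr.erm_mem k hk1 hkM.le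
    have hd2 := hr.disagree_le (ν := ν) hkM herm hs.1
    rw [hr.stepMean_excess_eq (hr.erm_mem_good hk1 hkM.le) hT.mem_good] at hd2
    -- The true regret of `h_{k+1}` is below its biased regret in every earlier epoch, so one bound
    -- on the biased sum controls `τ_k` times the true regret.
    have hfav : p.τ k * (popErr ν (r.h (k + 1)) - popErr ν hstar) ≤ p.η * amp p H r k / 4 := by
      refine le_trans ?_ hT.erm_le
      rw [← epochSum_const hr.valid]
      exact epochSum_le hr.valid hkM.le fun j hj =>
        hr.popErr_sub_le_stepMean (by omega) herm (hgood j (by omega))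
    have hrec : recip p (k + 1) = 1 / p.τ k := by simp [recip, show k ≠ 0 by omega]
    set ρ := recip p (k + 1) with hρ
    have hρ0 : 0 < ρ := by rw [hrec]; positivity
    have hfav' : popErr ν (r.h (k + 1)) - popErr ν hstar ≤ p.η * amp p H r k / 4 * ρ := by
      rw [hrec, mul_one_div, le_div_iff₀ (by linarith)]; linarith
    rw [show amp p H r k / p.τ k = amp p H r k * ρ by rw [hrec]; ring] at hv
    set B := epochSum p (stepMean ν p H r (excess h hstar)) m with hB
    have hBk : epochSum p (stepMean ν p H r (excess h hstar)) k ≤ B :=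
      epochSum_mono hr.valid hk.le hm (hnn h hh)
    have hdev := (abs_le.1 (hT.deviation_le h hh)).2
    rw [wsum_excess] at hdev
    have hsl := hT.slack_le
    have hηA : p.η * amp p H r k ≤ p.η * amp p H r m := by gcongr
    have hB0 : 0 ≤ B := epochSum_nonneg hr.valid hm (hnn h hh)
    -- The left side is the empirical excess of `h` over `hstar` plus twice the slack of `hstar`,
    -- whence `1/8 + 2/8 = 3/8`.
    have hSle : wsum (loss h) (sample p H r k) + wsum (loss hstar) (sample p H r k)
        - 2 * minLoss p H r k ≤ 3 / 2 * B + 3 / 8 * (p.η * amp p H r m) := by linarith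
    have hY : 0 ≤ 3 / 2 * B + 3 / 8 * (p.η * amp p H r m) := by
      have : 0 ≤ p.η * amp p H r m := mul_nonneg (by linarith) (hA.le.trans hAm)
      linarith
    set Y := 3 / 2 * B + 3 / 8 * (p.η * amp p H r m)
    have q1 : 2 * p.β ^ 2 * p.γ * (wsum (loss h) (sample p H r k)
        + wsum (loss hstar) (sample p H r k) - 2 * minLoss p H r k) ≤ 2 * b * Y := by
      calc _ ≤ 2 * p.β ^ 2 * p.γ * Y := mul_le_mul_of_nonneg_left hSle (by positivity)
        _ ≤ 2 * b * Y := mul_le_mul_of_nonneg_right (by linarith) hY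
    have q2 : 2 * p.ξ * amp p H r k ≤ 2 * x * amp p H r m := by
      calc _ ≤ 2 * x * amp p H r k := mul_le_mul_of_nonneg_right (by linarith) hA.le
        _ ≤ _ := mul_le_mul_of_nonneg_left hAm (by linarith)
    have hZ : 0 ≤ 2 * b * Y + 2 * x * amp p H r m := by
      have : 0 ≤ b := le_trans (by positivity) hb
      have : 0 ≤ amp p H r m := hA.le.trans hAm
      positivity
    have q3 : amp p H r k * ρ * (2 * p.β ^ 2 * p.γ * (wsum (loss h) (sample p H r k)
        + wsum (loss hstar) (sample p H r k) - 2 * minLoss p H r k) + 2 * p.ξ * amp p H r k)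
        ≤ amp p H r m * ρ * (2 * b * Y + 2 * x * amp p H r m) := by
      calc _ ≤ amp p H r k * ρ * (2 * b * Y + 2 * x * amp p H r m) :=
            mul_le_mul_of_nonneg_left (add_le_add q1 q2) (by positivity)
        _ ≤ _ := mul_le_mul_of_nonneg_right (mul_le_mul_of_nonneg_right hAm hρ0.le) hZ
    have q4 : popErr ν (r.h (k + 1)) - popErr ν hstar ≤ p.η * amp p H r m / 4 * ρ :=
      hfav'.trans (mul_le_mul_of_nonneg_right (by linarith) hρ0.le)
    -- This yields `12 α² = 2 α² (2 + 4)` in front of the loss, and `α² η` from the regret of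
    -- `h_{k+1}`.
    have q5 : 2 * p.α ^ 2 * (disagree ν h hstar + 2 * disagree ν (r.h (k + 1)) hstar)
        ≤ 2 * p.α ^ 2 * ((stepMean ν p H r (excess h hstar) (k + 1)
            + 2 * stepMean ν p H r (loss hstar) (k + 1))
          + 2 * (p.η * amp p H r m / 4 * ρ + 2 * stepMean ν p H r (loss hstar) (k + 1))) := by
      refine mul_le_mul_of_nonneg_left ?_ (by positivity)
      linarith
    refine hv.trans ((add_le_add q5 q3).trans (le_of_eq ?_))
    ring

end IsPath

/-- Numerical core of the deviation bound. -/
theorem tilt_mul_variance_le {l η A ℓ g ℓM gM a s t E B V : ℝ} (hl : 0 < l) (hη : 864 ≤ η)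
    (hA : 0 < A) (hℓ : 1 ≤ ℓ) (hg : 1 ≤ g) (hℓM : ℓ ≤ ℓM) (hgM : g ≤ gM) (ha : 1 ≤ a)
    (hs : 0 ≤ s) (ht : 0 ≤ t) (hB : 0 ≤ B) (hA1 : 192 * η * a * ℓ * g ≤ A)
    (hA2 : 768 * a * ℓ * t ≤ A ^ 2) (hlA : l * (η * A) ≤ 100 * ℓ)
    (hE : E ≤ 2 * (s + t) + 16 / 100 * (η * A))
    (hV : V ≤ (2 * a * B + 12 * a * E) + A * (a * η + 2 * (η / (27648 * ℓM * gM))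
      * (3 / 2 * B + 3 / 8 * (η * A)) + 2 * (1 / (256 * ℓM * gM)) * A) * (2 * g)) :
    l * V ≤ 3 / 100 * B + 1 / 1000 * s + 1 / 100 * (η * A) := by
  have hη0 : 0 < η := by linarith
  have hla0 : 0 < l * a := by positivity
  have hAη : 864 * A ≤ η * A := by gcongr
  have hηη : 746496 ≤ η * η := by nlinarith
  -- Each term of `l * V` is small because `l` is at most `100 ℓ / (η A)` while `A` dominates `192 η
  -- a ℓ g` and `A²` dominates `768 a ℓ t`; the factor `ℓ` cancels throughout.
  have f1 : l * a * 192 * (η * η) * ℓ ≤ 100 * ℓ := by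
    calc l * a * 192 * (η * η) * ℓ ≤ l * a * 192 * (η * η) * ℓ * g :=
          le_mul_of_one_le_right (by positivity) hg
      _ = l * (η * (192 * η * a * ℓ * g)) := by ring
      _ ≤ l * (η * A) := by gcongr
      _ ≤ 100 * ℓ := hlA
  have f2 : l * a * 192 * (η * η) ≤ 100 := le_of_mul_le_mul_right f1 (by linarith)
  have hla : l * a ≤ 1 / 1000000 := by
    have : l * a * 192 * 746496 ≤ l * a * 192 * (η * η) := by gcongr
    linarith
  have hlat : l * a * t ≤ 1 / 1000000 * (η * A) := by
    have h1 : 768 * (l * a * t) * ℓ * η ≤ 100 * A * ℓ := by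
      calc 768 * (l * a * t) * ℓ * η = l * η * (768 * a * ℓ * t) := by ring
        _ ≤ l * η * A ^ 2 := by gcongr
        _ = l * (η * A) * A := by ring
        _ ≤ 100 * ℓ * A := by gcongr
        _ = _ := by ring
    have h2 : 768 * (l * a * t) * η ≤ 100 * A := by
      refine le_of_mul_le_mul_right (a := ℓ) ?_ (by linarith)
      linarith
    have h3 : 768 * (l * a * t) * 864 ≤ 768 * (l * a * t) * η := by gcongr
    linarith
  have hlag : l * a * g * (η * A) ≤ 1 / 1000 * (η * A) := by
    have h1 : 192 * η * (l * a * g * (η * A)) ≤ 192 * η * (a * g * (100 * ℓ)) := by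
      have : l * a * g * (η * A) = a * g * (l * (η * A)) := by ring
      rw [this]
      gcongr
    have h2 : 192 * η * (a * g * (100 * ℓ)) ≤ 100 * A := by linarith
    have h3 : 192 * 864 * (l * a * g * (η * A)) ≤ 192 * η * (l * a * g * (η * A)) := by gcongr
    linarith
  have hM : ℓ * g ≤ ℓM * gM := mul_le_mul hℓM hgM (by linarith) (by linarith)
  have hM0 : 0 < ℓM * gM := by nlinarith
  have hlg : l * A * g * η ≤ 100 * (ℓM * gM) := by
    calc l * A * g * η = l * (η * A) * g := by ring
      _ ≤ 100 * ℓ * g := by gcongr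
      _ ≤ 100 * (ℓM * gM) := by linarith
  -- Because `100 / 27648 < 37 / 10000`.
  have hb : l * A * g * (η / (27648 * ℓM * gM)) ≤ 37 / 10000 := by
    rw [← mul_div_assoc, div_le_iff₀ (by nlinarith)]
    nlinarith
  have hx : l * A * g * (1 / (256 * ℓM * gM)) ≤ 1 / 1000 := by
    rw [mul_one_div, div_le_iff₀ (by nlinarith)]
    have : l * A * g * 864 ≤ l * A * g * η := by gcongr
    linarith
  have hb0 : 0 ≤ l * A * g * (η / (27648 * ℓM * gM)) := by
    have : 0 < 27648 * ℓM * gM := by linarith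
    positivity
  set cb := l * A * g * (η / (27648 * ℓM * gM)) with hcb
  set cx := l * A * g * (1 / (256 * ℓM * gM)) with hcx
  have e1 : l * V ≤ 2 * (l * a) * B + 12 * (l * a) * (2 * (s + t) + 16 / 100 * (η * A))
      + 2 * (l * a * g * (η * A)) + 4 * cb * (3 / 2 * B + 3 / 8 * (η * A)) + 4 * cx * A := by
    calc l * V ≤ l * ((2 * a * B + 12 * a * (2 * (s + t) + 16 / 100 * (η * A))) + A * (a * η
            + 2 * (η / (27648 * ℓM * gM)) * (3 / 2 * B + 3 / 8 * (η * A))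
            + 2 * (1 / (256 * ℓM * gM)) * A) * (2 * g)) := by
          refine mul_le_mul_of_nonneg_left (hV.trans ?_) hl.le
          gcongr
      _ = _ := by rw [hcb, hcx]; ring
  have p1 : l * a * B ≤ 1 / 1000000 * B := by gcongr
  have p2 : l * a * s ≤ 1 / 1000000 * s := by gcongr
  have p3 : l * a * (η * A) ≤ 1 / 1000000 * (η * A) := by gcongr
  have p4 : cb * B ≤ 37 / 10000 * B := by gcongr
  have p5 : cb * (η * A) ≤ 37 / 10000 * (η * A) := by gcongr
  have p6 : cx * A ≤ 1 / 1000 * A := by gcongr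
  linarith

namespace IsPath

variable [MeasurableSpace 𝒳] {ν : Measure (𝒳 × Bool)} {p : Params} {H : Finset (𝒳 → Bool)}
  {r : Path 𝒳} {hstar : 𝒳 → Bool}

theorem tilt_mul_var_loss_le [IsFiniteMeasure ν] (hr : IsPath ν p H r) (hs : hstar ∈ H) {m : ℕ}
    (hm : m ≤ p.M) {l : ℝ} (hl : 0 < l) (hl1 : 2 * l ≤ 1)
    (hlf : ∀ k < m, 2 * l ≤ probFloor p H r (k + 1)) :
    l * epochSum p (stepVar ν p H r (loss hstar)) m
      ≤ epochSum p (stepMean ν p H r (loss hstar)) m / 2 := by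
  have h := epochSum_le hr.valid hm (f := stepVar ν p H r (loss hstar))
    (g := fun k => 1 / (2 * l) * stepMean ν p H r (loss hstar) k)
    fun k hk => hr.stepVar_loss_le (by omega) hs (by linarith) hl1 (hlf k hk)
  rw [epochSum_const_mul] at h
  have := mul_le_mul_of_nonneg_left h hl.le
  refine this.trans (le_of_eq ?_)
  field_simp

theorem loss_deviation_le [IsFiniteMeasure ν] (hr : IsPath ν p H r) (hs : hstar ∈ H)
    (hc : Concentrated ν p H r hstar) {m : ℕ} (h1 : 1 ≤ m) (hm : m ≤ p.M) :
    |wsum (loss hstar) (sample p H r m) - epochSum p (stepMean ν p H r (loss hstar)) m|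
      ≤ epochSum p (stepMean ν p H r (loss hstar)) m / 2 + 8 / 100 * (p.η * amp p H r m) := by
  obtain ⟨N, hN1, hN2, hl, -, h4, hl1, hlf⟩ := hr.exists_tilt h1 hm
  have h := (hc m h1 hm N hN1 hN2).2 fun k hk => le_trans (by linarith) (hlf k hk)
  have := hr.tilt_mul_var_loss_le (ν := ν) hs hm hl hl1 hlf
  linarith

/-- Earlier tracking makes all biased regrets nonnegative and bounds the variances, so every
deviation is a small part of the biased regret, plus a tiny part of the current slack of `hstar`,
plus `9/100 η amp`. For the empirical minimizer this inequality bounds the slack by a fraction of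
itself and closes; `γ ≥ η / 4` then keeps `hstar` alive. -/
theorem tracked [IsFiniteMeasure ν] (hr : IsPath ν p H r) (hs : IsBest ν H hstar)
    (hc : Concentrated ν p H r hstar) (m : ℕ) (h1 : 1 ≤ m) (hm : m ≤ p.M) :
    Tracked ν p H r hstar m := by
  induction m using Nat.strong_induction_on with
  | _ m IH =>
  have ih : ∀ k, 1 ≤ k → k < m → Tracked ν p H r hstar k :=
    fun k hk1 hk => IH k hk hk1 (by omega)
  have hη := hr.valid.η_ge
  have hγ := hr.valid.γ_ge
  have hγ0 := hr.valid.γ_pos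
  have hA := hr.amp_pos h1 hm
  have hℓ := hr.logTerm_ge_one h1 hm
  have hlog := hr.valid.log_τ_ge_one h1 hm
  have hMM := hr.valid.one_le_M
  have hgood : ∀ j < m, hstar ∈ good p H r (j + 1) := by
    intro j hj
    rcases Nat.eq_zero_or_pos j with rfl | hj1
    · exact mem_good_one hs.1
    · exact (ih j hj1 hj).mem_good
  obtain ⟨N, hN1, hN2, hl, hlA, h4, hl1, hlf⟩ := hr.exists_tilt h1 hm
  have hL := hr.loss_deviation_le hs.1 hc h1 hm
  set T := wsum (loss hstar) (sample p H r m) with hT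
  set t := minLoss p H r m with ht
  set E := epochSum p (stepMean ν p H r (loss hstar)) m with hE
  have hs0 : 0 ≤ T - t := by linarith [hr.minLoss_le h1 hm hs.1]
  have ht0 : 0 ≤ t := hr.minLoss_nonneg hm
  have hEle : E ≤ 2 * ((T - t) + t) + 16 / 100 * (p.η * amp p H r m) := by
    have := (abs_le.1 hL).1
    linarith
  have hα : 1 ≤ p.α ^ 2 := by nlinarith [hr.valid.α_ge]
  -- Hence the constants `27648 = 864 · 32` and `256 = 8 · 32` below.
  have hnεM : (p.n : ℝ) * p.eps H p.M = 32 * logTerm p H p.M := hr.τ_mul_eps hMM le_rfl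
  have hβ : p.β ^ 2 * p.γ ≤ p.η / (27648 * logTerm p H p.M * Real.log p.n) := by
    have hb := hr.valid.β_le
    have hlM := hr.logTerm_ge_one hMM le_rfl
    have hgM : 1 ≤ Real.log p.n := hr.valid.log_τ_ge_one hMM le_rfl
    rw [show 864 * p.γ * p.n * p.eps H p.M * Real.log p.n
      = p.γ * (27648 * logTerm p H p.M * Real.log p.n) by
        linear_combination 864 * p.γ * Real.log p.n * hnεM] at hb
    calc p.β ^ 2 * p.γ ≤ p.η / (p.γ * (27648 * logTerm p H p.M * Real.log p.n)) * p.γ := by gcongr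
      _ = _ := by field_simp
  have hξ : p.ξ ≤ 1 / (256 * logTerm p H p.M * Real.log p.n) := by
    have hx := hr.valid.ξ_le
    rwa [show 8 * p.n * p.eps H p.M * Real.log p.n
      = 256 * logTerm p H p.M * Real.log p.n by
        linear_combination 8 * Real.log p.n * hnεM] at hx
  have hξ0 : 0 ≤ 1 / (256 * logTerm p H p.M * Real.log p.n) := by
    have hlM := hr.logTerm_ge_one hMM le_rfl
    have hgM : 1 ≤ Real.log p.n := hr.valid.log_τ_ge_one hMM le_rfl
    positivity
  have hA1 : 192 * p.η * p.α ^ 2 * logTerm p H m * Real.log (p.τ m) ≤ amp p H r m := by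
    refine le_trans ?_ (hr.amp_ge h1 hm)
    have := hr.valid.c₂_ge_α
    rw [show 192 * p.η * p.α ^ 2 * logTerm p H m * Real.log (p.τ m)
      = 32 * (6 * p.η * p.α ^ 2) * logTerm p H m * Real.log (p.τ m) by ring]
    gcongr
  have hA2 : 768 * p.α ^ 2 * logTerm p H m * t ≤ amp p H r m ^ 2 := by
    have hsq : p.c₁ * √(32 * logTerm p H m * t) ≤ amp p H r m := by
      have := hr.valid.c₂_pos
      rw [hr.amp_eq h1 hm]
      exact le_add_of_nonneg_right (by positivity)
    have hc1 := hr.valid.c₁_pos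
    calc 768 * p.α ^ 2 * logTerm p H m * t = 24 * p.α ^ 2 * (32 * logTerm p H m * t) := by ring
      _ ≤ p.c₁ ^ 2 * (32 * logTerm p H m * t) := by
          have := hr.valid.c₁_sq_ge
          gcongr
      _ = (p.c₁ * √(32 * logTerm p H m * t)) ^ 2 := by
          rw [mul_pow, Real.sq_sqrt (by positivity)]
      _ ≤ _ := by gcongr
  have hdev : ∀ h ∈ H,
      0 ≤ epochSum p (stepMean ν p H r (excess h hstar)) m ∧
      |wsum (excess h hstar) (sample p H r m) - epochSum p (stepMean ν p H r (excess h hstar)) m|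
        ≤ 3 / 100 * epochSum p (stepMean ν p H r (excess h hstar)) m + 1 / 1000 * (T - t)
          + 9 / 100 * (p.η * amp p H r m) := by
    intro h hh
    have hB0 : 0 ≤ epochSum p (stepMean ν p H r (excess h hstar)) m :=
      epochSum_nonneg hr.valid hm fun k hk =>
        hr.stepMean_excess_nonneg hs (by omega) (hgood k hk) hh
    refine ⟨hB0, ?_⟩
    have hcon := (hc m h1 hm N hN1 hN2).1 h hh fun k hk => le_trans (by linarith) (hlf k hk)
    have hV := epochSum_le hr.valid hm (f := stepVar ν p H r (excess h hstar))
      (g := fun k => (2 * p.α ^ 2 * stepMean ν p H r (excess h hstar) k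
        + 12 * p.α ^ 2 * stepMean ν p H r (loss hstar) k)
        + amp p H r m * (p.α ^ 2 * p.η
          + 2 * (p.η / (27648 * logTerm p H p.M * Real.log p.n))
            * (3 / 2 * epochSum p (stepMean ν p H r (excess h hstar)) m
              + 3 / 8 * (p.η * amp p H r m))
          + 2 * (1 / (256 * logTerm p H p.M * Real.log p.n)) * amp p H r m) * recip p k)
      fun k hk => hr.stepVar_excess_le_of_tracked hs hm ih hh hβ hξ0 hξ hk
    rw [epochSum_add p (fun k => 2 * p.α ^ 2 * stepMean ν p H r (excess h hstar) k
      + 12 * p.α ^ 2 * stepMean ν p H r (loss hstar) k), epochSum_add, epochSum_const_mul,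
      epochSum_const_mul, epochSum_const_mul] at hV
    have hrec := epochSum_recip_le hr.valid h1 hm
    have hK : 0 ≤ amp p H r m * (p.α ^ 2 * p.η
        + 2 * (p.η / (27648 * logTerm p H p.M * Real.log p.n))
          * (3 / 2 * epochSum p (stepMean ν p H r (excess h hstar)) m
            + 3 / 8 * (p.η * amp p H r m))
        + 2 * (1 / (256 * logTerm p H p.M * Real.log p.n)) * amp p H r m) := by
      have : 0 ≤ p.η / (27648 * logTerm p H p.M * Real.log p.n) := le_trans (by positivity) hβ
      positivity
    have := tilt_mul_variance_le hl hη hA hℓ hlog (hr.logTerm_mono h1 hm le_rfl)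
      (hr.valid.log_τ_mono h1 hm le_rfl) hα hs0 ht0 hB0 hA1 hA2 hlA hEle
      (hV.trans (add_le_add le_rfl (mul_le_mul_of_nonneg_left hrec hK)))
    linarith
  have hηA : 0 < p.η * amp p H r m := by positivity
  -- For the minimizer the empirical excess is `t - T`. With `B` its biased regret, the bound reads
  -- `999/1000 (T - t) + 97/100 B ≤ 9/100 η amp`, with both terms on the left nonnegative.
  have hermd := hdev _ (hr.erm_mem m h1 hm)
  rw [wsum_excess, ← hT] at hermd
  change 0 ≤ _ ∧ |t - T - _| ≤ _ at hermd
  have hermd2 := (abs_le.1 hermd.2).1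
  have hslack : T - t ≤ p.η * amp p H r m / 8 := by linarith [hermd.1]
  refine ⟨(hr.mem_good_iff h1 hm).2 ⟨hs.1, ?_⟩, hslack, fun h hh => ?_, by linarith⟩
  · change T - t ≤ _
    have : p.η / 4 * amp p H r m ≤ p.γ * amp p H r m := by gcongr
    linarith
  · have := hdev h hh
    linarith

end IsPath

/-! ### From small regret to small disagreement regions. -/

namespace IsPath

variable [MeasurableSpace 𝒳] {ν : Measure (𝒳 × Bool)} {p : Params} {H : Finset (𝒳 → Bool)}
  {r : Path 𝒳} {hstar : 𝒳 → Bool}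

theorem measureReal_le_disagreementCoeff_mul {ρ : Measure 𝒳} [IsFiniteMeasure ρ] {s : Set 𝒳}
    {t : ℝ} (ht : 0 < t) (hs : s ⊆ ballDisagreement ρ H hstar t) :
    ρ.real s ≤ disagreementCoeff ρ H hstar * t := by
  rw [← div_le_iff₀ ht]
  refine le_trans ?_ (le_csSup (disagreementCoeff_bddAbove ρ H hstar) ⟨t, ht, rfl⟩)
  gcongr
  exact measure_ne_top _ _

theorem disagreementCoeff_nonneg (ρ : Measure 𝒳) (H : Finset (𝒳 → Bool)) (hstar : 𝒳 → Bool) :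
    0 ≤ disagreementCoeff ρ H hstar := by
  refine Real.sSup_nonneg ?_
  rintro t ⟨r, hr, rfl⟩
  positivity

/-- Surviving classifiers are close to the best one. -/
theorem disagree_le_of_mem_good [IsFiniteMeasure ν] (hr : IsPath ν p H r) (hs : IsBest ν H hstar)
    (hc : Concentrated ν p H r hstar) {k : ℕ} (h1 : 1 ≤ k) (hk : k < p.M) {h : 𝒳 → Bool}
    (hh : h ∈ good p H r (k + 1)) :
    disagree ν h hstar ≤ 2 * popErrOn ν (region p H r (k + 1)) hstar
      + 4 * p.γ * amp p H r k * recip p (k + 1) := by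
  have hT := hr.tracked hs hc k h1 hk.le
  obtain ⟨hhH, hW⟩ := (hr.mem_good_iff h1 hk.le).1 hh
  have hd := hr.disagree_le (ν := ν) hk hhH hs.1
  rw [hr.stepMean_excess_eq hh hT.mem_good, hr.stepMean_loss_eq h1 hk hT.mem_good] at hd
  have hτ := hr.valid.τ_ge_three h1 hk.le
  have hA := hr.amp_pos h1 hk.le
  have hfav : p.τ k * (popErr ν h - popErr ν hstar)
      ≤ epochSum p (stepMean ν p H r (excess h hstar)) k := by
    rw [← epochSum_const hr.valid]
    refine epochSum_le hr.valid hk.le fun j hj => hr.popErr_sub_le_stepMean (by omega) hhH ?_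
    rcases Nat.eq_zero_or_pos j with rfl | hj1
    · exact mem_good_one hs.1
    · exact (hr.tracked hs hc j hj1 (by omega)).mem_good
  have hdev := (abs_le.1 (hT.deviation_le h hhH)).1
  rw [wsum_excess] at hdev
  have ht := hr.minLoss_le h1 hk.le hs.1
  have hγη : p.η / 4 * amp p H r k ≤ p.γ * amp p H r k :=
    mul_le_mul_of_nonneg_right hr.valid.γ_ge hA.le
  -- Survival bounds the empirical excess by `γ amp`, so the biased regret is at most `2 γ amp + η
  -- amp / 4 ≤ 3 γ amp`.
  have hB : p.τ k * (popErr ν h - popErr ν hstar) ≤ 4 * p.γ * amp p H r k := by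
    have : 0 < p.γ * amp p H r k := mul_pos hr.valid.γ_pos hA
    linarith
  have hrec : recip p (k + 1) = 1 / p.τ k := by simp [recip, show k ≠ 0 by omega]
  have : popErr ν h - popErr ν hstar ≤ 4 * p.γ * amp p H r k * recip p (k + 1) := by
    rw [hrec, mul_one_div, le_div_iff₀ (by linarith)]
    linarith
  linarith

/-- If two survivors differ at `x`, one of them differs from `hstar` there, and it lies in the ball
of radius given by `disagree_le_of_mem_good`. So the region is inside `ballDisagreement` for that
radius. -/
theorem regionMass_le [IsFiniteMeasure ν] (hr : IsPath ν p H r) (hs : IsBest ν H hstar)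
    (hc : Concentrated ν p H r hstar) {k : ℕ} (hk : k < p.M) :
    regionMass ν p H r (k + 1) ≤ disagreementCoeff (ν.map Prod.fst) H hstar *
      (2 * popErrOn ν (region p H r (k + 1)) hstar
        + 4 * p.γ * amp p H r p.M * recip p (k + 1)) := by
  have hθ := disagreementCoeff_nonneg (ν.map Prod.fst) H hstar
  have hpe : 0 ≤ popErrOn ν (region p H r (k + 1)) hstar := measureReal_nonneg
  rcases Nat.eq_zero_or_pos k with rfl | h1
  · simp only [regionMass, recip, zero_add, le_refl, if_true, mul_zero, add_zero] at *
    positivity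
  · have hA := hr.amp_pos h1 hk.le
    have hAM := hr.amp_mono h1 hk.le le_rfl
    have hγ := hr.valid.γ_pos
    have hτ := hr.valid.τ_ge_three h1 hk.le
    have hrec : recip p (k + 1) = 1 / p.τ k := by simp [recip, show k ≠ 0 by omega]
    have hrpos : 0 < recip p (k + 1) := by rw [hrec]; positivity
    have hT := hr.tracked hs hc k h1 hk.le
    rw [regionMass, if_neg (by omega)]
    have hle := measureReal_le_disagreementCoeff_mul (ρ := ν.map Prod.fst) (H := H)
      (hstar := hstar) (s := region p H r (k + 1))
      (t := 2 * popErrOn ν (region p H r (k + 1)) hstar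
        + 4 * p.γ * amp p H r k * recip p (k + 1)) (by positivity) ?_
    · refine hle.trans (mul_le_mul_of_nonneg_left ?_ hθ)
      gcongr
    · have hgood : ∀ h ∈ good p H r (k + 1), ∀ x, hstar x ≠ h x →
          x ∈ ballDisagreement (ν.map Prod.fst) H hstar
            (2 * popErrOn ν (region p H r (k + 1)) hstar
              + 4 * p.γ * amp p H r k * recip p (k + 1)) := by
        intro h hh x hx
        have hhH := goodFrom_subset _ _ _ _ _ _ hh
        refine ⟨h, hhH, hx, ?_⟩
        have hset : MeasurableSet {x' | h x' ≠ hstar x'} :=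
          (measurableSet_eq_fun (hr.measurable h hhH) (hr.measurable _ hs.1)).compl
        rw [map_measureReal_apply measurable_fst hset]
        exact hr.disagree_le_of_mem_good hs hc h1 hk hh
      rintro x ⟨h, hh, h', hh', hx⟩
      by_cases e : hstar x = h x
      · exact hgood h' hh' x fun e' => hx (e.symm.trans e')
      · exact hgood h hh x e

theorem n_mul_errAvg (hp : p.Valid H) (r : Path 𝒳) (hstar : 𝒳 → Bool) :
    errAvg ν p H r p.M hstar * p.n
      = epochSum p (fun j => popErrOn ν (region p H r j) hstar) p.M := by
  have h3 := hp.τ_ge_three hp.one_le_M le_rfl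
  have e : ∑ j ∈ Finset.Icc 1 p.M, ((p.τ j : ℝ) - p.τ (j - 1)) * popErrOn ν (region p H r j) hstar
      = epochSum p (fun j => popErrOn ν (region p H r j) hstar) p.M := by
    rw [epochSum, Finset.range_eq_Ico]
    exact (Finset.sum_Ico_add' (fun j => ((p.τ j : ℝ) - p.τ (j - 1)) *
      popErrOn ν (region p H r j) hstar) 0 p.M 1).symm
  rw [errAvg, e, Params.n]
  field_simp

theorem epochSum_regionMass_le [IsFiniteMeasure ν] (hr : IsPath ν p H r) (hs : IsBest ν H hstar)
    (hc : Concentrated ν p H r hstar) :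
    epochSum p (regionMass ν p H r) p.M ≤ disagreementCoeff (ν.map Prod.fst) H hstar *
      (2 * (errAvg ν p H r p.M hstar * p.n) + 8 * p.γ * amp p H r p.M * Real.log p.n) := by
  have hθ := disagreementCoeff_nonneg (ν.map Prod.fst) H hstar
  have hMM := hr.valid.one_le_M
  have h := epochSum_le hr.valid le_rfl (f := regionMass ν p H r)
    (g := fun j => disagreementCoeff (ν.map Prod.fst) H hstar *
      (2 * popErrOn ν (region p H r j) hstar + 4 * p.γ * amp p H r p.M * recip p j))
    fun k hk => hr.regionMass_le hs hc hk
  rw [epochSum_const_mul, epochSum_add p (fun j => 2 * popErrOn ν (region p H r j) hstar),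
    epochSum_const_mul, epochSum_const_mul, ← n_mul_errAvg hr.valid] at h
  refine h.trans (mul_le_mul_of_nonneg_left ?_ hθ)
  have hrec := epochSum_recip_le hr.valid hMM le_rfl
  have hA := hr.amp_pos hMM le_rfl
  have hγ := hr.valid.γ_pos
  have := mul_le_mul_of_nonneg_left hrec (show 0 ≤ 4 * p.γ * amp p H r p.M by positivity)
  rw [Params.n] at *
  linarith

/-- In the first epoch errors count on the whole space, whereas `errAvg` only sees the disagreement
region. Its three examples cost at most `3`. -/
theorem epochSum_loss_le [IsProbabilityMeasure ν] (hr : IsPath ν p H r) (hs : IsBest ν H hstar)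
    (hc : Concentrated ν p H r hstar) :
    epochSum p (stepMean ν p H r (loss hstar)) p.M ≤ errAvg ν p H r p.M hstar * p.n + 3 := by
  have hMM := hr.valid.one_le_M
  have h := epochSum_le hr.valid le_rfl (f := stepMean ν p H r (loss hstar))
    (g := fun j => popErrOn ν (region p H r j) hstar + if j ≤ 1 then 1 else 0) ?_
  · refine h.trans ?_
    rw [epochSum_add p (fun j => popErrOn ν (region p H r j) hstar), ← n_mul_errAvg hr.valid]
    refine add_le_add le_rfl (le_of_eq ?_)
    rw [epochSum, Finset.sum_eq_single_of_mem 0 (Finset.mem_range.2 (by omega))]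
    · simp [hr.valid.τ_zero, hr.valid.τ_one]
    · intro b _ hb
      simp [hb]
  · intro k hk
    have hpe : 0 ≤ popErrOn ν (region p H r (k + 1)) hstar := measureReal_nonneg
    rcases Nat.eq_zero_or_pos k with rfl | h1
    · have := hr.stepMean_loss_le_one (ν := ν) hk hs.1
      simp only [zero_add, le_refl, if_true] at *
      linarith
    · rw [hr.stepMean_loss_eq h1 hk (hr.tracked hs hc k h1 hk.le).mem_good, if_neg (by omega),
        add_zero]

end IsPath

/-! ### Self-bounding estimate of the last radius, and the deterministic query count. -/

theorem sqrt_add_le_add_sqrt {a b : ℝ} (ha : 0 ≤ a) (hb : 0 ≤ b) : √(a + b) ≤ √a + √b := by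
  refine Real.sqrt_le_iff.2 ⟨by positivity, ?_⟩
  have h : 0 ≤ √a * √b := by positivity
  nlinarith [Real.sq_sqrt ha, Real.sq_sqrt hb]

/-- Constant in the bound on the radius of the last epoch. -/
def ampConst (c₁ c₂ γ : ℝ) : ℝ :=
  14 * c₁ + 2 * c₁ * (1 + 32 * (9 + 4 * γ ^ 2 * c₁ ^ 2 + 24 * γ * c₂)) + 64 * c₂

/-- Solution of the self-bounding inequality for the weighted loss of the best classifier. -/
theorem amp_le_of_self_bound {c₁ c₂ γ η A T t X L g : ℝ} (hc₁ : 0 < c₁) (hc₂ : 0 < c₂)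
    (hη : 0 < η) (hγ : η ≤ 4 * γ) (hX : 0 ≤ X) (hL : 1 ≤ L) (hg : 1 ≤ g) (ht0 : 0 ≤ t)
    (htT : t ≤ T) (hA : A = c₁ * √(32 * (L + g) * t) + 32 * c₂ * (L + g) * g)
    (hT : T ≤ 3 / 2 * (X + 3) + 8 / 100 * (η * A)) :
    A ≤ ampConst c₁ c₂ γ * (g ^ 2 * (√(X * L) + L)) := by
  have hγ0 : 0 < γ := by linarith
  set ℓ := L + g with hℓ
  have hℓ1 : 1 ≤ ℓ := by linarith
  have hℓ2 : ℓ ≤ 2 * (L * g) := by nlinarith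
  set D := 9 + 4 * γ ^ 2 * c₁ ^ 2 + 24 * γ * c₂ with hD
  have hD0 : 0 < D := by positivity
  have hT0 : 0 ≤ T := ht0.trans htT
  set S := √(32 * ℓ * T) with hS
  have hS0 : 0 ≤ S := Real.sqrt_nonneg _
  have hSS : S ^ 2 = 32 * ℓ * T := Real.sq_sqrt (by positivity)
  have hA1 : A ≤ c₁ * S + 32 * c₂ * ℓ * g := by
    have : √(32 * ℓ * t) ≤ S := Real.sqrt_le_sqrt (by gcongr)
    rw [hA]
    gcongr
  have hA0 : 0 ≤ A := by rw [hA]; positivity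
  have hηA : η * A ≤ 4 * γ * (c₁ * S + 32 * c₂ * ℓ * g) := by gcongr
  have hℓg : 1 ≤ ℓ * g := by nlinarith
  -- The term in `S`, of order `√(ℓ T)`, is split by AM-GM so that `T / 2` moves to the left.
  -- Doubling the rest gives the summands `9`, `4 γ² c₁²` and `24 γ c₂` of `D`.
  have hTb : T ≤ 3 * X + D * (ℓ * g) := by
    have hamgm : 8 / 100 * (4 * γ * c₁) * S ≤ T / 2 + 2 * γ ^ 2 * c₁ ^ 2 * ℓ := by
      have hsq := sq_nonneg (S - 32 * ℓ * (8 / 100 * (4 * γ * c₁)))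
      have e : (S - 32 * ℓ * (8 / 100 * (4 * γ * c₁))) ^ 2
          = 64 * ℓ * (T / 2 + 16 * ℓ * (8 / 100 * (4 * γ * c₁)) ^ 2
            - 8 / 100 * (4 * γ * c₁) * S) := by
        rw [sub_sq, hSS]; ring
      rw [e] at hsq
      have h2 := nonneg_of_mul_nonneg_right hsq (by positivity)
      have h3 : 16 * ℓ * (8 / 100 * (4 * γ * c₁)) ^ 2 ≤ 2 * γ ^ 2 * c₁ ^ 2 * ℓ := by
        have : 0 ≤ γ ^ 2 * c₁ ^ 2 * ℓ := by positivity
        nlinarith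
      linarith
    have h4 : γ ^ 2 * c₁ ^ 2 * ℓ ≤ γ ^ 2 * c₁ ^ 2 * (ℓ * g) := by
      have : ℓ ≤ ℓ * g := le_mul_of_one_le_right (by linarith) hg
      gcongr
    have h5 : 0 ≤ γ * c₂ * (ℓ * g) := by positivity
    rw [hD]
    linarith
  have hSle : S ≤ 14 * (g ^ 2 * √(X * L)) + (1 + 32 * D) * (2 * (L * g ^ 2)) := by
    have h1 : 32 * ℓ * T ≤ 192 * (g * (X * L)) + 32 * D * (ℓ ^ 2 * g) := by
      have a1 : 32 * ℓ * T ≤ 32 * ℓ * (3 * X + D * (ℓ * g)) := by gcongr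
      have a2 : 96 * X * ℓ ≤ 96 * X * (2 * (L * g)) := by gcongr
      linarith
    -- The constant comes from `192 ≤ 14²`.
    have h2 : √(192 * (g * (X * L))) ≤ 14 * (g ^ 2 * √(X * L)) := by
      refine Real.sqrt_le_iff.2 ⟨by positivity, ?_⟩
      have hXL : √(X * L) ^ 2 = X * L := Real.sq_sqrt (by positivity)
      have hg4 : g ≤ g ^ 4 := le_self_pow₀ hg (by norm_num)
      have hXL0 : 0 ≤ X * L := by positivity
      calc 192 * (g * (X * L)) ≤ 196 * (g ^ 4 * (X * L)) := by gcongr; norm_num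
        _ = _ := by rw [mul_pow, mul_pow, hXL]; ring
    have h3 : √(32 * D * (ℓ ^ 2 * g)) ≤ (1 + 32 * D) * (2 * (L * g ^ 2)) := by
      have hb : ℓ * g ≤ 2 * (L * g ^ 2) := by nlinarith
      refine le_trans ?_ (mul_le_mul_of_nonneg_left hb (by positivity))
      refine Real.sqrt_le_iff.2 ⟨by positivity, ?_⟩
      have hd : 32 * D ≤ (1 + 32 * D) ^ 2 := by nlinarith
      have hg2 : g ≤ g ^ 2 := le_self_pow₀ hg (by norm_num)
      calc 32 * D * (ℓ ^ 2 * g) ≤ (1 + 32 * D) ^ 2 * (ℓ ^ 2 * g ^ 2) := by gcongr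
        _ = _ := by ring
    calc S ≤ √(192 * (g * (X * L)) + 32 * D * (ℓ ^ 2 * g)) := Real.sqrt_le_sqrt h1
      _ ≤ √(192 * (g * (X * L))) + √(32 * D * (ℓ ^ 2 * g)) :=
          sqrt_add_le_add_sqrt (by positivity) (by positivity)
      _ ≤ _ := add_le_add h2 h3
  have hfin : c₁ * S + 32 * c₂ * ℓ * g
      ≤ c₁ * (14 * (g ^ 2 * √(X * L)) + (1 + 32 * D) * (2 * (L * g ^ 2)))
        + 32 * c₂ * (2 * (L * g)) * g := by gcongr
  refine hA1.trans (hfin.trans ?_)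
  have q1 : 0 ≤ c₁ * (g ^ 2 * L) := by positivity
  have q2 : 0 ≤ g ^ 2 * √(X * L) * (2 * c₁ * (1 + 32 * D) + 64 * c₂) := by positivity
  rw [ampConst, ← hD]
  linarith

theorem IsPath.amp_last_le [MeasurableSpace 𝒳] {ν : Measure (𝒳 × Bool)} [IsProbabilityMeasure ν]
    {p : Params} {H : Finset (𝒳 → Bool)} {r : Path 𝒳} {hstar : 𝒳 → Bool}
    (hr : IsPath ν p H r) (hs : IsBest ν H hstar) (hc : Concentrated ν p H r hstar) :
    amp p H r p.M ≤ ampConst p.c₁ p.c₂ p.γ * (Real.log p.n ^ 2 *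
      (√(errAvg ν p H r p.M hstar * p.n * Real.log (H.card / p.δ))
        + Real.log (H.card / p.δ))) := by
  have hMM := hr.valid.one_le_M
  have hdev := (abs_le.1 (hr.loss_deviation_le hs.1 hc hMM le_rfl)).2
  have hE := hr.epochSum_loss_le hs hc
  have hX : 0 ≤ errAvg ν p H r p.M hstar * p.n := by
    rw [n_mul_errAvg hr.valid]
    exact epochSum_nonneg hr.valid le_rfl fun k _ => measureReal_nonneg
  refine amp_le_of_self_bound (η := p.η) hr.valid.c₁_pos hr.valid.c₂_pos (by linarith [hr.valid.η_ge])
    (by linarith [hr.valid.γ_ge]) hX hr.log_card_ge_one (hr.valid.log_τ_ge_one hMM le_rfl)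
    (hr.minLoss_nonneg le_rfl) (hr.minLoss_le hMM le_rfl hs.1) (hr.amp_eq hMM le_rfl) ?_
  linarith

theorem numQueries_le {p : Params} {H : Finset (𝒳 → Bool)} (hp : p.Valid H) (r : Path 𝒳)
    (hq : ∀ m, 1 ≤ m → m < p.M → ∀ i, p.τ m ≤ i → i < p.τ (m + 1) →
      r.x (i + 1) ∉ region p H r (m + 1) → r.q (i + 1) = false) :
    (numQueries p r : ℝ) ≤ 3 + regionCount p H r := by
  classical
  have e : (numQueries p r : ℝ) = ∑ i ∈ Finset.range p.n,
      if r.q (i + 1) = true then (1 : ℝ) else 0 := by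
    rw [numQueries, Finset.card_filter]
    push_cast
    rw [Finset.range_eq_Ico, Finset.sum_Ico_add' (fun i => if r.q i = true then (1 : ℝ) else 0)]
    rfl
  have h3 : ∑ i ∈ Finset.range p.n, (if i < 3 then (1 : ℝ) else 0) ≤ 3 := by
    rw [Finset.sum_boole]
    have : ((Finset.range p.n).filter (· < 3)).card ≤ (Finset.range 3).card :=
      Finset.card_le_card fun i hi => Finset.mem_range.2 (Finset.mem_filter.1 hi).2
    rw [Finset.card_range] at this
    exact_mod_cast this
  rw [e, regionCount]
  refine le_trans (Finset.sum_le_sum fun i hi => ?_) ((Finset.sum_add_distrib).trans_le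
    (add_le_add h3 le_rfl))
  obtain ⟨hk, h1, h2⟩ := hp.epoch_spec (Finset.mem_range.1 hi)
  by_cases h0 : p.epoch i = 0
  · have : i < 3 := by rw [h0, zero_add, hp.τ_one] at h2; exact h2
    rw [if_pos this]
    split_ifs <;> norm_num
  · by_cases hx : r.x (i + 1) ∈ region p H r (p.epoch i + 1)
    · rw [if_pos (⟨by omega, hx⟩ : 1 ≤ p.epoch i ∧ r.x (i + 1) ∈ region p H r (p.epoch i + 1))]
      split_ifs <;> norm_num
    · rw [hq _ (by omega) hk i h1 h2 hx]
      simp only [Bool.false_eq_true, if_false]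
      split_ifs <;> norm_num

/-! ### Probability of concentration -/

theorem epochSum_neg (p : Params) (f : ℕ → ℝ) (m : ℕ) :
    epochSum p (fun k => -f k) m = -epochSum p f m := by
  simp only [epochSum, mul_neg, Finset.sum_neg_distrib]

theorem stepMean_neg [MeasurableSpace 𝒳] (ν : Measure (𝒳 × Bool)) (p : Params)
    (H : Finset (𝒳 → Bool)) (r : Path 𝒳) (φ : 𝒳 × Bool → ℝ) :
    stepMean ν p H r (fun z => -φ z) = fun k => -stepMean ν p H r φ k := by
  funext k
  rw [stepMean, stepMean, ← integral_neg]
  refine integral_congr_ae (Filter.Eventually.of_forall fun z => ?_)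
  simp only
  split_ifs <;> rfl

theorem stepVar_neg [MeasurableSpace 𝒳] (ν : Measure (𝒳 × Bool)) (p : Params)
    (H : Finset (𝒳 → Bool)) (r : Path 𝒳) (φ : 𝒳 × Bool → ℝ) :
    stepVar ν p H r (fun z => -φ z) = stepVar ν p H r φ := by
  funext k
  simp only [stepVar, neg_sq]

theorem tilt_mem_unit {p : Params} {H : Finset (𝒳 → Bool)} (hp : p.Valid H) {N : ℕ} (hN : 1 ≤ N) :
    0 < tilt p N ∧ tilt p N ≤ 1 := by
  have hc := hp.c₂_pos
  have hη := hp.η_ge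
  have hc2 : 3456 ≤ p.c₂ := by linarith [hp.c₂_ge_c₁, hp.c₁_ge_four]
  have hN' : (1 : ℝ) ≤ N := by exact_mod_cast hN
  have h : 100 ≤ p.c₂ * p.η * N := by
    have : 100 ≤ p.c₂ * p.η := by nlinarith
    nlinarith
  refine ⟨by unfold tilt; positivity, ?_⟩
  rw [tilt, div_le_one (by linarith)]
  exact h

section

variable [MeasurableSpace 𝒳] {Ω : Type v} {mΩ : MeasurableSpace Ω} {μ : Measure Ω}
  {ℱ : Filtration ℕ mΩ} {ν : Measure (𝒳 × Bool)} {p : Params} {H : Finset (𝒳 → Bool)}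
  {R : Ω → Path 𝒳}

/-- The one-sided tail is applied to `φ` and to `-φ`, which share the same `stepVar`, at level `4
logTerm`. Dividing by the tilt gives the form in `ConcentratedFor`. -/
theorem IsRun.measureReal_not_concentratedFor_le [IsProbabilityMeasure μ] (hp : p.Valid H)
    (hH : ∀ h ∈ H, Measurable h) (hR : IsRun μ ℱ ν p H R) {φ : 𝒳 × Bool → ℝ} (hφ : Measurable φ)
    (hφ1 : ∀ z, |φ z| ≤ 1) {m N : ℕ} (hm : m ≤ p.M) (hN : 1 ≤ N) :
    μ.real {ω | ¬ ConcentratedFor ν p H (R ω) φ m N}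
      ≤ 2 * Real.exp (-(4 * logTerm p H m)) := by
  obtain ⟨hl, hl1⟩ := tilt_mem_unit hp hN
  have h1 := hR.measure_wsum_deviation_le hp hH hφ hφ1 hl hl1 hm (4 * logTerm p H m)
  have h2 := hR.measure_wsum_deviation_le hp hH hφ.neg (fun z => by simpa using hφ1 z) hl hl1 hm
    (4 * logTerm p H m)
  have g1 := ENNReal.toReal_le_of_le_ofReal (Real.exp_pos _).le h1
  have g2 := ENNReal.toReal_le_of_le_ofReal (Real.exp_pos _).le h2
  rw [two_mul]
  refine le_trans ?_ ((measureReal_union_le _ _).trans (add_le_add g1 g2))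
  refine measureReal_mono (fun ω hω => ?_) (measure_ne_top _ _)
  obtain ⟨hf, hdev⟩ := Classical.not_imp.1 (show ¬ (_ → _) from hω)
  have key : ∀ d : ℝ, tilt p N * epochSum p (stepVar ν p H (R ω) φ) m
      + 4 * logTerm p H m / tilt p N < d →
      4 * logTerm p H m ≤ tilt p N * (d - tilt p N * epochSum p (stepVar ν p H (R ω) φ) m) := by
    intro d hd
    have := mul_lt_mul_of_pos_left (lt_sub_iff_add_lt'.2 hd) hl
    rw [mul_div_cancel₀ _ hl.ne'] at this
    exact this.le
  rcases lt_abs.1 (not_le.1 hdev) with h | h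
  · exact Or.inl ⟨hf, key _ h⟩
  · refine Or.inr ⟨hf, ?_⟩
    have e1 := wsum_neg φ (sample p H (R ω) m)
    have e2 := stepMean_neg ν p H (R ω) φ
    have e3 := stepVar_neg ν p H (R ω) φ
    change _ ≤ tilt p N * (wsum (fun z => -φ z) _ - epochSum p (stepMean ν p H (R ω)
      (fun z => -φ z)) m - tilt p N * epochSum p (stepVar ν p H (R ω) (fun z => -φ z)) m)
    rw [e1, e2, e3, epochSum_neg]
    have := key _ h
    rwa [neg_sub', sub_neg_eq_add, ← sub_neg_eq_add (-wsum _ _)] at this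

theorem sum_inv_consecutive_le (M : ℕ) :
    ∑ m ∈ Finset.Icc 1 M, 1 / (((m : ℝ) + 1) * (m + 2)) ≤ 1 / 2 := by
  have h : ∀ M : ℕ, ∑ m ∈ Finset.Icc 1 M, 1 / (((m : ℝ) + 1) * (m + 2))
      = 1 / 2 - 1 / ((M : ℝ) + 2) := by
    intro M
    induction M with
    | zero => simp
    | succ M ih =>
      rw [Finset.sum_Icc_succ_top (by omega), ih]
      push_cast
      field_simp
      ring
  rw [h]
  have : 0 ≤ 1 / ((M : ℝ) + 2) := by positivity
  linarith

/-- Union bound over at most `34 τ_m` tilts, `2 |H|` functions and two signs. With `a = |H| / δ`,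
each one-sided tail is `1 / (a τ_m)⁴`, so epoch `m` costs `136 δ / (a τ_m)³`. Since `a > 13` and
`τ_m ≥ m + 2`, this is at most `δ / ((m + 1) (m + 2))`, which telescopes. -/
theorem IsRun.measureReal_not_concentrated_le [IsProbabilityMeasure μ] (hp : p.Valid H)
    (hH : ∀ h ∈ H, Measurable h) (hR : IsRun μ ℱ ν p H R) (hδ : 0 < p.δ)
    (hlarge : √192 < H.card / p.δ) {hstar : 𝒳 → Bool} (hs : hstar ∈ H) :
    μ.real {ω | ¬ Concentrated ν p H (R ω) hstar} ≤ p.δ / 2 := by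
  classical
  set Φ : Finset (𝒳 × Bool → ℝ) := insert (loss hstar) (H.image fun h => excess h hstar) with hΦ
  have hΦm : ∀ φ ∈ Φ, Measurable φ ∧ ∀ z, |φ z| ≤ 1 := by
    intro φ hφ
    rcases Finset.mem_insert.1 hφ with rfl | hφ
    · exact ⟨measurable_loss (hH _ hs), abs_loss_le_one _⟩
    · obtain ⟨h, hh, rfl⟩ := Finset.mem_image.1 hφ
      exact ⟨measurable_excess (hH h hh) (hH _ hs), abs_excess_le_one h hstar⟩
  have hcard : (Φ.card : ℝ) ≤ 2 * H.card := by
    have h1 : Φ.card ≤ H.card + 1 :=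
      (Finset.card_insert_le _ _).trans (Nat.add_le_add_right Finset.card_image_le 1)
    have h2 : 1 ≤ H.card := Finset.card_pos.2 ⟨_, hs⟩
    exact_mod_cast (by omega : Φ.card ≤ 2 * H.card)
  have hH1 : (1 : ℝ) ≤ H.card := by exact_mod_cast Finset.card_pos.2 ⟨_, hs⟩
  have ha : 13 ≤ H.card / p.δ := by
    refine le_trans ?_ hlarge.le
    exact Real.le_sqrt_of_sq_le (by norm_num)
  set a := (H.card : ℝ) / p.δ with ha'
  have hsub : {ω | ¬ Concentrated ν p H (R ω) hstar} ⊆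
      ⋃ m ∈ Finset.Icc 1 p.M, ⋃ N ∈ Finset.Icc 1 (34 * p.τ m), ⋃ φ ∈ Φ,
        {ω | ¬ ConcentratedFor ν p H (R ω) φ m N} := by
    intro ω hω
    by_contra hcon
    simp only [Set.mem_iUnion, Finset.mem_Icc, Set.mem_ofPred_eq, not_exists, not_not] at hcon
    refine hω fun m h1 hm N hN1 hN2 => ⟨fun h hh => ?_, ?_⟩
    · exact hcon m ⟨h1, hm⟩ N ⟨hN1, hN2⟩ _
        (Finset.mem_insert_of_mem (Finset.mem_image_of_mem _ hh))
    · exact hcon m ⟨h1, hm⟩ N ⟨hN1, hN2⟩ _ (Finset.mem_insert_self _ _)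
  have hinner : ∀ m ∈ Finset.Icc 1 p.M, μ.real (⋃ N ∈ Finset.Icc 1 (34 * p.τ m), ⋃ φ ∈ Φ,
      {ω | ¬ ConcentratedFor ν p H (R ω) φ m N}) ≤ p.δ * (1 / (((m : ℝ) + 1) * (m + 2))) := by
    intro m hm
    obtain ⟨h1, hm⟩ := Finset.mem_Icc.1 hm
    have hτ : ((m : ℝ) + 2) ≤ p.τ m := by exact_mod_cast hp.τ_ge h1 hm
    have hτ3 := hp.τ_ge_three h1 hm
    have hexp : Real.exp (-(4 * logTerm p H m)) = 1 / (a ^ 4 * (p.τ m : ℝ) ^ 4) := by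
      rw [logTerm, Real.exp_neg, show 4 * (Real.log (H.card / p.δ) + Real.log (p.τ m))
        = (4 : ℕ) * Real.log (a * p.τ m) by
          rw [Real.log_mul (by positivity) (by positivity)]; push_cast; ring,
        Real.exp_nat_mul, Real.exp_log (by positivity), mul_pow, one_div]
    calc μ.real (⋃ N ∈ Finset.Icc 1 (34 * p.τ m), ⋃ φ ∈ Φ,
          {ω | ¬ ConcentratedFor ν p H (R ω) φ m N})
        ≤ ∑ N ∈ Finset.Icc 1 (34 * p.τ m), ∑ φ ∈ Φ, 2 * Real.exp (-(4 * logTerm p H m)) := by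
          refine (measureReal_biUnion_finset_le _ _).trans (Finset.sum_le_sum fun N hN => ?_)
          refine (measureReal_biUnion_finset_le _ _).trans (Finset.sum_le_sum fun φ hφ => ?_)
          exact hR.measureReal_not_concentratedFor_le hp hH (hΦm φ hφ).1 (hΦm φ hφ).2 hm
            (Finset.mem_Icc.1 hN).1
      _ = 34 * p.τ m * (Φ.card * (2 * (1 / (a ^ 4 * (p.τ m : ℝ) ^ 4)))) := by
          rw [hexp]
          simp
      _ ≤ 34 * p.τ m * (2 * H.card * (2 * (1 / (a ^ 4 * (p.τ m : ℝ) ^ 4)))) := by gcongr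
      _ = p.δ * (136 / a ^ 3 * (1 / (p.τ m : ℝ) ^ 3)) := by
          rw [ha']
          field_simp
          norm_num
      _ ≤ p.δ * (1 * (1 / (((m : ℝ) + 1) * (m + 2)))) := by
          have e1 : 136 / a ^ 3 ≤ 1 := by
            rw [div_le_one (by positivity)]
            calc (136 : ℝ) ≤ 13 ^ 3 := by norm_num
              _ ≤ a ^ 3 := by gcongr
          have e2 : ((m : ℝ) + 1) * (m + 2) ≤ (p.τ m : ℝ) ^ 3 := by
            calc ((m : ℝ) + 1) * (m + 2) ≤ p.τ m * p.τ m := by gcongr; linarith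
              _ ≤ p.τ m * p.τ m * p.τ m := le_mul_of_one_le_right (by positivity) (by linarith)
              _ = _ := by ring
          have e3 := one_div_le_one_div_of_le (by positivity) e2
          gcongr
      _ = _ := by rw [one_mul]
  calc μ.real {ω | ¬ Concentrated ν p H (R ω) hstar}
      ≤ _ := measureReal_mono hsub (measure_ne_top _ _)
    _ ≤ ∑ m ∈ Finset.Icc 1 p.M, p.δ * (1 / (((m : ℝ) + 1) * (m + 2))) :=
        (measureReal_biUnion_finset_le _ _).trans (Finset.sum_le_sum hinner)
    _ = p.δ * ∑ m ∈ Finset.Icc 1 p.M, 1 / (((m : ℝ) + 1) * (m + 2)) := by rw [Finset.mul_sum]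
    _ ≤ p.δ * (1 / 2) := by gcongr; exact sum_inv_consecutive_le p.M
    _ = p.δ / 2 := by ring

theorem IsRun.isPath (hp : p.Valid H) (hH : ∀ h ∈ H, Measurable h) (hR : IsRun μ ℱ ν p H R)
    (hδ : 0 < p.δ) (hlarge : √192 < H.card / p.δ) (ω : Ω) : IsPath ν p H (R ω) where
  valid := hp
  measurable := hH
  δ_pos := hδ
  card_large := hlarge
  erm_mem m h1 hm := hR.erm_mem m h1 hm ω
  erm_min m h1 hm := hR.erm_min m h1 hm ω
  feasible m h1 hm := (hR.solves m h1 hm ω).1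
  query_first i h1 h3 := hR.query_first i h1 h3 ω

end

/-! ### Combination of the estimates. -/

theorem one_sub_le_measureReal {Ω : Type v} [MeasurableSpace Ω] {μ : Measure Ω}
    [IsProbabilityMeasure μ] {s t u : Set Ω} {a : ℝ} (ha : μ.real s + μ.real t ≤ a)
    (h : ∀ ω ∉ s ∪ t, ω ∈ u) : 1 - a ≤ μ.real u := by
  -- Only subadditivity is used, so none of the three events has to be measurable.
  have hcover : μ.real Set.univ ≤ μ.real ((s ∪ t) ∪ u) :=
    measureReal_mono (fun ω _ => or_iff_not_imp_left.2 (h ω)) (measure_ne_top _ _)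
  have h1 := measureReal_union_le (μ := μ) (s ∪ t) u
  have h2 := measureReal_union_le (μ := μ) s t
  rw [probReal_univ] at hcover
  linarith

/-- The constants: `3/2 · 2 = 3 ≤ 4` for the leading term and `3/2 · 8 γ = 12 γ` for the radius. The
three initial queries fit into the last term, as `3 + 2 L ≤ 4 L` for `L = log (8 / δ) ≥ 2`. -/
theorem queries_le_of_concentrated [MeasurableSpace 𝒳] {ν : Measure (𝒳 × Bool)}
    [IsProbabilityMeasure ν] {p : Params} {H : Finset (𝒳 → Bool)} {r : Path 𝒳} {hstar : 𝒳 → Bool}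
    (hr : IsPath ν p H r) (hs : IsBest ν H hstar) (hc : Concentrated ν p H r hstar)
    (hδ : p.δ < 1 / Real.exp 1)
    (hq : ∀ m, 1 ≤ m → m < p.M → ∀ i, p.τ m ≤ i → i < p.τ (m + 1) →
      r.x (i + 1) ∉ region p H r (m + 1) → r.q (i + 1) = false)
    (hcount : regionCount p H r
      < 3 / 2 * epochSum p (regionMass ν p H r) p.M + 2 * Real.log (8 / p.δ)) :
    (numQueries p r : ℝ) ≤
      4 * disagreementCoeff (ν.map Prod.fst) H hstar * errAvg ν p H r p.M hstar * p.n
      + disagreementCoeff (ν.map Prod.fst) H hstar *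
          (12 * p.γ * ampConst p.c₁ p.c₂ p.γ * Real.log p.n ^ 3 *
            (√(p.n * errAvg ν p H r p.M hstar * Real.log (H.card / p.δ))
              + Real.log (H.card / p.δ)))
      + 4 * Real.log (8 * Real.log p.n / p.δ) := by
  have hMM := hr.valid.one_le_M
  have hθ := IsPath.disagreementCoeff_nonneg (ν.map Prod.fst) H hstar
  have hX : 0 ≤ errAvg ν p H r p.M hstar * p.n := by
    rw [IsPath.n_mul_errAvg hr.valid]
    exact epochSum_nonneg hr.valid le_rfl fun k _ => measureReal_nonneg
  have hlog : 1 ≤ Real.log p.n := hr.valid.log_τ_ge_one hMM le_rfl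
  have hγ := hr.valid.γ_pos
  have hδ0 := hr.δ_pos
  have hmass := hr.epochSum_regionMass_le hs hc
  have hamp := hr.amp_last_le hs hc
  have hnum := numQueries_le hr.valid r hq
  rw [mul_comm (p.n : ℝ) (errAvg ν p H r p.M hstar)]
  set θ := disagreementCoeff (ν.map Prod.fst) H hstar
  set G := √(errAvg ν p H r p.M hstar * p.n * Real.log (H.card / p.δ)) + Real.log (H.card / p.δ)
  have hmass' : epochSum p (regionMass ν p H r) p.M ≤ θ * (2 * (errAvg ν p H r p.M hstar * p.n)
      + 8 * p.γ * (ampConst p.c₁ p.c₂ p.γ * (Real.log p.n ^ 2 * G)) * Real.log p.n) := by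
    refine hmass.trans (mul_le_mul_of_nonneg_left ?_ hθ)
    gcongr
  -- From `δ < 1 / e`, `8 / δ ≥ 8 e ≥ 3 e ≥ e²`, which gives the logarithm the lower bound `2`.
  have hnine : Real.exp 1 * 3 ≤ 8 / p.δ := by
    rw [lt_div_iff₀ (Real.exp_pos 1)] at hδ
    rw [le_div_iff₀ hδ0]
    linarith
  have hlog8 : 2 ≤ Real.log (8 / p.δ) := by
    rw [Real.le_log_iff_exp_le (by positivity)]
    refine le_trans ?_ hnine
    rw [show (2 : ℝ) = 1 + 1 by norm_num, Real.exp_add]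
    gcongr
    linarith [Real.exp_one_lt_d9]
  have hlogmono : Real.log (8 / p.δ) ≤ Real.log (8 * Real.log p.n / p.δ) := by
    refine Real.log_le_log (by positivity) ?_
    gcongr
    linarith
  have hθX := mul_nonneg hθ hX
  linarith

end
end ActiveCover

theorem theorem2 :
    ∃ k : ℕ, ∀ c₁ c₂ γ : ℝ, ∃ C : ℝ,
      ∀ (𝒳 : Type*) (_ : MeasurableSpace 𝒳)
        (ν : Measure (𝒳 × Bool)) (_ : IsProbabilityMeasure ν)
        (H : Finset (𝒳 → Bool)) (_ : ∀ h ∈ H, Measurable h)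
        (hstar : 𝒳 → Bool) (_ : ActiveCover.IsBest ν H hstar)
        (p : ActiveCover.Params) (_ : p.Valid H)
        (_ : p.c₁ = c₁) (_ : p.c₂ = c₂) (_ : p.γ = γ)
        (_ : 0 < p.δ) (_ : p.δ < 1 / Real.exp 1) (_ : √192 < H.card / p.δ)
        (Ω : Type*) (mΩ : MeasurableSpace Ω) (μ : Measure Ω) (_ : IsProbabilityMeasure μ)
        (ℱ : Filtration ℕ mΩ) (R : Ω → ActiveCover.Path 𝒳)
        (_ : ActiveCover.IsRun μ ℱ ν p H R),
        1 - p.δ ≤ μ.real {ω |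
          (ActiveCover.numQueries p (R ω) : ℝ) ≤
            4 * ActiveCover.disagreementCoeff (ν.map Prod.fst) H hstar *
                ActiveCover.errAvg ν p H (R ω) p.M hstar * p.n
            + ActiveCover.disagreementCoeff (ν.map Prod.fst) H hstar *
                (C * Real.log p.n ^ k *
                  (√(p.n * ActiveCover.errAvg ν p H (R ω) p.M hstar *
                        Real.log (H.card / p.δ))
                    + Real.log (H.card / p.δ)))
            + 4 * Real.log (8 * Real.log p.n / p.δ)} := by
  -- Two of the three logarithms come from `amp`, the third from the sum of the reciprocals `1 /
  -- τ_k` over examples.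
  refine ⟨3, fun c₁ c₂ γ => ⟨12 * γ * ActiveCover.ampConst c₁ c₂ γ, ?_⟩⟩
  rintro 𝒳 _ ν _ H hH hstar hs p hp rfl rfl rfl hδ hδe hlarge Ω mΩ μ _ ℱ R hR
  have hbad := hR.measureReal_not_concentrated_le hp hH hδ hlarge hs.1
  have hcount : μ.real {ω | 3 / 2 * ActiveCover.epochSum p (ActiveCover.regionMass ν p H (R ω)) p.M
      + 2 * Real.log (8 / p.δ) ≤ ActiveCover.regionCount p H (R ω)} ≤ p.δ / 8 := by
    refine (ENNReal.toReal_le_of_le_ofReal (Real.exp_pos _).le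
      (hR.measure_regionCount_le hp hH (Real.log (8 / p.δ)))).trans_eq ?_
    rw [Real.exp_neg, Real.exp_log (by positivity), inv_div]
  -- The failure probabilities add up to `δ / 2 + δ / 8 ≤ δ`.
  refine ActiveCover.one_sub_le_measureReal
    ((add_le_add hbad hcount).trans (by linarith)) fun ω hω => ?_
  rw [Set.mem_union, not_or] at hω
  exact ActiveCover.queries_le_of_concentrated (hR.isPath hp hH hδ hlarge ω) hs
    (not_not.1 hω.1) hδe (fun m h1 hm i hi1 hi2 => hR.query_outside m h1 hm i hi1 hi2 ω)
    (not_le.1 hω.2)
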